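/- Let $S\in\{\tfrac12,1,\tfrac32,\dots\}$. Let $(\Lambda,\mathcal E)$ be a finite simple graph, $\beta>0$ and $u\in[0,1]$. Loop model. Let $\rho_u$ be the law of the Poisson point process $\omega$ on $\mathcal E\times[0,\beta]$ consisting of independent crosses (intensity $u$) and double bars (intensity $1-u$). For (almost every) $\omega$, the loop containing $(x,t)\in\Lambda\times[0,\beta]_{\mathrm{per}}$ is the closed trajectory obtained by moving vertically from $(x,t)$, going across to the other endpoint of the edge at each transition met, and continuing in the same vertical direction at a cross and in the opposite vertical direction at a double bar. Loops are identified when they have the same support; $\mathcal L(\omega)$ is the set of loops, and $L_{(x,t)}$ is the total length of the vertical lines of the loop containing $(x,t)$. Let $\mathbb E$ be the expectation with respect to the probability measure $\frac1Y(2S+1)^{|\mathcal L(\omega)|}\,d\rho_u(\omega)$, where $Y=\int(2S+1)^{|\mathcal L(\omega)|}\,d\rho_u(\omega)$. Quantum model. On $\bigotimes_{x\in\Lambda}\mathbb C^{2S+1}$, let $S^3_x$ be the third spin operator at $x$, with $S^3|a\rangle=a|a\rangle$ for $a\in\{-S,-S+1,\dots,S\}$, and let $$H=-\sum_{\{x,y\}\in\mathcal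 E}\bigl(uT_{xy}+(1-u)Q_{xy}-1\bigr),\qquad T_{xy}|a,b\rangle=|b,a\rangle,\qquad \langle a,b|Q_{xy}|c,d\rangle=\delta_{a,b}\delta_{c,d}.$$ Write $\langle A\rangle=\operatorname{Tr}(A\,e^{-\beta H})/\operatorname{Tr}e^{-\beta H}$. Theorem. (a) The total length $\sum_{x\in\Lambda}L_{(x,0)}$ is integrable, the function $h\mapsto\log\operatorname{Tr}e^{-\beta H+\beta h\sum_{x}S^3_x}$ is twice continuously differentiable near $0$, and $$\mathbb E\Bigl(\sum_{x\in\Lambda}L_{(x,0)}\Bigr)=\frac{3}{\beta S(S+1)}\,\frac{\partial^2}{\partial h^2}\log\operatorname{Tr}e^{-\beta H+\beta h\sum_{x\in\Lambda}S^3_x}\Big|_{h=0}.$$ (b) There is a constant $K$ that depends on $S$ but not on $\beta,u,\Lambda,\mathcal E$ such that $$\frac{3\beta}{S(S+1)}\sum_{x,y\in\Lambda}\langle S^3_xS^3_y\rangle-K\beta\sqrt{(1-u)|\mathcal E|}\,\sqrt{\mathbb E\Bigl(\sum_{x\in\Lambda}L_{(x,0)}\Bigr)}\le\mathbb E\Bigl(\sum_{x\in\Lambda}L_{(x,0)}\Bigr)\le\frac{3\beta}{S(S+1)}\sum_{x,y\in\Lambda}\langle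 S^3_xS^3_y\rangle.$$ -/

import Mathlib

open MeasureTheory

namespace LoopModel

/-! ### Finite Poisson point processes -/

/-- A finite configuration of points: a finite subset of `X`. -/
@[ext]
structure Configuration (X : Type*) where
  points : Finset X

namespace Configuration

/-- Forget the labels of a finite family of points. -/
noncomputable def ofFamily {X : Type*} {k : ℕ} (f : Fin k → X) : Configuration X := by
  classical exact ⟨Finset.univ.image f⟩

/-- The `σ`-algebra inherited from `X`: a set of configurations is measurable if and only if, for
every `k`, it corresponds to a measurable set of `k`-tuples of points. (Mathlib's `σ`-algebra on
`Finset X` is a different one; it only sees the events `a ∈ ω` for fixed `a`.) -/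
noncomputable instance {X : Type*} [MeasurableSpace X] : MeasurableSpace (Configuration X) :=
  ⨅ k : ℕ, MeasurableSpace.map (ofFamily (k := k)) inferInstance

end Configuration

/-- The law of the Poisson point process on `X` with finite non-atomic intensity measure `μ`:
the number of points is Poisson distributed with mean `μ X` and, given that there are `k` points,
they are independent with law `μ / μ X`. -/
noncomputable def poissonProcess {X : Type*} [MeasurableSpace X] (μ : Measure X) :
    Measure (Configuration X) :=
  Measure.sum fun k : ℕ =>
    (ENNReal.ofReal (Real.exp (-(μ Set.univ).toReal)) / (k.factorial : ENNReal)) •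
      (Measure.pi fun _ : Fin k => μ).map Configuration.ofFamily

/-! ### Crosses and double bars -/

/-- The two kinds of transitions. -/
inductive Kind
  | cross
  | bar

instance : MeasurableSpace Kind := ⊤

section Loops

variable {V : Type*}

instance (G : SimpleGraph V) : MeasurableSpace G.edgeSet := ⊤

/-- A transition: an edge, a time, and a kind. -/
abbrev Transition (G : SimpleGraph V) : Type _ := G.edgeSet × ℝ × Kind

/-- A realization `ω`: finitely many transitions. -/
abbrev Realization (G : SimpleGraph V) : Type _ := Configuration (Transition G)

/-- The intensity measure on `𝓔 × [0,β] × {cross, bar}`: intensity `u` for the crosses and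
`1 - u` for the double bars. -/
noncomputable def intensity (G : SimpleGraph V) (β u : ℝ) : Measure (Transition G) :=
  (Measure.count : Measure G.edgeSet).prod
    ((volume.restrict (Set.Icc (0 : ℝ) β)).prod
      (ENNReal.ofReal u • Measure.dirac Kind.cross +
        ENNReal.ofReal (1 - u) • Measure.dirac Kind.bar))

/-- The measure `ρ_u`: independent Poisson point processes of crosses (with intensity `u`) and of
double bars (with intensity `1 - u`) on `𝓔 × [0,β]`. -/
noncomputable def rho (G : SimpleGraph V) (β u : ℝ) : Measure (Realization G) :=
  poissonProcess (intensity G β u)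

/-! ### Loops -/

/-- Vertical direction of motion. -/
inductive Direction
  | up
  | down

/-- No transition of `ω` touches the vertex `x` at a time in `[s,t]`. -/
def Quiet {G : SimpleGraph V} (ω : Realization G) (x : V) (s t : ℝ) : Prop :=
  ∀ p ∈ ω.points, x ∈ (p.1 : Sym2 V) → p.2.1 ∉ Set.Icc s t

/-- During the time interval `[s,t]`, the vertices `x` and `y` are touched by exactly one
transition of `ω`; it is of kind `k`, it takes place on the edge `{x,y}`, and its time lies strictly
between `s` and `t`. -/
def UniqueTransition {G : SimpleGraph V} (ω : Realization G) (k : Kind) (x y : V) (s t : ℝ) :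
    Prop :=
  ∃ p ∈ ω.points, (p.1 : Sym2 V) = s(x, y) ∧ p.2.2 = k ∧ s < p.2.1 ∧ p.2.1 < t ∧
    ∀ q ∈ ω.points, (x ∈ (q.1 : Sym2 V) ∨ y ∈ (q.1 : Sym2 V)) → q.2.1 ∈ Set.Icc s t → q = p

/-- `Move β ω (x, s, d) (y, t, e)`: a traveller who is at `(x, s)` and moves in the vertical
direction `d` is later on at `(y, t)` with vertical direction `e`, by one of the following:
moving vertically without meeting a transition; going around the time circle `[0,β]_per`;
going across a cross and continuing in the same vertical direction; going across a double bar and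
continuing in the opposite vertical direction. -/
inductive Move {G : SimpleGraph V} (β : ℝ) (ω : Realization G) :
    V × ℝ × Direction → V × ℝ × Direction → Prop
  | vertical_up (x : V) (s t : ℝ) (hs : 0 ≤ s) (hst : s ≤ t) (ht : t ≤ β) (h : Quiet ω x s t) :
      Move β ω (x, s, .up) (x, t, .up)
  | vertical_down (x : V) (s t : ℝ) (hs : 0 ≤ s) (hst : s ≤ t) (ht : t ≤ β) (h : Quiet ω x s t) :
      Move β ω (x, t, .down) (x, s, .down)
  | around_up (x : V) : Move β ω (x, β, .up) (x, 0, .up)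
  | around_down (x : V) : Move β ω (x, 0, .down) (x, β, .down)
  | cross_up (x y : V) (s t : ℝ) (hs : 0 ≤ s) (ht : t ≤ β)
      (h : UniqueTransition ω .cross x y s t) : Move β ω (x, s, .up) (y, t, .up)
  | cross_down (x y : V) (s t : ℝ) (hs : 0 ≤ s) (ht : t ≤ β)
      (h : UniqueTransition ω .cross x y s t) : Move β ω (x, t, .down) (y, s, .down)
  | bar_up (x y : V) (s t : ℝ) (hs : 0 ≤ s) (ht : t ≤ β)
      (h : UniqueTransition ω .bar x y s t) : Move β ω (x, s, .up) (y, s, .down)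
  | bar_down (x y : V) (s t : ℝ) (hs : 0 ≤ s) (ht : t ≤ β)
      (h : UniqueTransition ω .bar x y s t) : Move β ω (x, t, .down) (y, t, .up)

/-- Two points of space-time with a direction lie on the same trajectory. -/
def SameTrajectory {G : SimpleGraph V} (β : ℝ) (ω : Realization G) :
    V × ℝ × Direction → V × ℝ × Direction → Prop :=
  Relation.EqvGen (Move β ω)

/-- (The support of) the loop that contains `(x, t)`: all points that are visited, in any vertical
direction, by the trajectory that starts upwards at `(x, t)`. -/
def loopAt {G : SimpleGraph V} (β : ℝ) (ω : Realization G) (x : V) (t : ℝ) : Set (V × ℝ) :=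
  {q | ∃ d, SameTrajectory β ω (x, t, .up) (q.1, q.2, d)}

/-- The set `𝓛(ω)` of all loops, starting from any point of `Λ × [0,β]` where there is no
transition. Loops that differ by their parametrization only are identified, as they are
represented by their supports. -/
def loops {G : SimpleGraph V} (β : ℝ) (ω : Realization G) : Set (Set (V × ℝ)) :=
  {γ | ∃ (x : V) (t : ℝ), t ∈ Set.Icc 0 β ∧ Quiet ω x t t ∧ γ = loopAt β ω x t}

/-- The number `|𝓛(ω)|` of loops. -/
noncomputable def loopCount {G : SimpleGraph V} (β : ℝ) (ω : Realization G) : ℕ :=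
  (loops β ω).ncard

/-- The length `L_{(x,t)}` of the loop that contains `(x, t)`: the sum of the lengths of its
vertical lines. -/
noncomputable def loopLength [Fintype V] {G : SimpleGraph V} (β : ℝ) (ω : Realization G)
    (x : V) (t : ℝ) : ℝ :=
  ∑ y, (volume {r : ℝ | r ∈ Set.Icc 0 β ∧ (y, r) ∈ loopAt β ω x t}).toReal

/-- The partition function `Y_θ^{(u)}(β,Λ) = ∫ θ^{|𝓛(ω)|} dρ_u(ω)`. -/
noncomputable def loopPartition (G : SimpleGraph V) (β u θ : ℝ) : ℝ :=
  ∫ ω, θ ^ loopCount β ω ∂(rho G β u)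

/-- The probability measure `Y_θ^{(u)}(β,Λ)⁻¹ θ^{|𝓛(ω)|} dρ_u(ω)` of the random loop model. -/
noncomputable def loopMeasure (G : SimpleGraph V) (β u θ : ℝ) : Measure (Realization G) :=
  (rho G β u).withDensity fun ω =>
    ENNReal.ofReal (θ ^ loopCount β ω / loopPartition G β u θ)

/-- The total length `∑_x L_{(x,0)}`. -/
noncomputable def totalLength [Fintype V] {G : SimpleGraph V} (β : ℝ) (ω : Realization G) : ℝ :=
  ∑ x, loopLength β ω x 0

/-- The expectation `𝔼(∑_x L_{(x,0)})` in the random loop model. -/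
noncomputable def expectedTotalLength [Fintype V] (G : SimpleGraph V) (β u θ : ℝ) : ℝ :=
  ∫ ω, totalLength β ω ∂(loopMeasure G β u θ)

end Loops

/-! ### Quantum spins

The spin is `S = n / 2`. The one-site space `ℂ^{2S+1}` has the orthonormal basis `|a⟩`,
`a ∈ {-S, …, S}`, indexed by `i : Fin (n + 1)` through `a = i - n / 2`; the space
`⨂_{x ∈ Λ} ℂ^{2S+1}` has the product basis, indexed by `V → Fin (n + 1)`. Operators are given by
their matrices in this basis. -/

section Quantum

variable {V : Type*} [Fintype V] [DecidableEq V]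

/-- Operators on `⨂_{x ∈ Λ} ℂ^{n+1}`. -/
abbrev Op (V : Type*) (n : ℕ) : Type _ := Matrix (V → Fin (n + 1)) (V → Fin (n + 1)) ℂ

/-- The operator `A ⊗ Id_{Λ∖{x}}`. -/
def siteOp {n : ℕ} (x : V) (A : Matrix (Fin (n + 1)) (Fin (n + 1)) ℂ) : Op V n :=
  Matrix.of fun σ τ => if ∀ z, z ≠ x → σ z = τ z then A (σ x) (τ x) else 0

/-- The operator `B ⊗ Id_{Λ∖{x,y}}`, for distinct `x` and `y`. -/
def pairOp {n : ℕ} (x y : V)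
    (B : Matrix (Fin (n + 1) × Fin (n + 1)) (Fin (n + 1) × Fin (n + 1)) ℂ) : Op V n :=
  Matrix.of fun σ τ =>
    if ∀ z, z ≠ x → z ≠ y → σ z = τ z then B (σ x, σ y) (τ x, τ y) else 0

/-- The one-site spin operator `S³`, with `S³ |a⟩ = a |a⟩`. -/
noncomputable def spin3 (n : ℕ) : Matrix (Fin (n + 1)) (Fin (n + 1)) ℂ :=
  Matrix.diagonal fun i => (i : ℂ) - (n : ℂ) / 2

/-- The transposition operator `T |a,b⟩ = |b,a⟩`. -/
def transposition (n : ℕ) :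
    Matrix (Fin (n + 1) × Fin (n + 1)) (Fin (n + 1) × Fin (n + 1)) ℂ :=
  Matrix.of fun p q => if p.1 = q.2 ∧ p.2 = q.1 then 1 else 0

/-- The operator `Q` with `⟨a,b| Q |c,d⟩ = δ_{a,b} δ_{c,d}`. -/
def doubleBar (n : ℕ) :
    Matrix (Fin (n + 1) × Fin (n + 1)) (Fin (n + 1) × Fin (n + 1)) ℂ :=
  Matrix.of fun p q => if p.1 = p.2 ∧ q.1 = q.2 then 1 else 0

/-- The interaction `u T_{xy} + (1 - u) Q_{xy} - 1`. -/
noncomputable def bond (V : Type*) [Fintype V] [DecidableEq V] (n : ℕ) (u : ℝ) (x y : V) : Op V n :=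
  (u : ℂ) • pairOp x y (transposition n) + ((1 - u : ℝ) : ℂ) • pairOp x y (doubleBar n) - 1

theorem bond_comm (n : ℕ) (u : ℝ) (x y : V) : bond V n u x y = bond V n u y x := by
  have h : ∀ σ τ : V → Fin (n + 1), (∀ z, z ≠ x → z ≠ y → σ z = τ z) ↔
      (∀ z, z ≠ y → z ≠ x → σ z = τ z) := fun σ τ =>
    ⟨fun H z h1 h2 => H z h2 h1, fun H z h1 h2 => H z h2 h1⟩
  have hT : pairOp x y (transposition n) = pairOp y x (transposition n) := by
    ext σ τ
    simp only [pairOp, transposition, Matrix.of_apply, h σ τ, and_comm]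
  have hQ : pairOp x y (doubleBar n) = pairOp y x (doubleBar n) := by
    ext σ τ
    simp only [pairOp, doubleBar, Matrix.of_apply, h σ τ, eq_comm]
  rw [bond, bond, hT, hQ]

/-- The Hamiltonian `H_Λ^{(u)} = -∑_{{x,y} ∈ 𝓔} (u T_{xy} + (1 - u) Q_{xy} - 1)`. -/
noncomputable def hamiltonian (G : SimpleGraph V) [DecidableRel G.Adj] (n : ℕ) (u : ℝ) : Op V n :=
  -∑ e ∈ G.edgeFinset, Sym2.lift ⟨bond V n u, bond_comm n u⟩ e

/-- The Boltzmann factor with a magnetic field, `exp(-β H_Λ^{(u)} + β h ∑_x S_x³)`. -/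
noncomputable def gibbsOp (G : SimpleGraph V) [DecidableRel G.Adj] (n : ℕ) (β u h : ℝ) : Op V n :=
  NormedSpace.exp (-(β : ℂ) • hamiltonian G n u + ((β * h : ℝ) : ℂ) • ∑ x, siteOp x (spin3 n))

/-- The function `h ↦ log Tr exp(-β H_Λ^{(u)} + β h ∑_x S_x³)` (the trace is a positive real
number). -/
noncomputable def logPartition (G : SimpleGraph V) [DecidableRel G.Adj] (n : ℕ) (β u h : ℝ) : ℝ :=
  Real.log (gibbsOp G n β u h).trace.re

/-- The Gibbs state `⟨A⟩ = Tr (A exp(-β H_Λ^{(u)})) / Tr exp(-β H_Λ^{(u)})`. -/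
noncomputable def gibbsState (G : SimpleGraph V) [DecidableRel G.Adj] (n : ℕ) (β u : ℝ)
    (A : Op V n) : ℂ :=
  (A * NormedSpace.exp (-(β : ℂ) • hamiltonian G n u)).trace /
    (NormedSpace.exp (-(β : ℂ) • hamiltonian G n u)).trace

/-- The sum of correlations `∑_{x,y} ⟨S_x³ S_y³⟩` (a real number). -/
noncomputable def spinCorrelationSum (G : SimpleGraph V) [DecidableRel G.Adj] (n : ℕ)
    (β u : ℝ) : ℝ :=
  ∑ x, ∑ y, (gibbsState G n β u (siteOp x (spin3 n) * siteOp y (spin3 n))).re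

end Quantum

end LoopModel

set_option linter.unusedSectionVars false

/-! Write `W` (`hopping`) for `∑ (u T + (1 - u) Q)` over the edges, `A = βW`, and `M` for the total
spin, a diagonal matrix. In the spin basis all these matrices are real, `T` and `Q` have entries 0
and 1, and `-H = W - |𝓔|`.

Random loop representation. Expand `exp A` in powers of `W` and each power into sequences of labels
(edge and kind). A closed path of spin configurations contributes to a sequence of labels exactly
when its spins are constant along the loops of that sequence, so the trace of the sequence is
`(2S+1)^(number of loops)`. The factor `β^k / k!` is the volume of the sorted `k`-tuples of times.
Hence the loop partition function is `exp (-β|𝓔|) Tr exp A` (`lintegral_pow_loopCount`).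

Lengths. The derivative of `exp (A + hM)` at `h = 0`, paired with `M`, is the Duhamel function `D =
∑ₖ 1/(k+1)! ∑ⱼ Tr (M Aʲ M A^(k-j))`. The spins of distinct loops are independent and centred, so
only pairs of segments in the same loop survive, each with the variance `S(S+1)/3`. As the `j`-th
time interval has integral `β^(k+1)/(k+1)!` over sorted times, the same series computes the total
length (`lintegral_totalLength_mul`), and with `Z = Tr exp A` the expectation is `3β/(S(S+1)) ·
D/Z`. Since `Tr (M exp A) = 0`, the second derivative of the logarithm is `β² D/Z`; this gives (a).

Correlations. In an eigenbasis of `A` with eigenvalues `vₐ`, `D` is the sum of `Mₐᵦ²` times divided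
differences of `exp`, and `Tr (M² exp A)` is the same sum with arithmetic means of `exp vₐ` and `exp
vᵦ`. The logarithmic mean is at most the arithmetic mean, which is the upper bound in (b). The gap
is at most half of `|exp vₐ - exp vᵦ|`, and Cauchy-Schwarz bounds it by `D` and the double
commutator `[M, [M, A]]` (`duhamel_bounds`). The latter has entries `(M_σ - M_τ)² A_στ`: crosses
conserve the total spin and drop out, while double bars change it by a bounded amount, which
produces the factor `(1 - u)|𝓔|` (`trace_commutator_le`). -/

namespace LoopModel

/-! ### Derivative of the exponential in a Banach algebra -/

section BanachAlgebra

open NormedSpace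

variable {𝔸 : Type*} [NormedRing 𝔸] [NormOneClass 𝔸]

theorem norm_sum_pow_mul_pow_le (X B : 𝔸) {R : ℝ} (hX : ‖X‖ ≤ R) (k : ℕ) :
    ‖∑ i ∈ Finset.range (k + 1), X ^ (k - i) * B * X ^ i‖ ≤ (k + 1) * (R ^ k * ‖B‖) := by
  have hR : 0 ≤ R := (norm_nonneg X).trans hX
  calc ‖∑ i ∈ Finset.range (k + 1), X ^ (k - i) * B * X ^ i‖
      ≤ ∑ i ∈ Finset.range (k + 1), R ^ k * ‖B‖ := by
        refine norm_sum_le_of_le _ fun i hi => ?_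
        have hik : k - i + i = k := Nat.sub_add_cancel (Nat.lt_succ_iff.mp (Finset.mem_range.mp hi))
        calc ‖X ^ (k - i) * B * X ^ i‖ ≤ ‖X ^ (k - i)‖ * ‖B‖ * ‖X ^ i‖ :=
              (norm_mul_le _ _).trans (by gcongr; exact norm_mul_le _ _)
          _ ≤ R ^ (k - i) * ‖B‖ * R ^ i := by
              gcongr
              · exact (norm_pow_le _ _).trans (by gcongr)
              · exact (norm_pow_le _ _).trans (by gcongr)
          _ = R ^ (k - i + i) * ‖B‖ := by rw [pow_add]; ring
          _ = R ^ k * ‖B‖ := by rw [hik]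
    _ = (k + 1) * (R ^ k * ‖B‖) := by simp

variable [NormedAlgebra ℝ 𝔸]

/-- The terms of the power series of the derivative of `exp` at `X` in the direction `B`. -/
noncomputable def expDerivTerm (X B : 𝔸) (k : ℕ) : 𝔸 :=
  ((k + 1).factorial : ℝ)⁻¹ • ∑ i ∈ Finset.range (k + 1), X ^ (k - i) * B * X ^ i

theorem norm_expDerivTerm_le (X B : 𝔸) {R : ℝ} (hX : ‖X‖ ≤ R) (k : ℕ) :
    ‖expDerivTerm X B k‖ ≤ R ^ k / k.factorial * ‖B‖ := by
  rw [expDerivTerm, norm_smul, norm_inv, RCLike.norm_natCast]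
  have h := norm_sum_pow_mul_pow_le X B hX k
  have h1 : (0 : ℝ) < k.factorial := by positivity
  calc _ ≤ ((k + 1).factorial : ℝ)⁻¹ * ((k + 1) * (R ^ k * ‖B‖)) := by gcongr
    _ = R ^ k / k.factorial * ‖B‖ := by
        rw [Nat.factorial_succ]; push_cast; field_simp

variable [CompleteSpace 𝔸]

theorem summable_expDerivTerm (X B : 𝔸) : Summable (expDerivTerm X B) :=
  .of_norm_bounded ((Real.summable_pow_div_factorial ‖X‖).mul_right ‖B‖)
    (norm_expDerivTerm_le X B le_rfl)

theorem exp_eq_one_add_tsum (X : 𝔸) :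
    exp X = 1 + ∑' k : ℕ, ((k + 1).factorial : ℝ)⁻¹ • X ^ (k + 1) := by
  rw [exp_eq_tsum ℝ]
  simp only
  rw [(expSeries_summable' (𝕂 := ℝ) X).tsum_eq_zero_add]
  simp

theorem hasDerivAt_smul_pow_succ (X B : 𝔸) (k : ℕ) (h : ℝ) :
    HasDerivAt (fun h : ℝ => ((k + 1).factorial : ℝ)⁻¹ • (X + h • B) ^ (k + 1))
      (expDerivTerm (X + h • B) B k) h := by
  have hlin : HasDerivAt (fun h : ℝ => X + h • B) B h := by
    simpa using ((hasDerivAt_id h).smul_const B).const_add X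
  exact (hlin.fun_pow' (k + 1)).const_smul ((k + 1).factorial : ℝ)⁻¹

/-- `X` and `B` need not commute, so the power series is differentiated term by term; on the unit
ball around `h` the derivatives are dominated by a fixed exponential series. -/
theorem hasDerivAt_exp_add_smul (X B : 𝔸) (h : ℝ) :
    HasDerivAt (fun h : ℝ => exp (X + h • B)) (∑' k, expDerivTerm (X + h • B) B k) h := by
  have hs : Summable fun k : ℕ => (‖X‖ + (|h| + 1) * ‖B‖) ^ k / k.factorial * ‖B‖ :=
    (Real.summable_pow_div_factorial _).mul_right _
  have hb : ∀ (k : ℕ) (r : ℝ), r ∈ Metric.ball h 1 → ‖expDerivTerm (X + r • B) B k‖ ≤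
      (‖X‖ + (|h| + 1) * ‖B‖) ^ k / k.factorial * ‖B‖ := by
    intro k r hr
    refine norm_expDerivTerm_le _ _ ((norm_add_le _ _).trans ?_) k
    rw [norm_smul]
    have h1 : |r - h| < 1 := by simpa [Real.dist_eq] using hr
    have h2 : ‖r‖ ≤ |h| + 1 := by
      rw [Real.norm_eq_abs]
      linarith [abs_sub_abs_le_abs_sub r h]
    gcongr
  have h0 : Summable fun k : ℕ => ((k + 1).factorial : ℝ)⁻¹ • (X + h • B) ^ (k + 1) :=
    (summable_nat_add_iff 1).mpr (expSeries_summable' (𝕂 := ℝ) (X + h • B))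
  have key := hasDerivAt_tsum_of_isPreconnected hs Metric.isOpen_ball
    (convex_ball h 1).isPreconnected (fun k r _ => hasDerivAt_smul_pow_succ X B k r) hb
    (Metric.mem_ball_self one_pos) h0 (Metric.mem_ball_self one_pos)
  refine (key.const_add 1).congr_of_eventuallyEq (Filter.Eventually.of_forall fun r => ?_)
  exact exp_eq_one_add_tsum _

end BanachAlgebra

/-! ### Traces of matrix exponentials -/

section MatrixExp

open NormedSpace Matrix
open scoped Matrix.Norms.Operator

variable {N : Type*} [Fintype N] [DecidableEq N]

theorem hasSum_trace_mul_exp (C X : Matrix N N ℝ) :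
    HasSum (fun k => (k.factorial : ℝ)⁻¹ * (C * X ^ k).trace) (C * exp X).trace := by
  have h := exp_series_hasSum_exp' (𝕂 := ℝ) X
  have h2 := (h.mul_left C).map (Matrix.traceAddMonoidHom N ℝ) (continuous_id.matrix_trace)
  simp only [Function.comp_def, Matrix.traceAddMonoidHom_apply, Matrix.mul_smul, Matrix.trace_smul,
    smul_eq_mul] at h2
  exact h2

theorem trace_mul_expDerivTerm (C X B : Matrix N N ℝ) (k : ℕ) :
    (C * expDerivTerm X B k).trace = ((k + 1).factorial : ℝ)⁻¹ *
      ∑ i ∈ Finset.range (k + 1), (C * X ^ (k - i) * B * X ^ i).trace := by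
  simp [expDerivTerm, Finset.mul_sum, Matrix.trace_sum, Matrix.mul_assoc]

theorem summable_trace_mul_expDerivTerm [Nonempty N] (C X B : Matrix N N ℝ) :
    HasSum (fun k => (C * expDerivTerm X B k).trace) (C * ∑' k, expDerivTerm X B k).trace :=
  (((summable_expDerivTerm X B).hasSum.mul_left C).map (Matrix.traceAddMonoidHom N ℝ)
    (continuous_id.matrix_trace))

theorem hasDerivAt_trace_mul_exp [Nonempty N] (C X B : Matrix N N ℝ) (h : ℝ) :
    HasDerivAt (fun h : ℝ => (C * exp (X + h • B)).trace)
      (C * ∑' k, expDerivTerm (X + h • B) B k).trace h := by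
  let φ : Matrix N N ℝ →L[ℝ] ℝ :=
    ⟨(Matrix.traceLinearMap N ℝ ℝ).comp (LinearMap.mulLeft ℝ C),
      (continuous_const.mul continuous_id).matrix_trace⟩
  exact φ.hasFDerivAt.comp_hasDerivAt h (hasDerivAt_exp_add_smul X B h)

/-- By cyclicity the `k + 1` products in the `k`-th term have the same trace, and `(k + 1)/(k + 1)!
= 1/k!`. A further factor in front, as in the second derivative, destroys this simplification. -/
theorem trace_tsum_expDerivTerm [Nonempty N] (X B : Matrix N N ℝ) :
    (∑' k, expDerivTerm X B k).trace = (B * exp X).trace := by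
  have h1 := summable_trace_mul_expDerivTerm 1 X B
  rw [Matrix.one_mul] at h1
  refine h1.unique ?_
  convert hasSum_trace_mul_exp B X using 2 with k
  rw [trace_mul_expDerivTerm]
  have : ∀ i ∈ Finset.range (k + 1), (1 * X ^ (k - i) * B * X ^ i).trace = (B * X ^ k).trace := by
    intro i hi
    have hik : i + (k - i) = k := Nat.add_sub_cancel' (Nat.lt_succ_iff.mp (Finset.mem_range.mp hi))
    rw [Matrix.one_mul, Matrix.mul_assoc, Matrix.trace_mul_comm, Matrix.mul_assoc, ← pow_add, hik]
  rw [Finset.sum_congr rfl this, Finset.sum_const, Finset.card_range, nsmul_eq_mul,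
    Nat.factorial_succ]
  push_cast
  field_simp

theorem hasDerivAt_trace_exp [Nonempty N] (X B : Matrix N N ℝ) (h : ℝ) :
    HasDerivAt (fun h : ℝ => (exp (X + h • B)).trace) (B * exp (X + h • B)).trace h := by
  simpa [trace_tsum_expDerivTerm] using hasDerivAt_trace_mul_exp 1 X B h

theorem contDiff_trace_exp (X B : Matrix N N ℝ) {m : WithTop ℕ∞} :
    ContDiff ℝ m (fun h : ℝ => (exp (X + h • B)).trace) := by
  have h1 : ContDiff ℝ m (fun X : Matrix N N ℝ => exp X) := by
    rw [contDiff_iff_contDiffAt]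
    exact fun x => (exp_analytic (𝕂 := ℝ) x).contDiffAt
  let φ : Matrix N N ℝ →L[ℝ] ℝ := ⟨Matrix.traceLinearMap N ℝ ℝ, continuous_id.matrix_trace⟩
  exact φ.contDiff.comp (h1.comp (contDiff_const.add (contDiff_id.smul contDiff_const)))

end MatrixExp

/-! ### Divided differences of the exponential function -/

/-- The divided difference of the exponential function. -/
noncomputable def expDividedDiff (a b : ℝ) : ℝ :=
  if a = b then Real.exp a else (Real.exp a - Real.exp b) / (a - b)

theorem expDividedDiff_self (a : ℝ) : expDividedDiff a a = Real.exp a := if_pos rfl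

theorem sub_mul_expDividedDiff (a b : ℝ) :
    (a - b) * expDividedDiff a b = Real.exp a - Real.exp b := by
  rcases eq_or_ne a b with rfl | h
  · simp
  · rw [expDividedDiff, if_neg h, mul_div_cancel₀ _ (sub_ne_zero.mpr h)]

theorem expDividedDiff_comm (a b : ℝ) : expDividedDiff a b = expDividedDiff b a := by
  rcases eq_or_ne a b with rfl | h
  · rfl
  · rw [expDividedDiff, expDividedDiff, if_neg h, if_neg h.symm, ← neg_sub, ← neg_sub b a,
      neg_div_neg_eq]

/-- This is `tanh (d/2) ≤ d/2`. The difference `g` of the two sides vanishes at 0 and has derivative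
`1 + (x - 1) exp x`, which is nonnegative because `1 - x ≤ exp (-x)`. -/
theorem exp_sub_one_le {d : ℝ} (hd : 0 ≤ d) :
    2 * (Real.exp d - 1) ≤ d * (Real.exp d + 1) := by
  let g : ℝ → ℝ := fun x => x * (Real.exp x + 1) - 2 * (Real.exp x - 1)
  have hg (x : ℝ) : HasDerivAt g (1 * (Real.exp x + 1) + x * Real.exp x - 2 * Real.exp x) x :=
    ((hasDerivAt_id x).mul ((Real.hasDerivAt_exp x).add_const 1)).sub
      (((Real.hasDerivAt_exp x).sub_const 1).const_mul 2)
  have hmono : Monotone g := by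
    refine monotone_of_deriv_nonneg (fun x => (hg x).differentiableAt) fun x => ?_
    rw [(hg x).deriv]
    have h1 := Real.add_one_le_exp (-x)
    have h2 := Real.exp_pos x
    have h3 : Real.exp x * Real.exp (-x) = 1 := by rw [← Real.exp_add]; simp
    nlinarith
  have h := hmono hd
  simp only [g] at h
  simp at h
  linarith

theorem exp_le_expDividedDiff {a b : ℝ} (h : b ≤ a) : Real.exp b ≤ expDividedDiff a b := by
  rcases h.eq_or_lt with rfl | h
  · rw [expDividedDiff_self]
  · rw [expDividedDiff, if_neg h.ne', le_div_iff₀ (sub_pos.mpr h)]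
    have h1 := Real.add_one_le_exp (a - b)
    have h2 : Real.exp a = Real.exp b * Real.exp (a - b) := by rw [← Real.exp_add]; ring_nf
    nlinarith [Real.exp_pos b]

theorem expDividedDiff_nonneg (a b : ℝ) : 0 ≤ expDividedDiff a b := by
  rcases le_total b a with h | h
  · exact (Real.exp_pos b).le.trans (exp_le_expDividedDiff h)
  · rw [expDividedDiff_comm]
    exact (Real.exp_pos a).le.trans (exp_le_expDividedDiff h)

theorem expDividedDiff_le (a b : ℝ) : expDividedDiff a b ≤ (Real.exp a + Real.exp b) / 2 := by
  wlog h : b ≤ a generalizing a b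
  · rw [expDividedDiff_comm, add_comm]
    exact this b a (le_of_not_ge h)
  rcases h.eq_or_lt with rfl | h
  · rw [expDividedDiff_self]; linarith
  · rw [expDividedDiff, if_neg h.ne', div_le_iff₀ (sub_pos.mpr h)]
    have h1 := exp_sub_one_le (sub_nonneg.mpr h.le)
    have h2 : Real.exp a = Real.exp b * Real.exp (a - b) := by rw [← Real.exp_add]; ring_nf
    nlinarith [Real.exp_pos b]

/-- The product of the roots is `|exp a - exp b|`. The divided difference is at least the smaller
exponential, and the arithmetic mean exceeds the smaller one by half of that distance. The form with
roots is the one to which Cauchy-Schwarz applies. -/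
theorem le_expDividedDiff (a b : ℝ) :
    (Real.exp a + Real.exp b) / 2 - expDividedDiff a b ≤
      (√((a - b) * (Real.exp a - Real.exp b)) * √(expDividedDiff a b)) / 2 := by
  have h0 : √((a - b) * (Real.exp a - Real.exp b)) * √(expDividedDiff a b) =
      |Real.exp a - Real.exp b| := by
    have h1 : 0 ≤ (a - b) * (Real.exp a - Real.exp b) := by
      rw [← sub_mul_expDividedDiff, ← mul_assoc]
      exact mul_nonneg (mul_self_nonneg _) (expDividedDiff_nonneg a b)
    rw [← Real.sqrt_mul h1, ← Real.sqrt_sq_eq_abs]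
    congr 1
    rw [sq]
    conv_rhs => rw [← sub_mul_expDividedDiff]
    rw [← sub_mul_expDividedDiff]
    ring
  rw [h0]
  wlog h : b ≤ a generalizing a b
  · rw [expDividedDiff_comm, add_comm, abs_sub_comm]
    exact this b a (by rw [expDividedDiff_comm, abs_sub_comm, ← h0]; congr 2; ring)
      (le_of_not_ge h)
  rw [abs_of_nonneg (sub_nonneg.mpr (Real.exp_le_exp.mpr h))]
  linarith [exp_le_expDividedDiff h]

theorem hasSum_pow_div_factorial (a : ℝ) :
    HasSum (fun k : ℕ => a ^ k / k.factorial) (Real.exp a) := by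
  rw [Real.exp_eq_exp_ℝ]
  exact NormedSpace.expSeries_div_hasSum_exp a

/-- Divide the difference of the two exponential series by `a - b` and use the geometric sum for
`a^(k+1) - b^(k+1)`. The left side is what `expDerivTerm` becomes in an eigenbasis. -/
theorem hasSum_expDividedDiff (a b : ℝ) :
    HasSum (fun k : ℕ => ((k + 1).factorial : ℝ)⁻¹ *
      ∑ i ∈ Finset.range (k + 1), a ^ i * b ^ (k - i)) (expDividedDiff a b) := by
  rcases eq_or_ne a b with rfl | h
  · rw [expDividedDiff_self]
    refine (hasSum_pow_div_factorial a).congr_fun ?_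
    intro k
    have : ∀ i ∈ Finset.range (k + 1), a ^ i * a ^ (k - i) = a ^ k := fun i hi => by
      rw [← pow_add, Nat.add_sub_cancel' (Nat.lt_succ_iff.mp (Finset.mem_range.mp hi))]
    rw [Finset.sum_congr rfl this, Finset.sum_const, Finset.card_range, nsmul_eq_mul,
      Nat.factorial_succ]
    push_cast
    field_simp
  · rw [expDividedDiff, if_neg h]
    have h1 := ((hasSum_pow_div_factorial a).sub (hasSum_pow_div_factorial b)).div_const (a - b)
    -- The constant terms of the two series cancel, whence the shift to `k + 1`.
    rw [hasSum_nat_add_iff' 1 |>.symm] at h1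
    simp only [Finset.range_one, Finset.sum_singleton, pow_zero, sub_self, zero_div, sub_zero] at h1
    refine h1.congr_fun ?_
    intro k
    have h2 := (Commute.all a b).geom_sum₂ h (k + 1)
    simp only [Nat.add_sub_cancel] at h2
    rw [h2]
    ring

/-! ### Trace inequalities for symmetric matrices -/

section MatrixInequalities

open NormedSpace Matrix
open scoped Matrix.Norms.Operator

variable {N : Type*} [Fintype N] [DecidableEq N]

/-- The spectral theorem, stated as the algebra homomorphism `c` of conjugation by the eigenvectors.
As `c` respects traces and transposes, every trace below can be computed with `A` diagonal. -/
theorem exists_diagonalization {A : Matrix N N ℝ} (hA : A.IsSymm) :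
    ∃ (c : Matrix N N ℝ →ₐ[ℝ] Matrix N N ℝ) (v : N → ℝ), c A = diagonal v ∧
      c (exp A) = diagonal (fun i => Real.exp (v i)) ∧ (∀ X, (c X).trace = X.trace) ∧
      ∀ X, c Xᵀ = (c X)ᵀ := by
  have hA' : A.IsHermitian := by rw [IsHermitian, conjTranspose_eq_transpose_of_trivial]; exact hA
  let c := Unitary.conjStarAlgAut ℝ (Matrix N N ℝ) (star hA'.eigenvectorUnitary)
  have hcA : c A = diagonal hA'.eigenvalues := hA'.conjStarAlgAut_star_eigenvectorUnitary
  refine ⟨(c.toAlgEquiv : Matrix N N ℝ →ₐ[ℝ] Matrix N N ℝ), hA'.eigenvalues, hcA, ?_, ?_, ?_⟩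
  · have hc : Continuous c := LinearMap.continuous_of_finiteDimensional
      (c.toAlgEquiv.toLinearEquiv : Matrix N N ℝ →ₗ[ℝ] Matrix N N ℝ)
    change c (exp A) = _
    have h := map_exp (c.toAlgEquiv : Matrix N N ℝ →ₐ[ℝ] Matrix N N ℝ) hc A
    refine h.trans ?_
    change exp (c A) = _
    rw [hcA, exp_diagonal]
    congr 1
    funext i
    rw [Pi.exp_def, Real.exp_eq_exp_ℝ]
  · intro X
    change (c X).trace = _
    simp only [c, Unitary.conjStarAlgAut_star_apply]
    rw [Matrix.trace_mul_comm, ← Matrix.mul_assoc]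
    simp
  · intro X
    have := map_star c X
    simpa [star_eq_conjTranspose, conjTranspose_eq_transpose_of_trivial] using this

theorem trace_mul_diagonal_mul_diagonal {X Y : Matrix N N ℝ} (v w : N → ℝ) :
    (X * diagonal v * Y * diagonal w).trace = ∑ a, ∑ b, X a b * Y b a * (v b * w a) := by
  simp only [Matrix.trace, Matrix.diag_apply, Matrix.mul_diagonal]
  refine Finset.sum_congr rfl fun a _ => ?_
  rw [Matrix.mul_apply, Finset.sum_mul]
  refine Finset.sum_congr rfl fun b _ => ?_
  rw [Matrix.mul_diagonal]
  ring

/-- Comparison between the Duhamel two-point function and the ordinary one. -/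
theorem duhamel_bounds [Nonempty N] {A M : Matrix N N ℝ} (hA : A.IsSymm) (hM : M.IsSymm) :
    (M * ∑' k, expDerivTerm A M k).trace ≤ (M * M * exp A).trace ∧
    0 ≤ (M * ∑' k, expDerivTerm A M k).trace ∧
    (M * M * exp A).trace - (M * ∑' k, expDerivTerm A M k).trace ≤
      √(((M * M * A - M * A * M - M * A * M + A * M * M) * exp A).trace) *
        √((M * ∑' k, expDerivTerm A M k).trace) / 2 := by
  obtain ⟨c, v, hcA, hce, htr, hct⟩ := exists_diagonalization hA
  have hsymm (a b : N) : c M b a = c M a b := by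
    have : (c M)ᵀ = c M := by rw [← hct, hM]
    exact congrFun (congrFun this a) b
  have e1 : (M * ∑' k, expDerivTerm A M k).trace =
      ∑ a, ∑ b, c M a b ^ 2 * expDividedDiff (v a) (v b) := by
    refine (summable_trace_mul_expDerivTerm M A M).unique ?_
    have h : HasSum (fun k : ℕ => ∑ a, ∑ b, c M a b ^ 2 * (((k + 1).factorial : ℝ)⁻¹ *
        ∑ i ∈ Finset.range (k + 1), v a ^ i * v b ^ (k - i)))
        (∑ a, ∑ b, c M a b ^ 2 * expDividedDiff (v a) (v b)) :=
      hasSum_sum fun a _ => hasSum_sum fun b _ => (hasSum_expDividedDiff (v a) (v b)).mul_left _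
    convert h using 2 with k
    rw [trace_mul_expDerivTerm]
    have h2 (i : ℕ) : (M * A ^ (k - i) * M * A ^ i).trace =
        ∑ a, ∑ b, c M a b ^ 2 * (v a ^ i * v b ^ (k - i)) := by
      rw [← htr]
      simp only [map_mul, map_pow, hcA, diagonal_pow]
      rw [trace_mul_diagonal_mul_diagonal]
      refine Finset.sum_congr rfl fun a _ => Finset.sum_congr rfl fun b _ => ?_
      rw [hsymm a b]
      simp only [Pi.pow_apply]
      ring
    simp only [h2]
    rw [Finset.sum_comm, Finset.mul_sum]
    refine Finset.sum_congr rfl fun a _ => ?_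
    rw [Finset.sum_comm, Finset.mul_sum]
    refine Finset.sum_congr rfl fun b _ => ?_
    rw [← Finset.mul_sum]
    ring
  -- Averaging the double sum with its transpose, which is allowed since `c M` is symmetric, makes
  -- the weights symmetric in the two eigenvalues.
  have gen (x y : N → ℝ) : (c M * diagonal x * c M * diagonal y).trace =
      ∑ a, ∑ b, c M a b ^ 2 * ((x b * y a + x a * y b) / 2) := by
    have h1 := trace_mul_diagonal_mul_diagonal (X := c M) (Y := c M) x y
    have h2 := h1
    rw [Finset.sum_comm] at h2
    have h3 : (c M * diagonal x * c M * diagonal y).trace = ((c M * diagonal x * c M *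
      diagonal y).trace + (c M * diagonal x * c M * diagonal y).trace) / 2 := by ring
    rw [h3]
    nth_rewrite 1 [h1]
    rw [h2, ← Finset.sum_add_distrib, Finset.sum_div]
    refine Finset.sum_congr rfl fun a _ => ?_
    rw [← Finset.sum_add_distrib, Finset.sum_div]
    refine Finset.sum_congr rfl fun b _ => ?_
    rw [hsymm a b]
    ring
  have e2 : (M * M * exp A).trace =
      ∑ a, ∑ b, c M a b ^ 2 * ((Real.exp (v a) + Real.exp (v b)) / 2) := by
    rw [← htr, map_mul, map_mul, hce]
    have := gen (fun _ => 1) (fun a => Real.exp (v a))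
    simp only [diagonal_one, Matrix.mul_one, one_mul] at this
    exact this
  have e3 : ((M * M * A - M * A * M - M * A * M + A * M * M) * exp A).trace =
      ∑ a, ∑ b, c M a b ^ 2 * ((v a - v b) * (Real.exp (v a) - Real.exp (v b))) := by
    have g1 := gen (fun _ => 1) (fun a => v a * Real.exp (v a))
    have g2 := gen v (fun a => Real.exp (v a))
    simp only [diagonal_one, Matrix.mul_one, one_mul] at g1
    have t1 : (M * M * A * exp A).trace =
        (c M * c M * diagonal fun a => v a * Real.exp (v a)).trace := by
      rw [← htr]
      simp only [map_mul, hcA, hce, Matrix.mul_assoc, diagonal_mul_diagonal]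
    have t2 : (M * A * M * exp A).trace =
        (c M * diagonal v * c M * diagonal fun a => Real.exp (v a)).trace := by
      rw [← htr]
      simp only [map_mul, hcA, hce]
    have t3 : (A * M * M * exp A).trace =
        (c M * c M * diagonal fun a => v a * Real.exp (v a)).trace := by
      rw [Matrix.mul_assoc A, Matrix.mul_assoc A, Matrix.trace_mul_comm, ← htr]
      simp only [map_mul, hcA, hce, Matrix.mul_assoc, diagonal_mul_diagonal, mul_comm]
    rw [add_mul, sub_mul, sub_mul, Matrix.trace_add, Matrix.trace_sub, Matrix.trace_sub, t1, t2, t3,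
      g1, g2]
    simp only [← Finset.sum_sub_distrib, ← Finset.sum_add_distrib]
    refine Finset.sum_congr rfl fun a _ => Finset.sum_congr rfl fun b _ => ?_
    ring
  rw [e1, e2, e3]
  refine ⟨?_, ?_, ?_⟩
  · exact Finset.sum_le_sum fun a _ => Finset.sum_le_sum fun b _ =>
      mul_le_mul_of_nonneg_left (expDividedDiff_le _ _) (sq_nonneg _)
  · exact Finset.sum_nonneg fun a _ => Finset.sum_nonneg fun b _ =>
      mul_nonneg (sq_nonneg _) (expDividedDiff_nonneg _ _)
  · have hnn (a b : N) : 0 ≤ (v a - v b) * (Real.exp (v a) - Real.exp (v b)) := by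
      rw [← sub_mul_expDividedDiff, ← mul_assoc]
      exact mul_nonneg (mul_self_nonneg _) (expDividedDiff_nonneg _ _)
    -- Cauchy-Schwarz over pairs of eigenvectors; the entry `(c M a b)²` is split evenly between the
    -- two roots.
    have hcs := Real.sum_sqrt_mul_sqrt_le (Finset.univ : Finset (N × N))
      (f := fun p => c M p.1 p.2 ^ 2 * ((v p.1 - v p.2) * (Real.exp (v p.1) - Real.exp (v p.2))))
      (g := fun p => c M p.1 p.2 ^ 2 * expDividedDiff (v p.1) (v p.2))
      (fun p => mul_nonneg (sq_nonneg _) (hnn _ _))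
      (fun p => mul_nonneg (sq_nonneg _) (expDividedDiff_nonneg _ _))
    rw [Fintype.sum_prod_type, Fintype.sum_prod_type, Fintype.sum_prod_type] at hcs
    refine le_trans ?_ (div_le_div_of_nonneg_right hcs zero_le_two)
    rw [← Finset.sum_sub_distrib, Finset.sum_div]
    refine Finset.sum_le_sum fun a _ => ?_
    rw [← Finset.sum_sub_distrib, Finset.sum_div]
    refine Finset.sum_le_sum fun b _ => ?_
    rw [Real.sqrt_mul (sq_nonneg _), Real.sqrt_mul (sq_nonneg _), Real.sqrt_sq_eq_abs]
    have h1 := mul_le_mul_of_nonneg_left (le_expDividedDiff (v a) (v b)) (sq_nonneg (c M a b))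
    have h2 : |c M a b| * |c M a b| = c M a b ^ 2 := by rw [← sq, sq_abs]
    rw [mul_sub] at h1
    refine h1.trans (le_of_eq ?_)
    rw [← h2]
    ring

/-- If `Q² = q Q` with `q ≥ 0` and `Q` symmetric, then `Tr (Q e^A) ≤ q Tr e^A`. -/
theorem trace_mul_exp_le {A Q : Matrix N N ℝ} (hA : A.IsSymm) (hQ : Q.IsSymm) {q : ℝ} (hq : 0 < q)
    (hQQ : Q * Q = q • Q) : (Q * exp A).trace ≤ q * (exp A).trace := by
  obtain ⟨c, v, -, hce, htr, hct⟩ := exists_diagonalization hA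
  have key (C : Matrix N N ℝ) (hC : C.IsSymm) : 0 ≤ (C * C * exp A).trace := by
    have hsymm (a b : N) : c C b a = c C a b := by
      have : (c C)ᵀ = c C := by rw [← hct, hC]
      exact congrFun (congrFun this a) b
    rw [← htr, map_mul, map_mul, hce]
    simp only [Matrix.trace, Matrix.diag_apply, Matrix.mul_diagonal]
    simp only [Matrix.mul_apply]
    refine Finset.sum_nonneg fun a _ => mul_nonneg (Finset.sum_nonneg fun b _ => ?_)
      (Real.exp_pos _).le
    rw [hsymm]
    exact mul_self_nonneg _
  -- The matrix `q - Q` has square `q (q - Q)`, so positivity of `Tr ((q - Q)² exp A)` gives the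
  -- claim after division by `q`.
  have h := key (q • (1 : Matrix N N ℝ) - Q) (((isSymm_one).smul q).sub hQ)
  have e : (q • (1 : Matrix N N ℝ) - Q) * (q • (1 : Matrix N N ℝ) - Q) =
      q • (q • (1 : Matrix N N ℝ) - Q) := by
    rw [mul_sub, sub_mul, sub_mul, hQQ]
    simp [smul_sub]
  rw [e, smul_mul_assoc, Matrix.trace_smul, sub_mul, smul_mul_assoc, Matrix.one_mul,
    Matrix.trace_sub, Matrix.trace_smul, smul_eq_mul, smul_eq_mul] at h
  nlinarith [nonneg_of_mul_nonneg_right h hq]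

theorem trace_exp_pos [Nonempty N] {A : Matrix N N ℝ} (hA : A.IsSymm) : 0 < (exp A).trace := by
  obtain ⟨c, v, -, hce, htr, -⟩ := exists_diagonalization hA
  rw [← htr, hce, Matrix.trace_diagonal]
  exact Finset.sum_pos (fun i _ => Real.exp_pos _) Finset.univ_nonempty

end MatrixInequalities

/-! ### Matrix products as sums over paths -/

section PathSums

variable {N : Type*} [Fintype N] [DecidableEq N]

/-- The matrix product `D₀ B₀ D₁ B₁ ⋯ B_{k-1} D_k` where the `D_i` are diagonal. -/
noncomputable def pathProd : (k : ℕ) → (Fin k → Matrix N N ℝ) → (Fin (k + 1) → N → ℝ) →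
    Matrix N N ℝ
  | 0, _, D => Matrix.diagonal (D 0)
  | k + 1, B, D => Matrix.diagonal (D 0) * B 0 *
      pathProd k (fun i => B i.succ) (fun i => D i.succ)

theorem pathProd_apply (k : ℕ) (B : Fin k → Matrix N N ℝ) (D : Fin (k + 1) → N → ℝ) (a b : N) :
    pathProd k B D a b = ∑ σ : Fin (k + 1) → N, if σ 0 = a ∧ σ (Fin.last k) = b then
      (∏ i, D i (σ i)) * ∏ i : Fin k, B i (σ i.castSucc) (σ i.succ) else 0 := by
  induction k generalizing a with
  | zero =>
    rw [← (Equiv.funUnique (Fin 1) N).symm.sum_comp]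
    simp only [pathProd, Matrix.diagonal_apply]
    simp [ite_and]
  | succ k ih =>
    rw [pathProd, Matrix.mul_apply]
    simp only [Matrix.diagonal_mul, ih, Finset.mul_sum]
    rw [← (Fin.consEquiv fun _ => N).sum_comp, Fintype.sum_prod_type]
    rw [Finset.sum_comm]
    rw [Finset.sum_comm (s := Finset.univ (α := N)) (t := Finset.univ (α := Fin (k + 1) → N))]
    refine Finset.sum_congr rfl fun σ _ => ?_
    rw [Finset.sum_eq_single (σ 0) (fun c _ hc => by simp [hc.symm]) (by simp),
      Finset.sum_eq_single a (fun c _ hc => by simp [Fin.consEquiv, hc]) (by simp)]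
    by_cases h : σ (Fin.last k) = b
    · simp only [Fin.consEquiv, Equiv.coe_fn_mk, h, and_true, if_true, Fin.cons_zero,
        ← Fin.succ_last, Fin.cons_succ]
      rw [Fin.prod_univ_succ (n := k + 1), Fin.prod_univ_succ
        (fun i : Fin (k + 1) => B i (Fin.cons (α := fun _ => N) a σ i.castSucc) (σ i))]
      simp only [Fin.cons_zero, Fin.cons_succ, Fin.castSucc_zero, ← Fin.succ_castSucc]
      ring
    · simp [Fin.consEquiv, h, ← Fin.succ_last]

theorem trace_diagonal_mul_pathProd (k : ℕ) (f : N → ℝ) (B : Fin k → Matrix N N ℝ)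
    (D : Fin (k + 1) → N → ℝ) :
    (Matrix.diagonal f * pathProd k B D).trace =
      ∑ σ : Fin (k + 1) → N, if σ (Fin.last k) = σ 0 then
        f (σ 0) * (∏ i, D i (σ i)) * ∏ i : Fin k, B i (σ i.castSucc) (σ i.succ) else 0 := by
  simp only [Matrix.trace, Matrix.diag_apply, Matrix.diagonal_mul, pathProd_apply, Finset.mul_sum]
  rw [Finset.sum_comm]
  refine Finset.sum_congr rfl fun σ _ => ?_
  rw [Finset.sum_eq_single (σ 0) (fun c _ hc => by simp [hc.symm]) (by simp)]
  by_cases h : σ (Fin.last k) = σ 0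
  · simp [h, mul_assoc]
  · simp [h]

/-- Multilinearity of the product: this expands a power of `hopping` over sequences of labels. -/
theorem sum_pathProd {L : Type*} [Fintype L] (k : ℕ) (A : Fin k → L → Matrix N N ℝ)
    (D : Fin (k + 1) → N → ℝ) :
    ∑ l : Fin k → L, pathProd k (fun i => A i (l i)) D = pathProd k (fun i => ∑ a, A i a) D := by
  induction k with
  | zero => simp [pathProd]
  | succ k ih =>
    rw [← (Fin.consEquiv fun _ => L).sum_comp, Fintype.sum_prod_type]
    simp only [pathProd, ← ih (fun i => A i.succ), Finset.mul_sum, Finset.sum_mul, Fin.consEquiv,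
      Equiv.coe_fn_mk, Fin.cons_zero, Fin.cons_succ]
    exact Finset.sum_comm

theorem pathProd_one (k : ℕ) (W : Matrix N N ℝ) : pathProd k (fun _ => W) 1 = W ^ k := by
  induction k with
  | zero => simp [pathProd]
  | succ k ih =>
    have h : (fun i : Fin (k + 1) => (1 : Fin (k + 2) → N → ℝ) i.succ) = 1 := rfl
    rw [pathProd, h, ih, pow_succ']
    simp

theorem pathProd_update (k : ℕ) (W : Matrix N N ℝ) (j : Fin (k + 1)) (g : N → ℝ) :
    pathProd k (fun _ => W) (Function.update 1 j g) =
      W ^ (j : ℕ) * Matrix.diagonal g * W ^ (k - j) := by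
  induction k with
  | zero =>
    obtain rfl : j = 0 := Subsingleton.elim (α := Fin 1) _ _
    simp [pathProd]
  | succ k ih =>
    rw [pathProd]
    cases j using Fin.cases with
    | zero =>
      have h : (fun i : Fin (k + 1) => Function.update (1 : Fin (k + 2) → N → ℝ) 0 g i.succ) = 1 := by
        funext i
        rw [Function.update_of_ne (Fin.succ_ne_zero i)]
        rfl
      rw [h, pathProd_one, Function.update_self]
      simp [pow_succ', Matrix.mul_assoc]
    | succ j =>
      have h : (fun i : Fin (k + 1) => Function.update (1 : Fin (k + 2) → N → ℝ) j.succ g i.succ) =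
          Function.update (1 : Fin (k + 1) → N → ℝ) j g := by
        funext i
        by_cases hij : i = j
        · subst hij; simp
        · rw [Function.update_of_ne hij, Function.update_of_ne (by simpa using hij)]
          rfl
      rw [h, ih, Function.update_of_ne (Fin.succ_ne_zero j).symm]
      simp [pow_succ', Matrix.mul_assoc]

end PathSums

/-! ### Kinds of transitions -/

instance : DecidableEq Kind := fun a b =>
  match a, b with
  | .cross, .cross => isTrue rfl
  | .bar, .bar => isTrue rfl
  | .cross, .bar => isFalse nofun
  | .bar, .cross => isFalse nofun

instance : Fintype Kind := ⟨{.cross, .bar}, fun k => by cases k <;> simp⟩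

theorem Kind.sum_univ {R : Type*} [AddCommMonoid R] (f : Kind → R) :
    ∑ k, f k = f .cross + f .bar := by
  have : (Finset.univ : Finset Kind) = {.cross, .bar} := rfl
  rw [this, Finset.sum_pair (by simp)]

/-! ### Combinatorial loops and compatible spin configurations -/

section Segments

variable {V : Type*} {G : SimpleGraph V}

/-- The spatial part of a transition: an edge and a kind. -/
abbrev Label (G : SimpleGraph V) : Type _ := G.edgeSet × Kind

/-- Spin configurations `σ` and `τ` just before and just after a transition with label `l` are
compatible with it. -/
def Compat {α : Type*} (l : Label G) (σ τ : V → α) : Prop :=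
  (∀ z, z ∉ (l.1 : Sym2 V) → σ z = τ z) ∧
    ∀ x y, (l.1 : Sym2 V) = s(x, y) →
      (l.2 = .cross → σ x = τ y) ∧ (l.2 = .bar → σ x = σ y ∧ τ x = τ y)

/-- Vertical segments that are connected by a transition or by the periodicity in time; the times
of the `k` transitions separate `k + 1` time intervals. -/
inductive SegStep {k : ℕ} (l : Fin k → Label G) : V × Fin (k + 1) → V × Fin (k + 1) → Prop
  | around (x : V) : SegStep l (x, Fin.last k) (x, 0)
  | straight (x : V) (i : Fin k) (h : x ∉ ((l i).1 : Sym2 V)) :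
      SegStep l (x, i.castSucc) (x, i.succ)
  | cross (x y : V) (i : Fin k) (h : ((l i).1 : Sym2 V) = s(x, y)) (hk : (l i).2 = .cross) :
      SegStep l (x, i.castSucc) (y, i.succ)
  | bar_below (x y : V) (i : Fin k) (h : ((l i).1 : Sym2 V) = s(x, y)) (hk : (l i).2 = .bar) :
      SegStep l (x, i.castSucc) (y, i.castSucc)
  | bar_above (x y : V) (i : Fin k) (h : ((l i).1 : Sym2 V) = s(x, y)) (hk : (l i).2 = .bar) :
      SegStep l (x, i.succ) (y, i.succ)

/-- The loops, as classes of connected segments. -/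
abbrev SegLoop {k : ℕ} (l : Fin k → Label G) : Type _ :=
  Quotient (Relation.EqvGen.setoid (SegStep l))

/-- The loop of a segment. -/
def segLoop {k : ℕ} (l : Fin k → Label G) (p : V × Fin (k + 1)) : SegLoop l := ⟦p⟧

theorem segLoop_eq_of_segStep {k : ℕ} {l : Fin k → Label G} {p q : V × Fin (k + 1)}
    (h : SegStep l p q) : segLoop l p = segLoop l q := Quotient.sound (.rel _ _ h)

noncomputable instance [Fintype V] {k : ℕ} (l : Fin k → Label G) : Fintype (SegLoop l) :=
  Fintype.ofFinite _

noncomputable instance {k : ℕ} (l : Fin k → Label G) : DecidableEq (SegLoop l) :=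
  Classical.decEq _

/-- The bridge between operators and loops: compatibility with all transitions and periodicity in
time together say that the spins are constant along steps, hence along loops. -/
theorem compat_iff_segStep {α : Type*} {k : ℕ} (l : Fin k → Label G)
    (σ : Fin (k + 1) → V → α) :
    (σ (Fin.last k) = σ 0 ∧ ∀ i, Compat (l i) (σ i.castSucc) (σ i.succ)) ↔
      ∀ p q, SegStep l p q → σ p.2 p.1 = σ q.2 q.1 := by
  constructor
  · rintro ⟨h0, h⟩ p q hpq
    cases hpq with
    | around x => exact congrFun h0 x
    | straight x i hx => exact (h i).1 x hx
    | cross x y i hi hk => exact ((h i).2 x y hi).1 hk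
    | bar_below x y i hi hk => exact (((h i).2 x y hi).2 hk).1
    | bar_above x y i hi hk => exact (((h i).2 x y hi).2 hk).2
  · intro h
    exact ⟨funext fun x => h _ _ (.around x), fun i => ⟨fun z hz => h _ _ (.straight z i hz),
      fun x y hi => ⟨fun hk => h _ _ (.cross x y i hi hk),
        fun hk => ⟨h _ _ (.bar_below x y i hi hk), h _ _ (.bar_above x y i hi hk)⟩⟩⟩⟩

/-- The operator of a transition, as a matrix with entries `0` and `1`. -/
noncomputable def labelOp (n : ℕ) (l : Label G) : Matrix (V → Fin (n + 1)) (V → Fin (n + 1)) ℝ := by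
  classical exact Matrix.of fun σ τ => if Compat l σ τ then 1 else 0

variable [Fintype V] [DecidableEq V]

/-- The product of matrix entries is the indicator of compatibility, and the compatible closed paths
are in bijection with the assignments of one spin value to each loop. -/
theorem sum_closed_paths (n : ℕ) {k : ℕ} (l : Fin k → Label G)
    (F : (Fin (k + 1) → V → Fin (n + 1)) → ℝ) :
    (∑ σ : Fin (k + 1) → V → Fin (n + 1), if σ (Fin.last k) = σ 0 then
      F σ * ∏ i : Fin k, labelOp n (l i) (σ i.castSucc) (σ i.succ) else 0) =
    ∑ c : SegLoop l → Fin (n + 1), F fun i x => c (segLoop l (x, i)) := by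
  classical
  have h1 (σ : Fin (k + 1) → V → Fin (n + 1)) : (if σ (Fin.last k) = σ 0 then
      F σ * ∏ i : Fin k, labelOp n (l i) (σ i.castSucc) (σ i.succ) else 0) =
      if ∀ p q, SegStep l p q → σ p.2 p.1 = σ q.2 q.1 then F σ else 0 := by
    rw [← if_congr (compat_iff_segStep l σ) rfl rfl, ite_and]
    congr 1
    simp only [labelOp, Matrix.of_apply]
    by_cases h : ∀ i : Fin k, Compat (l i) (σ i.castSucc) (σ i.succ)
    · simp [h]
    · obtain ⟨i, hi⟩ := not_forall.mp h
      rw [if_neg h, Finset.prod_eq_zero (Finset.mem_univ i) (if_neg hi), mul_zero]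
  rw [Finset.sum_congr rfl fun σ _ => h1 σ, ← Finset.sum_filter]
  symm
  refine Finset.sum_bij (fun c _ i x => c (segLoop l (x, i))) ?_ ?_ ?_ fun _ _ => rfl
  · intro c _
    rw [Finset.mem_filter]
    exact ⟨Finset.mem_univ _, fun p q hpq => congrArg c (segLoop_eq_of_segStep hpq)⟩
  · intro c _ c' _ h
    funext q
    induction q using Quotient.inductionOn with
    | _ p => exact congrFun (congrFun h p.2) p.1
  · intro σ hσ
    rw [Finset.mem_filter] at hσ
    refine ⟨Quotient.lift (fun p : V × Fin (k + 1) => σ p.2 p.1) fun p q hpq => ?_,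
      Finset.mem_univ _, rfl⟩
    induction hpq with
    | rel p q h => exact hσ.2 p q h
    | refl p => rfl
    | symm p q _ ih => exact ih.symm
    | trans p q r _ _ ih1 ih2 => exact ih1.trans ih2

end Segments

/-! ### Moments of independent spins -/

section SpinSums

/-- The eigenvalues of the spin operator. -/
noncomputable def spinVal (n : ℕ) (a : Fin (n + 1)) : ℝ := (a : ℝ) - (n : ℝ) / 2

theorem sum_spinVal (n : ℕ) : ∑ a, spinVal n a = 0 := by
  have h : ∑ a, spinVal n a = -∑ a, spinVal n a := by
    rw [← Finset.sum_neg_distrib, ← Equiv.sum_comp Fin.revPerm]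
    refine Finset.sum_congr rfl fun a _ => ?_
    have : (a : ℕ) ≤ n := Nat.lt_succ_iff.mp a.2
    simp only [spinVal, Fin.revPerm_apply, Fin.val_rev, Nat.add_sub_add_right]
    push_cast [this]
    ring
  linarith

/-- With `S = n/2`, the constant `n (n + 2)/12` is `S (S + 1)/3`, the variance of a uniform spin. -/
theorem sum_spinVal_sq (n : ℕ) :
    ∑ a, spinVal n a * spinVal n a = (n + 1) * ((n : ℝ) * (n + 2) / 12) := by
  -- The upper limit `m` is separated from the centre `n/2`, which stays fixed during the induction.
  have h1 : ∀ m : ℕ, ∑ a ∈ Finset.range (m + 1), ((a : ℝ) - (n : ℝ) / 2) * ((a : ℝ) - (n : ℝ) / 2) =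
      (m + 1) * (m * (2 * m + 1) / 6 - m * n / 2 + n ^ 2 / 4) := by
    intro m
    induction m with
    | zero => simp; ring
    | succ m ih => rw [Finset.sum_range_succ, ih]; push_cast; ring
  have h2 := h1 n
  rw [Finset.sum_range] at h2
  simp only [spinVal]
  rw [h2]
  ring

theorem sum_pi_prod {Q ι : Type*} [Fintype Q] [DecidableEq Q] [Fintype ι] (f : Q → ι → ℝ) :
    ∑ c : Q → ι, ∏ r, f r (c r) = ∏ r, ∑ a, f r a := by
  rw [Finset.prod_univ_sum, Fintype.piFinset_univ]

/-- Writing the two factors as products over all loops makes the sum factorize. Distinct loops give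
a factor with mean zero; equal loops give the variance. -/
theorem sum_spinVal_mul_spinVal (n : ℕ) {Q : Type*} [Fintype Q] [DecidableEq Q] (p q : Q) :
    ∑ c : Q → Fin (n + 1), spinVal n (c p) * spinVal n (c q) =
      if p = q then ((n : ℝ) + 1) ^ Fintype.card Q * ((n : ℝ) * (n + 2) / 12) else 0 := by
  have h1 (c : Q → Fin (n + 1)) : spinVal n (c p) * spinVal n (c q) =
      ∏ r, ((if r = p then spinVal n (c r) else 1) * if r = q then spinVal n (c r) else 1) := by
    rw [Finset.prod_mul_distrib]
    simp
  rw [Finset.sum_congr rfl fun c _ => h1 c, sum_pi_prod fun r a =>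
    (if r = p then spinVal n a else 1) * if r = q then spinVal n a else 1]
  split_ifs with h
  · subst h
    rw [← Finset.mul_prod_erase _ _ (Finset.mem_univ p)]
    have h2 : ∀ r ∈ Finset.univ.erase p, (∑ a, (if r = p then spinVal n a else 1) *
        if r = p then spinVal n a else 1) = (n : ℝ) + 1 := by
      intro r hr
      simp [Finset.ne_of_mem_erase hr]
    rw [Finset.prod_congr rfl h2, Finset.prod_const, Finset.card_erase_of_mem (Finset.mem_univ p)]
    simp only [if_true, sum_spinVal_sq, Finset.card_univ]
    obtain ⟨m, hm⟩ : ∃ m, Fintype.card Q = m + 1 :=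
      Nat.exists_eq_succ_of_ne_zero (Fintype.card_pos_iff.mpr ⟨p⟩).ne'
    rw [hm, Nat.add_sub_cancel, pow_succ]
    ring
  · refine Finset.prod_eq_zero (Finset.mem_univ p) ?_
    simp [h, sum_spinVal]

end SpinSums

/-! ### Traces of powers as sums over loop configurations -/

section TraceExpansion

variable {V : Type*} {G : SimpleGraph V} [Fintype V] [DecidableEq V] [Fintype G.edgeSet]

/-- The weight of a label. -/
def labelWeight (u : ℝ) (l : Label G) : ℝ :=
  match l.2 with
  | .cross => u
  | .bar => 1 - u

variable (G) in
/-- The operator `∑_{{x,y} ∈ 𝓔} (u T_{xy} + (1 - u) Q_{xy})`, as a real matrix. -/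
noncomputable def hopping (n : ℕ) (u : ℝ) : Matrix (V → Fin (n + 1)) (V → Fin (n + 1)) ℝ :=
  ∑ l : Label G, labelWeight u l • labelOp n l

theorem trace_expansion (n : ℕ) (u : ℝ) (k : ℕ) (f : (V → Fin (n + 1)) → ℝ)
    (D : Fin (k + 1) → (V → Fin (n + 1)) → ℝ) :
    (Matrix.diagonal f * pathProd k (fun _ => hopping G n u) D).trace =
      ∑ l : Fin k → Label G, (∏ i, labelWeight u (l i)) * ∑ c : SegLoop l → Fin (n + 1),
        f (fun x => c (segLoop l (x, 0))) * ∏ i, D i fun x => c (segLoop l (x, i)) := by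
  simp only [hopping]
  rw [← sum_pathProd k (fun _ l => labelWeight u l • labelOp n l) D, Finset.mul_sum,
    Matrix.trace_sum]
  refine Finset.sum_congr rfl fun l _ => ?_
  rw [← sum_closed_paths n l (fun σ => f (σ 0) * ∏ i, D i (σ i)), trace_diagonal_mul_pathProd,
    Finset.mul_sum]
  refine Finset.sum_congr rfl fun σ _ => ?_
  split_ifs
  · simp only [Matrix.smul_apply, smul_eq_mul, Finset.prod_mul_distrib]
    ring
  · simp

theorem trace_hopping_pow (n : ℕ) (u : ℝ) (k : ℕ) :
    (hopping G n u ^ k).trace = ∑ l : Fin k → Label G, (∏ i, labelWeight u (l i)) *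
      ((n : ℝ) + 1) ^ Fintype.card (SegLoop l) := by
  have h := trace_expansion (G := G) n u k 1 1
  rw [pathProd_one] at h
  simpa using h

variable (V) in
/-- The eigenvalues of the total spin. -/
noncomputable def totalSpin (n : ℕ) (σ : V → Fin (n + 1)) : ℝ := ∑ x, spinVal n (σ x)

/-- The two spin observables sit in the time intervals `0` and `j`; only pairs of segments in the
same loop are correlated. -/
theorem trace_totalSpin_hopping_pow (n : ℕ) (u : ℝ) (k : ℕ) (j : Fin (k + 1)) :
    (Matrix.diagonal (totalSpin V n) * (hopping G n u ^ (j : ℕ) * Matrix.diagonal (totalSpin V n) *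
      hopping G n u ^ (k - j))).trace =
    ∑ l : Fin k → Label G, (∏ i, labelWeight u (l i)) * ∑ x, ∑ y,
      if segLoop l (x, 0) = segLoop l (y, j) then
        ((n : ℝ) + 1) ^ Fintype.card (SegLoop l) * ((n : ℝ) * (n + 2) / 12) else 0 := by
  rw [← pathProd_update, trace_expansion]
  refine Finset.sum_congr rfl fun l _ => ?_
  congr 1
  have h1 (c : SegLoop l → Fin (n + 1)) : ∏ i, (Function.update 1 j (totalSpin V n) :
      Fin (k + 1) → (V → Fin (n + 1)) → ℝ) i (fun x => c (segLoop l (x, i))) =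
      totalSpin V n fun x => c (segLoop l (x, j)) := by
    rw [Finset.prod_eq_single j]
    · simp
    · intro i _ hi
      simp [Function.update_of_ne hi]
    · simp
  simp only [h1, totalSpin, Finset.sum_mul_sum]
  rw [Finset.sum_comm]
  refine Finset.sum_congr rfl fun x _ => ?_
  rw [Finset.sum_comm]
  refine Finset.sum_congr rfl fun y _ => ?_
  exact sum_spinVal_mul_spinVal n _ _

theorem trace_totalSpin_mul_hopping_pow (n : ℕ) (u : ℝ) (k : ℕ) :
    (Matrix.diagonal (totalSpin V n) * hopping G n u ^ k).trace = 0 := by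
  rw [← pathProd_one, trace_expansion]
  refine Finset.sum_eq_zero fun l _ => ?_
  have h (x : V) : ∑ c : SegLoop l → Fin (n + 1), spinVal n (c (segLoop l (x, 0))) = 0 := by
    have h1 (c : SegLoop l → Fin (n + 1)) : spinVal n (c (segLoop l (x, 0))) =
        ∏ r, (if r = segLoop l (x, 0) then spinVal n (c r) else 1) := by simp
    rw [Finset.sum_congr rfl fun c _ => h1 c, sum_pi_prod fun r a =>
      if r = segLoop l (x, 0) then spinVal n a else 1]
    exact Finset.prod_eq_zero (Finset.mem_univ (segLoop l (x, 0))) (by simp [sum_spinVal])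
  simp only [Pi.one_apply, Finset.prod_const_one, mul_one, totalSpin]
  rw [Finset.sum_comm, Finset.sum_eq_zero fun x _ => h x, mul_zero]

end TraceExpansion

/-! ### Loops of a realization with sorted times -/

section SortedRealizations

variable {V : Type*} {G : SimpleGraph V} {k : ℕ}

/-- The realization with given labels and times. -/
noncomputable def realization (l : Fin k → Label G) (t : Fin k → ℝ) : Realization G :=
  Configuration.ofFamily fun i => ((l i).1, t i, (l i).2)

theorem Configuration.mem_points_ofFamily {X : Type*} {f : Fin k → X} {a : X} :
    a ∈ (Configuration.ofFamily f).points ↔ ∃ i, f i = a := by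
  classical
  simp [Configuration.ofFamily]

theorem quiet_realization_iff {l : Fin k → Label G} {t : Fin k → ℝ} {x : V} {r s : ℝ} :
    Quiet (realization l t) x r s ↔ ∀ i, x ∈ ((l i).1 : Sym2 V) → t i ∉ Set.Icc r s := by
  simp only [Quiet, realization, Configuration.mem_points_ofFamily]
  exact ⟨fun h i => h _ ⟨i, rfl⟩, by rintro h _ ⟨i, rfl⟩; exact h i⟩

theorem uniqueTransition_realization_iff {l : Fin k → Label G} {t : Fin k → ℝ} (ht : StrictMono t)
    {d : Kind} {x y : V} {r s : ℝ} :
    UniqueTransition (realization l t) d x y r s ↔ ∃ i, ((l i).1 : Sym2 V) = s(x, y) ∧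
      (l i).2 = d ∧ r < t i ∧ t i < s ∧ ∀ j, (x ∈ ((l j).1 : Sym2 V) ∨ y ∈ ((l j).1 : Sym2 V)) →
        t j ∈ Set.Icc r s → j = i := by
  simp only [UniqueTransition, realization, Configuration.mem_points_ofFamily]
  constructor
  · rintro ⟨_, ⟨i, rfl⟩, h1, h2, h3, h4, h5⟩
    exact ⟨i, h1, h2, h3, h4, fun j hj hjt =>
      ht.injective (congrArg (fun q => q.2.1) (h5 _ ⟨j, rfl⟩ hj hjt))⟩
  · rintro ⟨i, h1, h2, h3, h4, h5⟩
    refine ⟨_, ⟨i, rfl⟩, h1, h2, h3, h4, ?_⟩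
    rintro _ ⟨j, rfl⟩ hj hjt
    rw [h5 j hj hjt]

/-- The index of the time interval that contains `r`, when the times of the transitions are `t`. -/
noncomputable def segIdx (t : Fin k → ℝ) (r : ℝ) : Fin (k + 1) :=
  ⟨(Finset.univ.filter fun i => t i < r).card,
    Nat.lt_succ_of_le ((Finset.card_le_univ _).trans (Fintype.card_fin k).le)⟩

theorem segIdx_val (t : Fin k → ℝ) (r : ℝ) :
    (segIdx t r : ℕ) = (Finset.univ.filter fun i => t i < r).card := rfl

variable {l : Fin k → Label G} {t : Fin k → ℝ}

/-- Since `t` is increasing, the indices counted by `segIdx` form an initial segment. A time that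
equals `t i` belongs to the interval below `t i`. -/
theorem lt_segIdx_iff (ht : StrictMono t) {r : ℝ} {i : Fin k} :
    (i : ℕ) < segIdx t r ↔ t i < r := by
  constructor
  · intro h
    by_contra h'
    refine absurd h (not_lt.mpr ?_)
    rw [← Fin.card_Iio i, segIdx_val]
    refine Finset.card_le_card fun j hj => ?_
    rw [Finset.mem_filter] at hj
    rw [Finset.mem_Iio]
    exact ht.lt_iff_lt.mp (hj.2.trans_le (not_lt.mp h'))
  · intro h
    refine lt_of_lt_of_le (Nat.lt_succ_self i) ?_
    rw [Nat.succ_eq_add_one, ← Fin.card_Iic i, segIdx_val]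
    refine Finset.card_le_card fun j hj => ?_
    rw [Finset.mem_Iic] at hj
    rw [Finset.mem_filter]
    exact ⟨Finset.mem_univ _, (ht.monotone hj).trans_lt h⟩

theorem segIdx_le_iff (ht : StrictMono t) {r : ℝ} {i : Fin k} :
    (segIdx t r : ℕ) ≤ i ↔ r ≤ t i := by
  rw [← not_lt, lt_segIdx_iff ht, not_lt]

theorem segIdx_mono {r s : ℝ} (h : r ≤ s) : segIdx t r ≤ segIdx t s := by
  rw [Fin.le_def, segIdx_val, segIdx_val]
  refine Finset.card_le_card fun i hi => ?_
  rw [Finset.mem_filter] at hi ⊢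
  exact ⟨hi.1, hi.2.trans_le h⟩

theorem segIdx_zero (h0 : ∀ i, 0 < t i) : segIdx t 0 = 0 := by
  apply Fin.ext
  simp [segIdx, fun i => (h0 i).le]

theorem segIdx_eq_last {β : ℝ} (hβ : ∀ i, t i < β) : segIdx t β = Fin.last k := by
  apply Fin.ext
  simp [segIdx, hβ]

theorem segIdx_eq_of_between (ht : StrictMono t) {r : ℝ} {j : Fin (k + 1)}
    (h1 : ∀ i : Fin k, (i : ℕ) < j → t i < r) (h2 : ∀ i : Fin k, (j : ℕ) ≤ i → r < t i) :
    segIdx t r = j := by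
  apply Fin.ext
  apply le_antisymm
  · by_contra hlt
    have hj : (j : ℕ) < k := (not_le.mp hlt).trans_le (Nat.lt_succ_iff.mp (segIdx t r).2)
    exact (h2 ⟨j, hj⟩ le_rfl).not_gt ((lt_segIdx_iff (i := ⟨j, hj⟩) ht).mp (not_le.mp hlt))
  · by_contra hlt
    have hj : (segIdx t r : ℕ) < k := (not_le.mp hlt).trans_le (Nat.lt_succ_iff.mp j.2)
    exact (h1 ⟨_, hj⟩ (not_le.mp hlt)).not_ge ((segIdx_le_iff (i := ⟨_, hj⟩) ht).mp le_rfl)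

/-- Segments of the same vertex are in the same loop if there is no transition in between. -/
theorem segLoop_vertical {x : V} {a b : Fin (k + 1)} (hab : a ≤ b)
    (h : ∀ i : Fin k, (a : ℕ) ≤ i → (i : ℕ) < b → x ∉ ((l i).1 : Sym2 V)) :
    segLoop l (x, a) = segLoop l (x, b) := by
  obtain ⟨a, ha⟩ := a
  obtain ⟨b, hb⟩ := b
  simp only [Fin.mk_le_mk] at hab
  induction b, hab using Nat.le_induction with
  | base => rfl
  | succ b hab ih =>
    have hbk : b < k := Nat.lt_of_succ_lt_succ hb
    rw [ih (hbk.trans (Nat.lt_succ_self k)) fun i h1 h2 => h i h1 (Nat.lt_succ_of_lt h2)]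
    exact segLoop_eq_of_segStep (.straight x ⟨b, hbk⟩ (h ⟨b, hbk⟩ hab (Nat.lt_succ_self b)))

/-- The loop that contains a point of space-time. -/
noncomputable def pointLoop (l : Fin k → Label G) (t : Fin k → ℝ) (x : V) (r : ℝ) : SegLoop l :=
  segLoop l (x, segIdx t r)

theorem pointLoop_eq_of_quiet (ht : StrictMono t) {x : V} {r s : ℝ} (hrs : r ≤ s)
    (h : Quiet (realization l t) x r s) : pointLoop l t x r = pointLoop l t x s := by
  rw [quiet_realization_iff] at h
  refine segLoop_vertical (segIdx_mono hrs) fun i h1 h2 hx => h i hx ⟨?_, ?_⟩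
  · exact (segIdx_le_iff ht).mp h1
  · exact ((lt_segIdx_iff ht).mp h2).le

/-- Between `r` and `s` there may be transitions on other vertices, so `r` and `s` need not lie in
the intervals adjacent to `t i`; these transitions do not touch `x` or `y`, and the segments in
between are joined vertically. -/
theorem pointLoop_of_uniqueTransition (ht : StrictMono t) {d : Kind} {x y : V} {r s : ℝ}
    (h : UniqueTransition (realization l t) d x y r s) :
    ∃ i, ((l i).1 : Sym2 V) = s(x, y) ∧ (l i).2 = d ∧
      pointLoop l t x r = segLoop l (x, i.castSucc) ∧
      pointLoop l t y r = segLoop l (y, i.castSucc) ∧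
      pointLoop l t x s = segLoop l (x, i.succ) ∧ pointLoop l t y s = segLoop l (y, i.succ) := by
  rw [uniqueTransition_realization_iff ht] at h
  obtain ⟨i, h1, h2, h3, h4, h5⟩ := h
  have key1 (z : V) (hz : z = x ∨ z = y) :
      pointLoop l t z r = segLoop l (z, i.castSucc) := by
    refine segLoop_vertical ((segIdx_le_iff ht).mpr h3.le) fun j hj1 hj2 hj => ?_
    have hji : j < i := hj2
    refine hji.ne (h5 j ?_ ⟨(segIdx_le_iff ht).mp hj1, ((ht hji).trans h4).le⟩)
    rcases hz with rfl | rfl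
    exacts [.inl hj, .inr hj]
  have key2 (z : V) (hz : z = x ∨ z = y) :
      pointLoop l t z s = segLoop l (z, i.succ) := by
    symm
    refine segLoop_vertical (Nat.succ_le_of_lt ((lt_segIdx_iff ht).mpr h4)) fun j hj1 hj2 hj => ?_
    have hij : i < j := hj1
    refine hij.ne' (h5 j ?_ ⟨(h3.trans (ht hij)).le, ((lt_segIdx_iff ht).mp hj2).le⟩)
    rcases hz with rfl | rfl
    exacts [.inl hj, .inr hj]
  exact ⟨i, h1, h2, key1 x (.inl rfl), key1 y (.inr rfl), key2 x (.inl rfl), key2 y (.inr rfl)⟩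

theorem UniqueTransition.quiet {ω : Realization G} {d : Kind} {x y : V} {r s : ℝ}
    (h : UniqueTransition ω d x y r s) :
    r ≤ s ∧ Quiet ω x r r ∧ Quiet ω y r r ∧ Quiet ω x s s ∧ Quiet ω y s s := by
  obtain ⟨p, -, -, -, h1, h2, h3⟩ := h
  have hrs : r ≤ s := (h1.trans h2).le
  have key (z : V) (hz : z = x ∨ z = y) (a : ℝ) (ha : a = r ∨ a = s) : Quiet ω z a a := by
    intro q hq hz' hqa
    have hqa' : q.2.1 = a := le_antisymm hqa.2 hqa.1
    have hqp : q = p := h3 q hq (by rcases hz with rfl | rfl; exacts [.inl hz', .inr hz']) (by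
      rw [hqa']
      rcases ha with rfl | rfl
      exacts [⟨le_rfl, hrs⟩, ⟨hrs, le_rfl⟩])
    subst hqp
    rw [hqa'] at h1 h2
    rcases ha with rfl | rfl
    exacts [h1.false, h2.false]
  exact ⟨hrs, key x (.inl rfl) r (.inl rfl), key y (.inr rfl) r (.inl rfl),
    key x (.inl rfl) s (.inr rfl), key y (.inr rfl) s (.inr rfl)⟩

theorem Quiet.mono {ω : Realization G} {x : V} {r s r' s' : ℝ} (h : Quiet ω x r s) (h1 : r ≤ r')
    (h2 : s' ≤ s) : Quiet ω x r' s' :=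
  fun p hp hx hpt => h p hp hx ⟨h1.trans hpt.1, hpt.2.trans h2⟩

variable {β : ℝ}

/-- The points of space-time where there is no transition. -/
def IsRegular (β : ℝ) (ω : Realization G) (x : V) (r : ℝ) : Prop :=
  r ∈ Set.Icc 0 β ∧ Quiet ω x r r

theorem isRegular_zero (h0 : ∀ i, 0 < t i) (hβ0 : 0 ≤ β) (x : V) :
    IsRegular β (realization l t) x 0 :=
  ⟨⟨le_rfl, hβ0⟩, quiet_realization_iff.mpr fun i _ h => (h0 i).not_ge h.2⟩

theorem isRegular_end (hβ : ∀ i, t i < β) (hβ0 : 0 ≤ β) (x : V) :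
    IsRegular β (realization l t) x β :=
  ⟨⟨hβ0, le_rfl⟩, quiet_realization_iff.mpr fun i _ h => (hβ i).not_ge h.1⟩

/-- Both endpoints of a move are free of transitions, so a loop started at a regular point never
reaches an irregular one. -/
theorem move_invariant (ht : StrictMono t) (h0 : ∀ i, 0 < t i) (hβ : ∀ i, t i < β) (hβ0 : 0 ≤ β)
    {p q : V × ℝ × Direction} (h : Move β (realization l t) p q) :
    IsRegular β (realization l t) p.1 p.2.1 ∧ IsRegular β (realization l t) q.1 q.2.1 ∧
      pointLoop l t p.1 p.2.1 = pointLoop l t q.1 q.2.1 := by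
  have hends (x : V) : pointLoop l t x β = pointLoop l t x 0 := by
    rw [pointLoop, pointLoop, segIdx_zero h0, segIdx_eq_last hβ]
    exact segLoop_eq_of_segStep (.around x)
  cases h with
  | vertical_up x s r hs hsr hr h =>
    exact ⟨⟨⟨hs, hsr.trans hr⟩, h.mono le_rfl hsr⟩, ⟨⟨hs.trans hsr, hr⟩, h.mono hsr le_rfl⟩,
      pointLoop_eq_of_quiet ht hsr h⟩
  | vertical_down x s r hs hsr hr h =>
    exact ⟨⟨⟨hs.trans hsr, hr⟩, h.mono hsr le_rfl⟩, ⟨⟨hs, hsr.trans hr⟩, h.mono le_rfl hsr⟩,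
      (pointLoop_eq_of_quiet ht hsr h).symm⟩
  | around_up x => exact ⟨isRegular_end hβ hβ0 x, isRegular_zero h0 hβ0 x, hends x⟩
  | around_down x => exact ⟨isRegular_zero h0 hβ0 x, isRegular_end hβ hβ0 x, (hends x).symm⟩
  | cross_up x y s r hs hr h =>
    obtain ⟨hsr, q1, q2, q3, q4⟩ := h.quiet
    obtain ⟨i, h1, h2, e1, e2, e3, e4⟩ := pointLoop_of_uniqueTransition ht h
    exact ⟨⟨⟨hs, hsr.trans hr⟩, q1⟩, ⟨⟨hs.trans hsr, hr⟩, q4⟩,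
      e1.trans ((segLoop_eq_of_segStep (.cross x y i h1 h2)).trans e4.symm)⟩
  | cross_down x y s r hs hr h =>
    obtain ⟨hsr, q1, q2, q3, q4⟩ := h.quiet
    obtain ⟨i, h1, h2, e1, e2, e3, e4⟩ := pointLoop_of_uniqueTransition ht h
    exact ⟨⟨⟨hs.trans hsr, hr⟩, q3⟩, ⟨⟨hs, hsr.trans hr⟩, q2⟩, e3.trans ((segLoop_eq_of_segStep
      (.cross y x i (h1.trans Sym2.eq_swap) h2)).symm.trans e2.symm)⟩
  | bar_up x y s r hs hr h =>
    obtain ⟨hsr, q1, q2, q3, q4⟩ := h.quiet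
    obtain ⟨i, h1, h2, e1, e2, e3, e4⟩ := pointLoop_of_uniqueTransition ht h
    exact ⟨⟨⟨hs, hsr.trans hr⟩, q1⟩, ⟨⟨hs, hsr.trans hr⟩, q2⟩,
      e1.trans ((segLoop_eq_of_segStep (.bar_below x y i h1 h2)).trans e2.symm)⟩
  | bar_down x y s r hs hr h =>
    obtain ⟨hsr, q1, q2, q3, q4⟩ := h.quiet
    obtain ⟨i, h1, h2, e1, e2, e3, e4⟩ := pointLoop_of_uniqueTransition ht h
    exact ⟨⟨⟨hs.trans hsr, hr⟩, q3⟩, ⟨⟨hs.trans hsr, hr⟩, q4⟩,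
      e3.trans ((segLoop_eq_of_segStep (.bar_above x y i h1 h2)).trans e4.symm)⟩

theorem sameTrajectory_invariant (ht : StrictMono t) (h0 : ∀ i, 0 < t i) (hβ : ∀ i, t i < β)
    (hβ0 : 0 ≤ β) {p q : V × ℝ × Direction} (h : SameTrajectory β (realization l t) p q) :
    (IsRegular β (realization l t) p.1 p.2.1 ↔ IsRegular β (realization l t) q.1 q.2.1) ∧
      pointLoop l t p.1 p.2.1 = pointLoop l t q.1 q.2.1 := by
  induction h with
  | rel p q h =>
    obtain ⟨h1, h2, h3⟩ := move_invariant ht h0 hβ hβ0 h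
    exact ⟨iff_of_true h1 h2, h3⟩
  | refl p => exact ⟨Iff.rfl, rfl⟩
  | symm p q _ ih => exact ⟨ih.1.symm, ih.2.symm⟩
  | trans p q r _ _ ih1 ih2 => exact ⟨ih1.1.trans ih2.1, ih1.2.trans ih2.2⟩

/-- Two points of space-time are visited by the same trajectories, up to the direction. -/
def Connected (β : ℝ) (ω : Realization G) (p q : V × ℝ) : Prop :=
  (∀ d, ∃ e, SameTrajectory β ω (p.1, p.2, d) (q.1, q.2, e)) ∧
    ∀ e, ∃ d, SameTrajectory β ω (p.1, p.2, d) (q.1, q.2, e)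

theorem Connected.symm {ω : Realization G} {p q : V × ℝ} (h : Connected β ω p q) :
    Connected β ω q p :=
  ⟨fun e => (h.2 e).imp fun _ => .symm _ _, fun d => (h.1 d).imp fun _ => .symm _ _⟩

theorem Connected.trans {ω : Realization G} {p q r : V × ℝ} (h : Connected β ω p q)
    (h' : Connected β ω q r) : Connected β ω p r := by
  constructor
  · intro d
    obtain ⟨e, he⟩ := h.1 d
    obtain ⟨f, hf⟩ := h'.1 e
    exact ⟨f, he.trans _ _ _ hf⟩
  · intro f
    obtain ⟨e, he⟩ := h'.2 f
    obtain ⟨d, hd⟩ := h.2 e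
    exact ⟨d, hd.trans _ _ _ he⟩

theorem Connected.refl {ω : Realization G} (p : V × ℝ) : Connected β ω p p :=
  ⟨fun d => ⟨d, .refl _⟩, fun d => ⟨d, .refl _⟩⟩

theorem connected_of_quiet {ω : Realization G} {x : V} {r s : ℝ} (hr : 0 ≤ r) (hrs : r ≤ s)
    (hs : s ≤ β) (h : Quiet ω x r s) : Connected β ω (x, r) (x, s) := by
  have key (d : Direction) : SameTrajectory β ω (x, r, d) (x, s, d) := by
    cases d with
    | up => exact .rel _ _ (.vertical_up x r s hr hrs hs h)
    | down => exact .symm _ _ (.rel _ _ (.vertical_down x r s hr hrs hs h))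
  exact ⟨fun d => ⟨d, key d⟩, fun d => ⟨d, key d⟩⟩

theorem connected_around {ω : Realization G} (x : V) : Connected β ω (x, β) (x, 0) := by
  have key (d : Direction) : SameTrajectory β ω (x, β, d) (x, 0, d) := by
    cases d with
    | up => exact .rel _ _ (.around_up x)
    | down => exact .symm _ _ (.rel _ _ (.around_down x))
  exact ⟨fun d => ⟨d, key d⟩, fun d => ⟨d, key d⟩⟩

theorem UniqueTransition.swap {ω : Realization G} {d : Kind} {x y : V} {r s : ℝ}
    (h : UniqueTransition ω d x y r s) : UniqueTransition ω d y x r s := by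
  obtain ⟨p, h1, h2, h3, h4, h5, h6⟩ := h
  exact ⟨p, h1, h2.trans Sym2.eq_swap, h3, h4, h5, fun q hq hxy => h6 q hq hxy.symm⟩

theorem connected_cross {ω : Realization G} {x y : V} {r s : ℝ} (hr : 0 ≤ r) (hs : s ≤ β)
    (h : UniqueTransition ω .cross x y r s) : Connected β ω (x, r) (y, s) := by
  have key (d : Direction) : SameTrajectory β ω (x, r, d) (y, s, d) := by
    cases d with
    | up => exact .rel _ _ (.cross_up x y r s hr hs h)
    | down => exact .symm _ _ (.rel _ _ (.cross_down y x r s hr hs h.swap))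
  exact ⟨fun d => ⟨d, key d⟩, fun d => ⟨d, key d⟩⟩

theorem connected_bar {ω : Realization G} {x y : V} {r s : ℝ} (hr : 0 ≤ r) (hs : s ≤ β)
    (h : UniqueTransition ω .bar x y r s) :
    Connected β ω (x, r) (y, r) ∧ Connected β ω (x, s) (y, s) := by
  have h1 := Move.bar_up (β := β) x y r s hr hs h
  have h2 := Move.bar_up (β := β) y x r s hr hs h.swap
  have h3 := Move.bar_down (β := β) x y r s hr hs h
  have h4 := Move.bar_down (β := β) y x r s hr hs h.swap
  refine ⟨⟨fun d => ?_, fun d => ?_⟩, fun d => ?_, fun d => ?_⟩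
  · cases d
    exacts [⟨.down, .rel _ _ h1⟩, ⟨.up, .symm _ _ (.rel _ _ h2)⟩]
  · cases d
    exacts [⟨.down, .symm _ _ (.rel _ _ h2)⟩, ⟨.up, .rel _ _ h1⟩]
  · cases d
    exacts [⟨.down, .symm _ _ (.rel _ _ h4)⟩, ⟨.up, .rel _ _ h3⟩]
  · cases d
    exacts [⟨.down, .rel _ _ h3⟩, ⟨.up, .symm _ _ (.rel _ _ h4)⟩]

/-- Points of the same segment are connected. -/
theorem connected_of_segIdx_eq (ht : StrictMono t) {x : V} {r s : ℝ}
    (hr : IsRegular β (realization l t) x r) (hs : IsRegular β (realization l t) x s)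
    (h : segIdx t r = segIdx t s) : Connected β (realization l t) (x, r) (x, s) := by
  wlog hrs : r ≤ s generalizing r s
  · exact (this hs hr h.symm (le_of_not_ge hrs)).symm
  refine connected_of_quiet hr.1.1 hrs hs.1.2 (quiet_realization_iff.mpr fun i hi hti => ?_)
  have h1 := quiet_realization_iff.mp hr.2 i hi
  have h2 := quiet_realization_iff.mp hs.2 i hi
  have h3 : r < t i := lt_of_le_of_ne hti.1 fun h => h1 ⟨h.le, h.ge⟩
  have h4 : t i < s := lt_of_le_of_ne hti.2 fun h => h2 ⟨h.ge, h.le⟩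
  rw [← lt_segIdx_iff ht, ← h, lt_segIdx_iff ht] at h4
  exact h3.not_gt h4

/-- Every time interval contains a time that is not the time of a transition. -/
theorem exists_segIdx_eq (ht : StrictMono t) (h0 : ∀ i, 0 < t i) (hβ : ∀ i, t i < β) (hβ0 : 0 < β)
    (j : Fin (k + 1)) : ∃ r, 0 < r ∧ r < β ∧ (∀ i : Fin k, (i : ℕ) < j → t i < r) ∧
      ∀ i : Fin k, (j : ℕ) ≤ i → r < t i := by
  obtain ⟨r, h1, h2⟩ := Order.exists_between_finsets
    (lo := insert 0 ((Finset.univ.filter fun i : Fin k => (i : ℕ) < j).image t))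
    (hi := insert β ((Finset.univ.filter fun i : Fin k => (j : ℕ) ≤ i).image t)) (by
      intro a ha b hb
      simp only [Finset.mem_insert, Finset.mem_image, Finset.mem_filter, Finset.mem_univ,
        true_and] at ha hb
      rcases ha with rfl | ⟨i, hi, rfl⟩ <;> rcases hb with rfl | ⟨i', hi', rfl⟩
      exacts [hβ0, h0 _, hβ _, ht (show (i : ℕ) < i' from hi.trans_le hi')])
  refine ⟨r, h1 0 (by simp), h2 β (by simp), fun i hi => h1 _ ?_, fun i hi => h2 _ ?_⟩
  · exact Finset.mem_insert_of_mem (Finset.mem_image_of_mem t (by simpa using hi))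
  · exact Finset.mem_insert_of_mem (Finset.mem_image_of_mem t (by simpa using hi))

/-- Converse to the invariance: with one chosen time `m j` inside each interval, every `SegStep` is
realized by moves. Double bars reverse the direction, so only `Connected`, which leaves the other
direction free, can be propagated. -/
theorem connected_of_segLoop_eq (ht : StrictMono t) (h0 : ∀ i, 0 < t i) (hβ : ∀ i, t i < β)
    (hβ0 : 0 < β) {x y : V} {r s : ℝ} (hr : IsRegular β (realization l t) x r)
    (hs : IsRegular β (realization l t) y s) (h : pointLoop l t x r = pointLoop l t y s) :
    Connected β (realization l t) (x, r) (y, s) := by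
  choose m hm0 hmβ hml hmr using exists_segIdx_eq ht h0 hβ hβ0
  have hidx (j : Fin (k + 1)) : segIdx t (m j) = j :=
    segIdx_eq_of_between ht (hml j) (hmr j)
  have hreg (z : V) (j : Fin (k + 1)) : IsRegular β (realization l t) z (m j) := by
    refine ⟨⟨(hm0 j).le, (hmβ j).le⟩, quiet_realization_iff.mpr fun i _ hi => ?_⟩
    rcases lt_or_ge (i : ℕ) j with hij | hij
    exacts [(hml j i hij).not_ge hi.1, (hmr j i hij).not_ge hi.2]
  have hbetween (i j : Fin k) (hj : t j ∈ Set.Icc (m i.castSucc) (m i.succ)) : j = i := by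
    rcases lt_trichotomy (j : ℕ) i with hij | hij | hij
    · exact absurd hj.1 (hml i.castSucc j hij).not_ge
    · exact Fin.ext hij
    · exact absurd hj.2 (hmr i.succ j (by simpa using hij)).not_ge
  have hunique (x y : V) (i : Fin k) (d : Kind) (h1 : ((l i).1 : Sym2 V) = s(x, y))
      (h2 : (l i).2 = d) :
      UniqueTransition (realization l t) d x y (m i.castSucc) (m i.succ) :=
    (uniqueTransition_realization_iff ht).mpr ⟨i, h1, h2, hmr i.castSucc i (by simp),
      hml i.succ i (by simp), fun j _ hj => hbetween i j hj⟩
  have hstep {p q : V × Fin (k + 1)} (hpq : SegStep l p q) :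
      Connected β (realization l t) (p.1, m p.2) (q.1, m q.2) := by
    cases hpq with
    | around x =>
      refine (connected_of_segIdx_eq ht (hreg x _) (isRegular_end hβ hβ0.le x) ?_).trans
        ((connected_around x).trans
          (connected_of_segIdx_eq ht (isRegular_zero h0 hβ0.le x) (hreg x _) ?_))
      · rw [hidx, segIdx_eq_last hβ]
      · rw [hidx, segIdx_zero h0]
    | straight x i hx =>
      refine connected_of_quiet (hm0 _).le
        ((hmr i.castSucc i (by simp)).trans (hml i.succ i (by simp))).le (hmβ _).le
        (quiet_realization_iff.mpr fun j hj hjt => hx ?_)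
      rwa [hbetween i j hjt] at hj
    | cross x y i h1 h2 => exact connected_cross (hm0 _).le (hmβ _).le (hunique x y i _ h1 h2)
    | bar_below x y i h1 h2 =>
      exact (connected_bar (hm0 _).le (hmβ _).le (hunique x y i _ h1 h2)).1
    | bar_above x y i h1 h2 =>
      exact (connected_bar (hm0 _).le (hmβ _).le (hunique x y i _ h1 h2)).2
  have hgen {p q : V × Fin (k + 1)} (hpq : Relation.EqvGen (SegStep l) p q) :
      Connected β (realization l t) (p.1, m p.2) (q.1, m q.2) := by
    induction hpq with
    | rel p q h => exact hstep h
    | refl p => exact .refl _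
    | symm p q _ ih => exact ih.symm
    | trans p q r _ _ ih1 ih2 => exact ih1.trans ih2
  exact (connected_of_segIdx_eq ht hr (hreg x _) (hidx _).symm).trans
    ((hgen (Quotient.exact h)).trans (connected_of_segIdx_eq ht (hreg y _) hs (hidx _)))

theorem mem_loopAt_iff (ht : StrictMono t) (h0 : ∀ i, 0 < t i) (hβ : ∀ i, t i < β)
    (hβ0 : 0 < β) {x y : V} {r s : ℝ} (hr : IsRegular β (realization l t) x r) :
    (y, s) ∈ loopAt β (realization l t) x r ↔
      IsRegular β (realization l t) y s ∧ pointLoop l t x r = pointLoop l t y s := by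
  constructor
  · rintro ⟨d, hd⟩
    obtain ⟨h1, h2⟩ := sameTrajectory_invariant ht h0 hβ hβ0.le hd
    exact ⟨h1.mp hr, h2⟩
  · rintro ⟨hs, h⟩
    exact (connected_of_segLoop_eq ht h0 hβ hβ0 hr hs h).1 .up

/-- The map `Φ` sends a class of segments to the regular points on it. Every class contains such a
point, which gives both injectivity and range `loops`. -/
theorem loopCount_realization [Fintype V] (ht : StrictMono t) (h0 : ∀ i, 0 < t i)
    (hβ : ∀ i, t i < β) (hβ0 : 0 < β) :
    loopCount β (realization l t) = Fintype.card (SegLoop l) := by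
  let Φ : SegLoop l → Set (V × ℝ) := fun c =>
    {p | IsRegular β (realization l t) p.1 p.2 ∧ c = pointLoop l t p.1 p.2}
  have hsurj (c : SegLoop l) : ∃ x r, IsRegular β (realization l t) x r ∧ c = pointLoop l t x r := by
    induction c using Quotient.inductionOn with
    | _ p =>
    obtain ⟨r, hr0, hrβ, h1, h2⟩ := exists_segIdx_eq ht h0 hβ hβ0 p.2
    have hidx : segIdx t r = p.2 := segIdx_eq_of_between ht h1 h2
    refine ⟨p.1, r, ⟨⟨hr0.le, hrβ.le⟩, quiet_realization_iff.mpr fun i _ hi => ?_⟩, ?_⟩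
    · rcases lt_or_ge (i : ℕ) p.2 with hij | hij
      exacts [(h1 i hij).not_ge hi.1, (h2 i hij).not_ge hi.2]
    · rw [pointLoop, hidx]
      rfl
  have hloop {x : V} {r : ℝ} (hr : IsRegular β (realization l t) x r) :
      loopAt β (realization l t) x r = Φ (pointLoop l t x r) := by
    ext ⟨y, s⟩
    exact mem_loopAt_iff ht h0 hβ hβ0 hr
  have hinj : Function.Injective Φ := by
    intro c c' h
    obtain ⟨x, r, hr, hc⟩ := hsurj c
    have h1 : (x, r) ∈ Φ c := ⟨hr, hc⟩
    rw [h] at h1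
    exact hc.trans h1.2.symm
  have himage : loops β (realization l t) = Set.range Φ := by
    ext γ
    constructor
    · rintro ⟨x, r, hr, hq, rfl⟩
      exact ⟨_, (hloop ⟨hr, hq⟩).symm⟩
    · rintro ⟨c, rfl⟩
      obtain ⟨x, r, hr, rfl⟩ := hsurj c
      exact ⟨x, r, hr.1, hr.2, (hloop hr).symm⟩
  rw [loopCount, himage, ← Set.image_univ, Set.ncard_image_of_injective _ hinj, Set.ncard_univ,
    Nat.card_eq_fintype_card]

/-- The `j`-th open time interval. -/
def timeInterval (β : ℝ) (t : Fin k → ℝ) (j : Fin (k + 1)) : Set ℝ :=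
  {r | r ∈ Set.Ioo 0 β ∧ (∀ i : Fin k, (i : ℕ) < j → t i < r) ∧ ∀ i : Fin k, (j : ℕ) ≤ i → r < t i}

theorem measurableSet_timeInterval (t : Fin k → ℝ) (j : Fin (k + 1)) :
    MeasurableSet (timeInterval β t j) := by
  have h : timeInterval β t j = Set.Ioo 0 β ∩ ((⋂ i : Fin k, ⋂ _ : (i : ℕ) < j, Set.Ioi (t i)) ∩
      ⋂ i : Fin k, ⋂ _ : (j : ℕ) ≤ i, Set.Iio (t i)) := by
    ext r
    simp [timeInterval]
  rw [h]
  exact measurableSet_Ioo.inter ((MeasurableSet.iInter fun i => MeasurableSet.iInter fun _ =>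
    measurableSet_Ioi).inter (MeasurableSet.iInter fun i => MeasurableSet.iInter fun _ =>
    measurableSet_Iio))

theorem mem_timeInterval_segIdx (ht : StrictMono t) {r : ℝ} (hr : r ∈ Set.Ioo 0 β)
    (hrt : ∀ i, t i ≠ r) : r ∈ timeInterval β t (segIdx t r) :=
  ⟨hr, fun _ hi => (lt_segIdx_iff ht).mp hi,
    fun i hi => lt_of_le_of_ne ((segIdx_le_iff ht).mp hi) (hrt i).symm⟩

theorem ofReal_loopLength [Fintype V] (ht : StrictMono t) (h0 : ∀ i, 0 < t i)
    (hβ : ∀ i, t i < β) (hβ0 : 0 < β) (x : V) :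
    ENNReal.ofReal (loopLength β (realization l t) x 0) =
      ∑ y, ∑ j, if segLoop l (x, 0) = segLoop l (y, j) then volume (timeInterval β t j) else 0 := by
  classical
  have hvol (y : V) : volume {r : ℝ | r ∈ Set.Icc 0 β ∧ (y, r) ∈ loopAt β (realization l t) x 0} =
      ∑ j, if segLoop l (x, 0) = segLoop l (y, j) then volume (timeInterval β t j) else 0 := by
    -- Outside these finitely many times, the part of the loop above `y` is the disjoint union of
    -- the open intervals whose segment is in the class of `(x, 0)`.
    have hnull : volume (Set.range t ∪ {0, β}) = 0 :=
      ((Set.finite_range t).union (Set.toFinite _)).measure_zero _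
    have hae : {r : ℝ | r ∈ Set.Icc 0 β ∧ (y, r) ∈ loopAt β (realization l t) x 0} =ᵐ[volume]
        ⋃ j ∈ Finset.univ.filter fun j => segLoop l (x, 0) = segLoop l (y, j),
          timeInterval β t j := by
      filter_upwards [compl_mem_ae_iff.mpr hnull] with r hr
      have hr1 : ∀ i, t i ≠ r := fun i h => hr (.inl ⟨i, h⟩)
      have hr2 : r ≠ 0 := fun h => hr (.inr (.inl h))
      have hr3 : r ≠ β := fun h => hr (.inr (.inr h))
      refine propext ?_
      change (r ∈ Set.Icc 0 β ∧ (y, r) ∈ loopAt β (realization l t) x 0) ↔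
        r ∈ ⋃ j ∈ Finset.univ.filter fun j => segLoop l (x, 0) = segLoop l (y, j),
          timeInterval β t j
      rw [mem_loopAt_iff ht h0 hβ hβ0 (isRegular_zero h0 hβ0.le x)]
      simp only [Set.mem_iUnion, Finset.mem_filter, Finset.mem_univ, true_and, exists_prop]
      rw [pointLoop, segIdx_zero h0]
      constructor
      · rintro ⟨h1, -, h2⟩
        exact ⟨_, h2, mem_timeInterval_segIdx ht ⟨h1.1.lt_of_ne' hr2, h1.2.lt_of_ne hr3⟩ hr1⟩
      · rintro ⟨j, h1, h2⟩
        have hIcc : r ∈ Set.Icc 0 β := ⟨h2.1.1.le, h2.1.2.le⟩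
        refine ⟨hIcc, ⟨hIcc, quiet_realization_iff.mpr fun i _ hi => ?_⟩, ?_⟩
        · exact hr1 i (le_antisymm hi.2 hi.1)
        · rw [h1, pointLoop, segIdx_eq_of_between ht h2.2.1 h2.2.2]
    rw [measure_congr hae, measure_biUnion_finset, Finset.sum_filter]
    · intro i _ j _ hij
      refine Set.disjoint_left.mpr fun r hi hj => hij ?_
      rw [← segIdx_eq_of_between ht hi.2.1 hi.2.2, segIdx_eq_of_between ht hj.2.1 hj.2.2]
    · exact fun j _ => measurableSet_timeInterval t j
  rw [loopLength, ENNReal.ofReal_sum_of_nonneg fun y _ => ENNReal.toReal_nonneg]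
  refine Finset.sum_congr rfl fun y _ => ?_
  rw [ENNReal.ofReal_toReal, hvol]
  exact ((measure_mono fun r hr => hr.1).trans_lt
    (measure_Icc_lt_top (a := (0 : ℝ)) (b := β))).ne

theorem totalLength_nonneg [Fintype V] (ω : Realization G) : 0 ≤ totalLength β ω :=
  Finset.sum_nonneg fun _ _ => Finset.sum_nonneg fun _ _ => ENNReal.toReal_nonneg

theorem ofReal_totalLength [Fintype V] (ht : StrictMono t) (h0 : ∀ i, 0 < t i)
    (hβ : ∀ i, t i < β) (hβ0 : 0 < β) :
    ENNReal.ofReal (totalLength β (realization l t)) = ∑ x, ∑ y, ∑ j,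
      if segLoop l (x, 0) = segLoop l (y, j) then volume (timeInterval β t j) else 0 := by
  have h (x : V) : 0 ≤ loopLength β (realization l t) x 0 :=
    Finset.sum_nonneg fun _ _ => ENNReal.toReal_nonneg
  rw [totalLength, ENNReal.ofReal_sum_of_nonneg fun x _ => h x]
  exact Finset.sum_congr rfl fun x _ => ofReal_loopLength ht h0 hβ hβ0 x

end SortedRealizations

/-! ### Reduction of symmetric integrals to sorted families -/

section SortedFamilies

variable {X : Type*} (τ : X → ℝ) (I : Set ℝ)

/-- The families that are sorted according to `τ`, with values of `τ` in `I`. -/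
def sortedFamilies (k : ℕ) : Set (Fin k → X) :=
  {f | StrictMono (fun i => τ (f i)) ∧ ∀ i, τ (f i) ∈ I}

theorem exists_perm_mem_sortedFamilies {k : ℕ} {f : Fin k → X}
    (hf : Function.Injective fun i => τ (f i)) (hI : ∀ i, τ (f i) ∈ I) :
    ∃ π : Equiv.Perm (Fin k), f ∘ π ∈ sortedFamilies τ I k := by
  refine ⟨Tuple.sort fun i => τ (f i), ?_, fun i => hI _⟩
  exact (Tuple.monotone_sort fun i => τ (f i)).strictMono_of_injective
    (hf.comp (Equiv.injective _))

theorem perm_eq_of_mem_sortedFamilies {k : ℕ} {f : Fin k → X} {π π' : Equiv.Perm (Fin k)}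
    (h : f ∘ π ∈ sortedFamilies τ I k) (h' : f ∘ π' ∈ sortedFamilies τ I k) : π = π' := by
  have key {π : Equiv.Perm (Fin k)} (h : f ∘ π ∈ sortedFamilies τ I k) :
      π = Tuple.sort fun i => τ (f i) :=
    Tuple.eq_sort_iff.mpr ⟨h.1.monotone, fun i j hij he => absurd he (h.1 hij).ne⟩
  rw [key h, key h']

variable [MeasurableSpace X] {τ} {I}

theorem measurableSet_sortedFamilies (hτ : Measurable τ) (hI : MeasurableSet I) (k : ℕ) :
    MeasurableSet (sortedFamilies τ I k) := by
  have h : sortedFamilies τ I k = (⋂ i : Fin k, ⋂ j : Fin k, ⋂ _ : i < j,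
      {f | τ (f i) < τ (f j)}) ∩ ⋂ i : Fin k, {f | τ (f i) ∈ I} := by
    ext f
    simp only [sortedFamilies, StrictMono, Set.mem_ofPred_eq, Set.mem_inter_iff, Set.mem_iInter]
  rw [h]
  have hm (i : Fin k) : Measurable fun f : Fin k → X => τ (f i) := hτ.comp (measurable_pi_apply i)
  exact (MeasurableSet.iInter fun i => MeasurableSet.iInter fun j => MeasurableSet.iInter fun _ =>
    measurableSet_lt (hm i) (hm j)).inter (MeasurableSet.iInter fun i => hm i hI)

variable {μ : Measure X} [SigmaFinite μ]

/-- By Fubini, for fixed values of the other coordinates a coincidence confines the `i`-th point to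
a null fibre of `τ`. -/
theorem ae_injective_pi (hτ : Measurable τ) (h0 : ∀ r, μ (τ ⁻¹' {r}) = 0) (k : ℕ) :
    ∀ᵐ f ∂(Measure.pi fun _ : Fin k => μ), Function.Injective fun i => τ (f i) := by
  have key : ∀ i j : Fin k, i ≠ j → ∀ᵐ f ∂(Measure.pi fun _ : Fin k => μ), τ (f i) ≠ τ (f j) := by
    intro i j hij
    obtain ⟨m, rfl⟩ : ∃ m, k = m + 1 := ⟨k - 1, by have := i.2; omega⟩
    obtain ⟨j, rfl⟩ := Fin.exists_succAbove_eq hij.symm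
    have hmp := measurePreserving_piFinSuccAbove (fun _ : Fin (m + 1) => μ) i
    have hs : MeasurableSet {p : X × (Fin m → X) | τ p.1 = τ (p.2 j)} :=
      measurableSet_eq_fun (hτ.comp measurable_fst)
        (hτ.comp ((measurable_pi_apply j).comp measurable_snd))
    have hnull : (μ.prod (Measure.pi fun _ : Fin m => μ))
        {p : X × (Fin m → X) | τ p.1 = τ (p.2 j)} = 0 := by
      rw [Measure.prod_apply_symm hs]
      simp only [Set.preimage_ofPred_eq]
      exact (lintegral_congr (g := fun _ => 0) fun f : Fin m → X => h0 (τ (f j))).trans lintegral_zero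
    have h := hmp.measure_preimage hs.nullMeasurableSet
    rw [hnull] at h
    exact measure_eq_zero_iff_ae_notMem.mp h
  have h2 : ∀ᵐ f ∂(Measure.pi fun _ : Fin k => μ), ∀ i j : Fin k, i ≠ j → τ (f i) ≠ τ (f j) := by
    simp only [ae_all_iff]
    exact key
  filter_upwards [h2] with f hf i j hij
  by_contra hne
  exact hf i j hne hij

theorem ae_mem_pi (hI : μ (τ ⁻¹' I)ᶜ = 0) (k : ℕ) :
    ∀ᵐ f ∂(Measure.pi fun _ : Fin k => μ), ∀ i, τ (f i) ∈ I := by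
  rw [ae_all_iff]
  intro i
  have h : ∀ᵐ x ∂μ, τ x ∈ I := by
    rw [ae_iff]
    exact hI
  exact (Measure.tendsto_eval_ae_ae (μ := fun _ : Fin k => μ) (i := i)).eventually h

theorem ae_exists_perm (hτ : Measurable τ) (h0 : ∀ r, μ (τ ⁻¹' {r}) = 0) (hI : μ (τ ⁻¹' I)ᶜ = 0)
    (k : ℕ) : ∀ᵐ f ∂(Measure.pi fun _ : Fin k => μ),
      ∃ π : Equiv.Perm (Fin k), f ∘ π ∈ sortedFamilies τ I k := by
  filter_upwards [ae_injective_pi hτ h0 k, ae_mem_pi hI k] with f h1 h2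
  exact exists_perm_mem_sortedFamilies τ I h1 h2

/-- The integral of a symmetric function is determined by its values on sorted families. -/
theorem lintegral_pi_eq_factorial_mul (hτ : Measurable τ) (hIm : MeasurableSet I)
    (h0 : ∀ r, μ (τ ⁻¹' {r}) = 0) (hI : μ (τ ⁻¹' I)ᶜ = 0) {k : ℕ} (h : (Fin k → X) → ENNReal)
    (hh : ∀ (π : Equiv.Perm (Fin k)) f, h (f ∘ π) = h f) :
    ∫⁻ f, h f ∂(Measure.pi fun _ : Fin k => μ) =
      k.factorial * ∫⁻ f in sortedFamilies τ I k, h f ∂(Measure.pi fun _ : Fin k => μ) := by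
  have hmp (π : Equiv.Perm (Fin k)) : MeasurePreserving
      (MeasurableEquiv.piCongrLeft (fun _ : Fin k => X) π.symm)
      (Measure.pi fun _ : Fin k => μ) (Measure.pi fun _ : Fin k => μ) :=
    measurePreserving_piCongrLeft (fun _ => μ) π.symm
  have he (π : Equiv.Perm (Fin k)) (f : Fin k → X) :
      MeasurableEquiv.piCongrLeft (fun _ : Fin k => X) π.symm f = f ∘ π := by
    funext i
    have := MeasurableEquiv.piCongrLeft_apply_apply (β := fun _ : Fin k => X) π.symm f (π i)
    simpa using this
  have hpre (π : Equiv.Perm (Fin k)) : MeasurableEquiv.piCongrLeft (fun _ : Fin k => X) π.symm ⁻¹'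
      sortedFamilies τ I k = {f : Fin k → X | f ∘ π ∈ sortedFamilies τ I k} := by
    ext f
    rw [Set.mem_preimage, he]
    rfl
  have hset (π : Equiv.Perm (Fin k)) :
      MeasurableSet {f : Fin k → X | f ∘ π ∈ sortedFamilies τ I k} := by
    rw [← hpre]
    exact (MeasurableEquiv.piCongrLeft (fun _ : Fin k => X) π.symm).measurable
      (measurableSet_sortedFamilies hτ hIm k)
  -- The `k!` permuted copies of the sorted region are disjoint, cover almost everything and carry
  -- equal integrals. Only the regions, not `h`, have to be measurable.
  have hunion : ∫⁻ f, h f ∂(Measure.pi fun _ : Fin k => μ) =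
      ∫⁻ f in ⋃ π : Equiv.Perm (Fin k), {f : Fin k → X | f ∘ π ∈ sortedFamilies τ I k}, h f
        ∂(Measure.pi fun _ : Fin k => μ) := by
    rw [← setLIntegral_univ]
    refine setLIntegral_congr ?_
    filter_upwards [ae_exists_perm hτ h0 hI k] with f hf
    obtain ⟨π, hπ⟩ := hf
    exact propext ⟨fun _ => Set.mem_iUnion.mpr ⟨π, hπ⟩, fun _ => trivial⟩
  rw [hunion, lintegral_iUnion hset, tsum_fintype]
  · have hterm (π : Equiv.Perm (Fin k)) :
        ∫⁻ f in {f : Fin k → X | f ∘ π ∈ sortedFamilies τ I k}, h f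
          ∂(Measure.pi fun _ : Fin k => μ) =
        ∫⁻ f in sortedFamilies τ I k, h f ∂(Measure.pi fun _ : Fin k => μ) := by
      rw [← (hmp π).setLIntegral_comp_preimage_emb (MeasurableEquiv.measurableEmbedding _) h
        (sortedFamilies τ I k), hpre]
      simp only [he, hh]
    simp only [hterm, Finset.sum_const, Finset.card_univ, Fintype.card_perm, Fintype.card_fin,
      nsmul_eq_mul]
  · intro π π' hne
    exact Set.disjoint_left.mpr fun f hf hf' => hne (perm_eq_of_mem_sortedFamilies τ I hf hf')

end SortedFamilies

/-! ### Integration with respect to the Poisson process -/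

section PoissonProcess

variable {X : Type*}

theorem ofFamily_comp_perm {k : ℕ} (π : Equiv.Perm (Fin k)) (f : Fin k → X) :
    Configuration.ofFamily (f ∘ π) = Configuration.ofFamily f := by
  ext a
  simp only [Configuration.mem_points_ofFamily, Function.comp]
  exact (π.surjective.exists (p := fun i => f i = a)).symm

/-- The configurations of points with distinct values of `τ` in `I`. -/
def goodConfigurations (τ : X → ℝ) (I : Set ℝ) : Set (Configuration X) :=
  {ω | ∃ k, ∃ f ∈ sortedFamilies τ I k, Configuration.ofFamily f = ω}

variable [MeasurableSpace X] {τ : X → ℝ} {I : Set ℝ}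

theorem measurable_ofFamily (k : ℕ) :
    Measurable (Configuration.ofFamily : (Fin k → X) → Configuration X) := by
  intro s hs
  exact MeasurableSpace.measurableSet_iInf.mp hs k

/-- The `σ`-algebra tests all tuples, also those with repetitions. A tuple `f` represents a good
configuration if and only if some choice `r` of its entries is sorted and exhausts the values of
`f`; there are countably many choices. -/
theorem measurableSet_good_inter [MeasurableEq X] {A : Set (Configuration X)}
    (hA : ∀ k, MeasurableSet (sortedFamilies τ I k ∩ Configuration.ofFamily ⁻¹' A)) :
    MeasurableSet (goodConfigurations τ I ∩ A) := by
  refine MeasurableSpace.measurableSet_iInf.mpr fun m => ?_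
  change MeasurableSet (Configuration.ofFamily ⁻¹' (goodConfigurations τ I ∩ A))
  have h : (Configuration.ofFamily ⁻¹' (goodConfigurations τ I ∩ A) : Set (Fin m → X)) =
      ⋃ k : ℕ, ⋃ r : Fin k → Fin m, (fun f => f ∘ r) ⁻¹'
        (sortedFamilies τ I k ∩ Configuration.ofFamily ⁻¹' A) ∩
        ⋂ i : Fin m, ⋃ j : Fin k, {f : Fin m → X | f i = f (r j)} := by
    ext f
    simp only [Set.mem_preimage, Set.mem_inter_iff, Set.mem_iUnion, Set.mem_iInter,
      Set.mem_ofPred_eq]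
    constructor
    · rintro ⟨⟨k, g, hg, hgf⟩, hfA⟩
      have hex (j : Fin k) : ∃ i, f i = g j := by
        rw [← Configuration.mem_points_ofFamily, ← hgf, Configuration.mem_points_ofFamily]
        exact ⟨j, rfl⟩
      choose r hr using hex
      have hfr : f ∘ r = g := funext hr
      refine ⟨k, r, ⟨?_, ?_⟩, fun i => ?_⟩
      · rwa [hfr]
      · rwa [hfr, hgf]
      · have : f i ∈ (Configuration.ofFamily g).points := by
          rw [hgf, Configuration.mem_points_ofFamily]
          exact ⟨i, rfl⟩
        obtain ⟨j, hj⟩ := Configuration.mem_points_ofFamily.mp this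
        exact ⟨j, by rw [hr, hj]⟩
    · rintro ⟨k, r, ⟨h1, h2⟩, h3⟩
      have heq : Configuration.ofFamily (f ∘ r) = Configuration.ofFamily f := by
        ext a
        simp only [Configuration.mem_points_ofFamily, Function.comp]
        constructor
        · rintro ⟨j, hj⟩
          exact ⟨r j, hj⟩
        · rintro ⟨i, hi⟩
          obtain ⟨j, hj⟩ := h3 i
          exact ⟨j, by rw [← hj, hi]⟩
      rw [heq] at h2
      exact ⟨⟨k, f ∘ r, h1, heq⟩, h2⟩
  rw [h]
  refine MeasurableSet.iUnion fun k => MeasurableSet.iUnion fun r => MeasurableSet.inter ?_ ?_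
  · exact (measurable_pi_lambda _ fun i => measurable_pi_apply (r i)) (hA k)
  · exact MeasurableSet.iInter fun i => MeasurableSet.iUnion fun j =>
      measurableSet_eq_fun (measurable_pi_apply _) (measurable_pi_apply _)

theorem measurableSet_goodConfigurations [MeasurableEq X] (hτ : Measurable τ)
    (hI : MeasurableSet I) : MeasurableSet (goodConfigurations τ I) := by
  have := measurableSet_good_inter (τ := τ) (I := I) (A := Set.univ) fun k => by
    simpa using measurableSet_sortedFamilies hτ hI k
  rwa [Set.inter_univ] at this

variable {μ : Measure X} [IsFiniteMeasure μ]

theorem ae_good_poissonProcess [MeasurableEq X] (hτ : Measurable τ) (hIm : MeasurableSet I)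
    (h0 : ∀ r, μ (τ ⁻¹' {r}) = 0) (hI : μ (τ ⁻¹' I)ᶜ = 0) :
    ∀ᵐ ω ∂(poissonProcess μ), ω ∈ goodConfigurations τ I := by
  rw [poissonProcess]
  refine (Measure.ae_sum_iff' (p := fun ω => ω ∈ goodConfigurations τ I)
    (measurableSet_goodConfigurations hτ hIm)).mpr fun k => ?_
  refine Measure.ae_smul_measure ?_ _
  refine (ae_map_iff (p := fun ω => ω ∈ goodConfigurations τ I)
    (measurable_ofFamily k).aemeasurable (measurableSet_goodConfigurations hτ hIm)).mpr ?_
  filter_upwards [ae_exists_perm hτ h0 hI k] with f hf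
  obtain ⟨π, hπ⟩ := hf
  exact ⟨k, f ∘ π, hπ, ofFamily_comp_perm π f⟩

/-- Only sorted families are under control, so the measurable version of `g` is `g` set to zero off
the good configurations, which have full measure. -/
theorem aemeasurable_poissonProcess [MeasurableEq X] (hτ : Measurable τ) (hIm : MeasurableSet I)
    (h0 : ∀ r, μ (τ ⁻¹' {r}) = 0) (hI : μ (τ ⁻¹' I)ᶜ = 0) {g : Configuration X → ENNReal}
    (F : ∀ k, (Fin k → X) → ENNReal) (hF : ∀ k, Measurable (F k))
    (hg : ∀ k, ∀ f ∈ sortedFamilies τ I k, g (Configuration.ofFamily f) = F k f) :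
    AEMeasurable g (poissonProcess μ) := by
  refine ⟨(goodConfigurations τ I).indicator g, ?_, ?_⟩
  · intro B hB
    rw [Set.indicator_preimage, Set.ite]
    refine (measurableSet_good_inter (τ := τ) (I := I) (A := g ⁻¹' B) fun k => ?_).union
      (MeasurableSet.diff (measurable_zero hB) (measurableSet_goodConfigurations hτ hIm)) |>.congr ?_
    · have : sortedFamilies τ I k ∩ Configuration.ofFamily ⁻¹' (g ⁻¹' B) =
          sortedFamilies τ I k ∩ F k ⁻¹' B := by
        ext f
        simp only [Set.mem_inter_iff, Set.mem_preimage]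
        exact and_congr_right fun hf => by rw [hg k f hf]
      rw [this]
      exact (measurableSet_sortedFamilies hτ hIm k).inter (hF k hB)
    · rw [Set.inter_comm]
  · filter_upwards [ae_good_poissonProcess hτ hIm h0 hI] with ω hω
    rw [Set.indicator_of_mem hω]

/-- The `k!` orderings cancel the `1/k!` of the Poisson weights. -/
theorem lintegral_poissonProcess [MeasurableEq X] (hτ : Measurable τ) (hIm : MeasurableSet I)
    (h0 : ∀ r, μ (τ ⁻¹' {r}) = 0) (hI : μ (τ ⁻¹' I)ᶜ = 0) {g : Configuration X → ENNReal}
    (F : ∀ k, (Fin k → X) → ENNReal) (hF : ∀ k, Measurable (F k))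
    (hg : ∀ k, ∀ f ∈ sortedFamilies τ I k, g (Configuration.ofFamily f) = F k f) :
    ∫⁻ ω, g ω ∂(poissonProcess μ) = ∑' k, ENNReal.ofReal (Real.exp (-(μ Set.univ).toReal)) *
      ∫⁻ f in sortedFamilies τ I k, F k f ∂(Measure.pi fun _ : Fin k => μ) := by
  have hm := aemeasurable_poissonProcess hτ hIm h0 hI F hF hg
  rw [poissonProcess] at hm ⊢
  rw [lintegral_sum_measure]
  refine tsum_congr fun k => ?_
  have hc : ENNReal.ofReal (Real.exp (-(μ Set.univ).toReal)) / (k.factorial : ENNReal) ≠ 0 :=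
    (ENNReal.div_pos (by simpa using Real.exp_pos _) (ENNReal.natCast_ne_top _)).ne'
  have hm1 := hm.mono_measure (Measure.le_sum _ k)
  rw [aemeasurable_smul_measure_iff hc] at hm1
  rw [lintegral_smul_measure, lintegral_map' hm1 (measurable_ofFamily k).aemeasurable,
    lintegral_pi_eq_factorial_mul hτ hIm h0 hI _ fun π f => by rw [ofFamily_comp_perm],
    setLIntegral_congr_fun (measurableSet_sortedFamilies hτ hIm k) (hg k), smul_eq_mul, ← mul_assoc,
    ENNReal.div_mul_cancel (by positivity) (ENNReal.natCast_ne_top _)]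

end PoissonProcess

/-! ### Volumes of simplices of sorted times -/

/-- The uniform measure on the time interval. -/
noncomputable def timeMeasure (β : ℝ) : Measure ℝ := volume.restrict (Set.Icc (0 : ℝ) β)

instance (β : ℝ) : IsFiniteMeasure (timeMeasure β) := by
  unfold timeMeasure
  infer_instance

theorem timeMeasure_univ (β : ℝ) : timeMeasure β Set.univ = ENNReal.ofReal β := by
  simp [timeMeasure]

theorem timeMeasure_singleton (β r : ℝ) : timeMeasure β {r} = 0 :=
  Measure.absolutelyContinuous_of_le Measure.restrict_le_self Real.volume_singleton

theorem timeMeasure_compl_Ioo (β : ℝ) : timeMeasure β (Set.Ioo 0 β)ᶜ = 0 := by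
  rw [timeMeasure, Measure.restrict_apply measurableSet_Ioo.compl]
  refine measure_mono_null (t := {0, β}) (fun r hr => ?_) ((Set.toFinite _).measure_zero _)
  by_contra h
  simp only [Set.mem_insert_iff, Set.mem_singleton_iff, not_or] at h
  exact hr.1 ⟨hr.2.1.lt_of_ne' h.1, hr.2.2.lt_of_ne h.2⟩

/-- The sorted families of times in `(0, β)`. -/
abbrev sortedTimes (β : ℝ) (k : ℕ) : Set (Fin k → ℝ) := sortedFamilies id (Set.Ioo 0 β) k

theorem pi_timeMeasure_sortedTimes (β : ℝ) (hβ : 0 ≤ β) (k : ℕ) :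
    (Measure.pi fun _ : Fin k => timeMeasure β) (sortedTimes β k) =
      ENNReal.ofReal (β ^ k / k.factorial) := by
  have h := lintegral_pi_eq_factorial_mul (μ := timeMeasure β) (τ := id) (k := k) measurable_id
    measurableSet_Ioo (timeMeasure_singleton β) (timeMeasure_compl_Ioo β) (fun _ => 1)
    fun _ _ => rfl
  simp only [lintegral_one, Measure.restrict_apply_univ, Measure.pi_univ, timeMeasure_univ,
    Finset.prod_const, Finset.card_univ, Fintype.card_fin] at h
  rw [ENNReal.ofReal_div_of_pos (by positivity), ENNReal.ofReal_pow hβ, h, mul_comm,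
    ENNReal.ofReal_natCast, ENNReal.mul_div_cancel_right (by positivity) (ENNReal.natCast_ne_top _)]

theorem insertNth_mem_sortedTimes_iff {β : ℝ} {k : ℕ} (j : Fin (k + 1)) (r : ℝ) (t : Fin k → ℝ) :
    j.insertNth (α := fun _ => ℝ) r t ∈ sortedTimes β (k + 1) ↔
      t ∈ sortedTimes β k ∧ r ∈ timeInterval β t j := by
  simp only [sortedTimes, sortedFamilies, id, Set.mem_ofPred_eq, timeInterval]
  rw [Fin.strictMono_insertNth_iff, Fin.forall_iff_succAbove j]
  simp only [Fin.insertNth_apply_same, Fin.insertNth_apply_succAbove, Fin.lt_def, Fin.le_def,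
    Fin.val_castSucc]
  tauto

theorem measurableSet_timeInterval_prod (β : ℝ) {k : ℕ} (j : Fin (k + 1)) :
    MeasurableSet {p : ℝ × (Fin k → ℝ) | p.1 ∈ timeInterval β p.2 j} := by
  have h : {p : ℝ × (Fin k → ℝ) | p.1 ∈ timeInterval β p.2 j} = {p | p.1 ∈ Set.Ioo 0 β} ∩
      ((⋂ i : Fin k, ⋂ _ : (i : ℕ) < j, {p | p.2 i < p.1}) ∩
      ⋂ i : Fin k, ⋂ _ : (j : ℕ) ≤ i, {p | p.1 < p.2 i}) := by
    ext p
    simp [timeInterval]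
  have hm (i : Fin k) : Measurable fun p : ℝ × (Fin k → ℝ) => p.2 i :=
    (measurable_pi_apply i).comp measurable_snd
  rw [h]
  exact (measurable_fst measurableSet_Ioo).inter ((MeasurableSet.iInter fun i =>
    MeasurableSet.iInter fun _ => measurableSet_lt (hm i) measurable_fst).inter
    (MeasurableSet.iInter fun i => MeasurableSet.iInter fun _ =>
    measurableSet_lt measurable_fst (hm i)))

theorem measurable_volume_timeInterval (β : ℝ) {k : ℕ} (j : Fin (k + 1)) :
    Measurable fun t : Fin k → ℝ => volume (timeInterval β t j) :=
  measurable_measure_prodMk_right (measurableSet_timeInterval_prod β j)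

/-- Inserting a further time in the `j`-th interval yields exactly the sorted `(k + 1)`-tuples, so
the integral is the volume of a larger simplex and does not depend on `j`. It supplies the `1/(k +
1)!` of `expDerivTerm`. -/
theorem lintegral_volume_timeInterval (β : ℝ) (hβ : 0 ≤ β) {k : ℕ} (j : Fin (k + 1)) :
    ∫⁻ t in sortedTimes β k, volume (timeInterval β t j)
      ∂(Measure.pi fun _ : Fin k => timeMeasure β) =
      ENNReal.ofReal (β ^ (k + 1) / (k + 1).factorial) := by
  have hsm (k : ℕ) : MeasurableSet (sortedTimes β k) :=
    measurableSet_sortedFamilies measurable_id measurableSet_Ioo k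
  have hmp := (measurePreserving_piFinSuccAbove (fun _ : Fin (k + 1) => timeMeasure β) j).symm
  rw [← pi_timeMeasure_sortedTimes β hβ, ← hmp.measure_preimage (hsm _).nullMeasurableSet,
    Measure.prod_apply_symm ((MeasurableEquiv.measurable _) (hsm _)),
    ← lintegral_indicator (hsm k)]
  refine lintegral_congr fun t => ?_
  have hset : (fun r => (r, t)) ⁻¹' ((MeasurableEquiv.piFinSuccAbove (fun _ => ℝ) j).symm ⁻¹'
      sortedTimes β (k + 1)) = {r | t ∈ sortedTimes β k ∧ r ∈ timeInterval β t j} := by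
    ext r
    exact insertNth_mem_sortedTimes_iff j r t
  rw [hset]
  by_cases ht : t ∈ sortedTimes β k
  · simp only [Set.indicator_of_mem ht, ht, true_and, Set.ofPred_mem_eq]
    rw [timeMeasure, Measure.restrict_apply (measurableSet_timeInterval t j),
      Set.inter_eq_left.mpr]
    exact fun r hr => ⟨hr.1.1.le, hr.1.2.le⟩
  · simp [ht]

/-! ### Labels and times under the intensity measure -/

section Intensity

variable {V : Type*} {G : SimpleGraph V}

instance : DiscreteMeasurableSpace Kind := ⟨fun _ => trivial⟩

instance : DiscreteMeasurableSpace G.edgeSet := ⟨fun _ => trivial⟩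

variable (G) in
/-- The measure on labels. -/
noncomputable def labelMeasure (u : ℝ) : Measure (Label G) :=
  (Measure.count : Measure G.edgeSet).prod
    (ENNReal.ofReal u • Measure.dirac Kind.cross + ENNReal.ofReal (1 - u) • Measure.dirac Kind.bar)

variable [Fintype V]

instance : Finite G.edgeSet := Subtype.finite

instance (u : ℝ) : IsFiniteMeasure
    (ENNReal.ofReal u • Measure.dirac Kind.cross + ENNReal.ofReal (1 - u) • Measure.dirac Kind.bar) :=
  ⟨by simp⟩

instance (u : ℝ) : IsFiniteMeasure (labelMeasure G u) := by
  unfold labelMeasure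
  infer_instance

theorem labelMeasure_singleton {u : ℝ} (l : Label G) :
    labelMeasure G u {l} = ENNReal.ofReal (labelWeight u l) := by
  obtain ⟨e, d⟩ := l
  rw [labelMeasure, ← Set.singleton_prod_singleton, Measure.prod_prod, Measure.count_singleton,
    one_mul]
  cases d <;> simp [labelWeight]

/-- The transition with a given label and a given time. -/
def transition (p : Label G × ℝ) : Transition G := (p.1.1, p.2, p.1.2)

theorem measurePreserving_transition (β u : ℝ) :
    MeasurePreserving (transition (G := G)) ((labelMeasure G u).prod (timeMeasure β))
      (intensity G β u) := by
  have h1 : MeasurePreserving (MeasurableEquiv.prodAssoc (α := G.edgeSet) (β := Kind) (γ := ℝ))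
    ((labelMeasure G u).prod (timeMeasure β)) _ := ⟨MeasurableEquiv.measurable _, Measure.prodAssoc_prod⟩
  exact ((MeasurePreserving.id _).prod Measure.measurePreserving_swap).comp h1

instance (β u : ℝ) : IsFiniteMeasure (intensity G β u) := by
  rw [← (measurePreserving_transition β u).map_eq]
  infer_instance

theorem intensity_univ [Fintype G.edgeSet] {β u : ℝ} (hβ : 0 ≤ β) (hu0 : 0 ≤ u) (hu1 : u ≤ 1) :
    (intensity G β u Set.univ).toReal = Fintype.card G.edgeSet * β := by
  rw [intensity, ← Set.univ_prod_univ, Measure.prod_prod, ← Set.univ_prod_univ, Measure.prod_prod]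
  simp only [ENNReal.toReal_mul, Measure.add_apply, Measure.smul_apply, measure_univ, smul_eq_mul,
    mul_one, Measure.restrict_apply_univ, Real.volume_Icc, sub_zero]
  rw [← ENNReal.ofReal_add hu0 (sub_nonneg.mpr hu1), ENNReal.toReal_ofReal hβ]
  rw [Measure.count_univ, ENat.card_eq_coe_fintype_card, ENat.toENNReal_coe,
    ENNReal.toReal_natCast, add_sub_cancel, ENNReal.ofReal_one, ENNReal.toReal_one, mul_one]

/-- Integration over families of transitions amounts to summing over the labels and integrating
over the times. -/
theorem lintegral_pi_intensity [Fintype G.edgeSet] {β u : ℝ} (hu0 : 0 ≤ u) (hu1 : u ≤ 1) {k : ℕ}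
    {F : (Fin k → Transition G) → ENNReal} (hF : Measurable F) :
    ∫⁻ f, F f ∂(Measure.pi fun _ : Fin k => intensity G β u) =
      ∑ l : Fin k → Label G, ENNReal.ofReal (∏ i, labelWeight u (l i)) *
        ∫⁻ t, F (fun i => transition (l i, t i)) ∂(Measure.pi fun _ : Fin k => timeMeasure β) := by
  have h1 := (measurePreserving_arrowProdEquivProdArrow (Label G) ℝ (Fin k)
    (fun _ => labelMeasure G u) (fun _ => timeMeasure β)).symm
  have h2 := measurePreserving_pi (fun _ : Fin k => (labelMeasure G u).prod (timeMeasure β))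
    (fun _ => intensity G β u) fun _ => measurePreserving_transition β u
  have h3 := h2.comp h1
  rw [← h3.lintegral_comp hF]
  refine (lintegral_prod _ (hF.comp h3.measurable).aemeasurable).trans ?_
  rw [lintegral_fintype]
  refine Finset.sum_congr rfl fun l _ => ?_
  rw [Measure.pi_singleton, mul_comm]
  congr 1
  simp only [labelMeasure_singleton]
  refine (ENNReal.ofReal_prod_of_nonneg fun i _ => ?_).symm
  unfold labelWeight
  cases (l i).2
  exacts [hu0, sub_nonneg.mpr hu1]

end Intensity

/-! ### Loop integrals as traces -/

section RandomLoops

open scoped Matrix.Norms.Operator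

variable {V : Type*} {G : SimpleGraph V}

theorem measurable_transition_time : Measurable fun p : Transition G => p.2.1 :=
  measurable_fst.comp measurable_snd

theorem measurable_transition_label : Measurable fun p : Transition G => ((p.1, p.2.2) : Label G) :=
  measurable_fst.prodMk (measurable_snd.comp measurable_snd)

theorem labelWeight_nonneg {u : ℝ} (hu0 : 0 ≤ u) (hu1 : u ≤ 1) (l : Label G) :
    0 ≤ labelWeight u l := by
  unfold labelWeight
  cases l.2
  exacts [hu0, sub_nonneg.mpr hu1]

variable [Fintype V]

theorem intensity_time_preimage {β u : ℝ} {s : Set ℝ} (hs : MeasurableSet s)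
    (h : timeMeasure β s = 0) : intensity G β u ((fun p : Transition G => p.2.1) ⁻¹' s) = 0 := by
  rw [← (measurePreserving_transition β u).measure_preimage
    (measurable_transition_time hs).nullMeasurableSet]
  have : transition ⁻¹' ((fun p : Transition G => p.2.1) ⁻¹' s) =
      (Set.univ : Set (Label G)) ×ˢ s := by
    ext p
    simp [transition]
  rw [this, Measure.prod_prod, h, mul_zero]

instance : MeasurableEq (Transition G) := by
  constructor
  have h : Set.diagonal (Transition G) = {p | p.1.2.1 = p.2.2.1} ∩
      {p | ((p.1.1, p.1.2.2) : Label G) = (p.2.1, p.2.2.2)} := by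
    ext ⟨⟨a, b, c⟩, d, e, f⟩
    simp only [Set.mem_diagonal_iff, Prod.mk.injEq, Set.mem_inter_iff, Set.mem_ofPred_eq]
    tauto
  rw [h]
  exact (measurableSet_eq_fun (measurable_transition_time.comp measurable_fst)
    (measurable_transition_time.comp measurable_snd)).inter
    (measurableSet_eq_fun (measurable_transition_label.comp measurable_fst)
    (measurable_transition_label.comp measurable_snd))

variable [Fintype G.edgeSet]

/-- Expansion of integrals over the realizations with respect to the number of transitions, their
labels and their times. -/
theorem lintegral_rho {β u : ℝ} (hβ : 0 ≤ β) (hu0 : 0 ≤ u) (hu1 : u ≤ 1)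
    {g : Realization G → ENNReal} (Φ : ∀ k, (Fin k → Label G) → (Fin k → ℝ) → ENNReal)
    (hΦ : ∀ k l, Measurable (Φ k l))
    (hg : ∀ k (l : Fin k → Label G) t, StrictMono t → (∀ i, 0 < t i) → (∀ i, t i < β) →
      g (realization l t) = Φ k l t) :
    AEMeasurable g (rho G β u) ∧ ∫⁻ ω, g ω ∂(rho G β u) =
      ∑' k, ENNReal.ofReal (Real.exp (-(Fintype.card G.edgeSet * β))) *
        ∑ l : Fin k → Label G, ENNReal.ofReal (∏ i, labelWeight u (l i)) *
          ∫⁻ t in sortedTimes β k, Φ k l t ∂(Measure.pi fun _ : Fin k => timeMeasure β) := by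
  let F (k : ℕ) (f : Fin k → Transition G) : ENNReal :=
    Φ k (fun i => ((f i).1, (f i).2.2)) fun i => (f i).2.1
  have hF (k : ℕ) : Measurable (F k) := by
    have h1 : Measurable fun p : (Fin k → Label G) × (Fin k → ℝ) => Φ k p.1 p.2 :=
      measurable_from_prod_countable_right (hΦ k)
    have h2 : Measurable fun f : Fin k → Transition G =>
        ((fun i => ((f i).1, (f i).2.2), fun i => (f i).2.1) : (Fin k → Label G) × (Fin k → ℝ)) :=
      (measurable_pi_lambda _ fun i => measurable_transition_label.comp
        (measurable_pi_apply i)).prodMk (measurable_pi_lambda _ fun i =>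
        measurable_transition_time.comp (measurable_pi_apply i))
    exact h1.comp h2
  have hgF (k : ℕ) (f : Fin k → Transition G)
      (hf : f ∈ sortedFamilies (fun p : Transition G => p.2.1) (Set.Ioo 0 β) k) :
      g (Configuration.ofFamily f) = F k f :=
    hg k (fun i => ((f i).1, (f i).2.2)) _ hf.1 (fun i => (hf.2 i).1) fun i => (hf.2 i).2
  have h0 (r : ℝ) : intensity G β u ((fun p : Transition G => p.2.1) ⁻¹' {r}) = 0 :=
    intensity_time_preimage (measurableSet_singleton r) (timeMeasure_singleton β r)
  have hI : intensity G β u ((fun p : Transition G => p.2.1) ⁻¹' Set.Ioo 0 β)ᶜ = 0 :=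
    intensity_time_preimage measurableSet_Ioo.compl (timeMeasure_compl_Ioo β)
  refine ⟨aemeasurable_poissonProcess measurable_transition_time measurableSet_Ioo h0 hI F hF hgF, ?_⟩
  rw [rho, lintegral_poissonProcess measurable_transition_time measurableSet_Ioo h0 hI F hF hgF]
  refine tsum_congr fun k => ?_
  have hsm := measurableSet_sortedFamilies (measurable_transition_time (G := G))
    (measurableSet_Ioo (a := (0 : ℝ)) (b := β)) k
  rw [intensity_univ hβ hu0 hu1, ← lintegral_indicator hsm,
    lintegral_pi_intensity hu0 hu1 ((hF k).indicator hsm)]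
  congr 1
  refine Finset.sum_congr rfl fun l _ => ?_
  rw [← lintegral_indicator (measurableSet_sortedFamilies measurable_id measurableSet_Ioo k)]
  rfl

variable [DecidableEq V]

open NormedSpace in
theorem lintegral_pow_loopCount (n : ℕ) {β u : ℝ} (hβ : 0 < β) (hu0 : 0 ≤ u) (hu1 : u ≤ 1) :
    AEMeasurable (fun ω => ENNReal.ofReal (((n : ℝ) + 1) ^ loopCount β ω)) (rho G β u) ∧
    ∫⁻ ω, ENNReal.ofReal (((n : ℝ) + 1) ^ loopCount β ω) ∂(rho G β u) =
      ENNReal.ofReal (Real.exp (-(Fintype.card G.edgeSet * β)) *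
        (exp (β • hopping G n u)).trace) := by
  have h := lintegral_rho (G := G) hβ.le hu0 hu1
    (g := fun ω => ENNReal.ofReal (((n : ℝ) + 1) ^ loopCount β ω))
    (fun k l _ => ENNReal.ofReal (((n : ℝ) + 1) ^ Fintype.card (SegLoop l)))
    (fun k l => measurable_const)
    (fun k l t h1 h2 h3 => by simp only [loopCount_realization h1 h2 h3 hβ])
  refine ⟨h.1, h.2.trans ?_⟩
  have hw {k : ℕ} (l : Fin k → Label G) : 0 ≤ ∏ i, labelWeight u (l i) :=
    Finset.prod_nonneg fun i _ => labelWeight_nonneg hu0 hu1 _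
  have hsum := (hasSum_trace_mul_exp 1 (β • hopping G n u)).mul_left
    (Real.exp (-(Fintype.card G.edgeSet * β)))
  have hterm (k : ℕ) : Real.exp (-(Fintype.card G.edgeSet * β)) * ((k.factorial : ℝ)⁻¹ *
      (1 * (β • hopping G n u) ^ k).trace) = Real.exp (-(Fintype.card G.edgeSet * β)) *
      ∑ l : Fin k → Label G, (∏ i, labelWeight u (l i)) *
        (((n : ℝ) + 1) ^ Fintype.card (SegLoop l) * (β ^ k / k.factorial)) := by
    rw [Matrix.one_mul, smul_pow, Matrix.trace_smul, trace_hopping_pow, smul_eq_mul, Finset.mul_sum,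
      Finset.mul_sum]
    congr 1
    refine Finset.sum_congr rfl fun l _ => ?_
    ring
  simp only [hterm] at hsum
  rw [Matrix.one_mul] at hsum
  rw [← hsum.tsum_eq, ENNReal.ofReal_tsum_of_nonneg _ hsum.summable]
  · refine tsum_congr fun k => ?_
    rw [ENNReal.ofReal_mul (Real.exp_pos _).le, ENNReal.ofReal_sum_of_nonneg fun l _ =>
      mul_nonneg (hw l) (by positivity)]
    congr 1
    refine Finset.sum_congr rfl fun l _ => ?_
    rw [ENNReal.ofReal_mul (hw l), ENNReal.ofReal_mul (by positivity), setLIntegral_const,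
      pi_timeMeasure_sortedTimes β hβ.le]
  · exact fun k => mul_nonneg (Real.exp_pos _).le
      (Finset.sum_nonneg fun l _ => mul_nonneg (hw l) (by positivity))

/-- Both sides are the same sum over `k`, labels, pairs of vertices and intervals `j`. The trace
carries `β^k` and the variance `n (n + 2)/12`, the length carries `β^(k+1)`; the prefactor
compensates. -/
theorem lintegral_totalLength_mul (n : ℕ) (hn : 0 < n) {β u : ℝ} (hβ : 0 < β) (hu0 : 0 ≤ u)
    (hu1 : u ≤ 1) :
    AEMeasurable (fun ω => ENNReal.ofReal (totalLength β ω)) (rho G β u) ∧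
    ∫⁻ ω, ENNReal.ofReal (((n : ℝ) + 1) ^ loopCount β ω) * ENNReal.ofReal (totalLength β ω)
        ∂(rho G β u) =
      ENNReal.ofReal (Real.exp (-(Fintype.card G.edgeSet * β)) *
        (β / ((n : ℝ) * (n + 2) / 12) * (Matrix.diagonal (totalSpin V n) *
          ∑' k, expDerivTerm (β • hopping G n u) (Matrix.diagonal (totalSpin V n)) k).trace)) := by
  have hmeas (k : ℕ) (l : Fin k → Label G) : Measurable fun t : Fin k → ℝ =>
      ∑ x, ∑ y, ∑ j, if segLoop l (x, 0) = segLoop l (y, j) then volume (timeInterval β t j)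
        else 0 :=
    Finset.measurable_sum _ fun x _ => Finset.measurable_sum _ fun y _ =>
      Finset.measurable_sum _ fun j _ => by
        split_ifs
        exacts [measurable_volume_timeInterval β j, measurable_const]
  refine ⟨(lintegral_rho (G := G) hβ.le hu0 hu1 (fun k l t => ∑ x, ∑ y, ∑ j,
    if segLoop l (x, 0) = segLoop l (y, j) then volume (timeInterval β t j) else 0) hmeas
    (fun k l t h1 h2 h3 => ofReal_totalLength h1 h2 h3 hβ)).1, ?_⟩
  have h := (lintegral_rho (G := G) hβ.le hu0 hu1
    (g := fun ω => ENNReal.ofReal (((n : ℝ) + 1) ^ loopCount β ω) *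
      ENNReal.ofReal (totalLength β ω))
    (fun k l t => ENNReal.ofReal (((n : ℝ) + 1) ^ Fintype.card (SegLoop l)) * ∑ x, ∑ y, ∑ j,
    if segLoop l (x, 0) = segLoop l (y, j) then volume (timeInterval β t j) else 0)
    (fun k l => (hmeas k l).const_mul _)
    (fun k l t h1 h2 h3 => by
      simp only [ofReal_totalLength h1 h2 h3 hβ, loopCount_realization h1 h2 h3 hβ])).2
  refine h.trans ?_
  have hw {k : ℕ} (l : Fin k → Label G) : 0 ≤ ∏ i, labelWeight u (l i) :=
    Finset.prod_nonneg fun i _ => labelWeight_nonneg hu0 hu1 _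
  have hc : (n : ℝ) * (n + 2) / 12 ≠ 0 := by positivity
  have hsum := ((summable_trace_mul_expDerivTerm (Matrix.diagonal (totalSpin V n))
    (β • hopping G n u) (Matrix.diagonal (totalSpin V n))).mul_left
    (β / ((n : ℝ) * (n + 2) / 12))).mul_left (Real.exp (-(Fintype.card G.edgeSet * β)))
  have hb (k : ℕ) : 0 ≤ β ^ (k + 1) / ((k + 1).factorial : ℝ) := by positivity
  have hterm (k : ℕ) : Real.exp (-(Fintype.card G.edgeSet * β)) *
      (β / ((n : ℝ) * (n + 2) / 12) * (Matrix.diagonal (totalSpin V n) *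
        expDerivTerm (β • hopping G n u) (Matrix.diagonal (totalSpin V n)) k).trace) =
      Real.exp (-(Fintype.card G.edgeSet * β)) *
      ∑ l : Fin k → Label G, (∏ i, labelWeight u (l i)) *
        (((n : ℝ) + 1) ^ Fintype.card (SegLoop l) * ∑ x, ∑ y, ∑ j : Fin (k + 1),
          if segLoop l (x, 0) = segLoop l (y, j) then β ^ (k + 1) / (k + 1).factorial else 0) := by
    congr 1
    have h1 (j : Fin (k + 1)) : (Matrix.diagonal (totalSpin V n) * (β • hopping G n u) ^ (j : ℕ) *
        Matrix.diagonal (totalSpin V n) * (β • hopping G n u) ^ (k - j)).trace =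
        β ^ k * ((n : ℝ) * (n + 2) / 12) * ∑ l : Fin k → Label G, (∏ i, labelWeight u (l i)) *
          (((n : ℝ) + 1) ^ Fintype.card (SegLoop l) * ∑ x, ∑ y,
            if segLoop l (x, 0) = segLoop l (y, j) then 1 else 0) := by
      have hk : β ^ (j : ℕ) * β ^ (k - j) = β ^ k := by
        rw [← pow_add, Nat.add_sub_cancel' (Nat.lt_succ_iff.mp j.2)]
      have hassoc := trace_totalSpin_hopping_pow (G := G) n u k j
      simp only [← Matrix.mul_assoc] at hassoc
      simp only [smul_pow, Matrix.mul_smul, Matrix.smul_mul, Matrix.trace_smul, smul_eq_mul, hassoc]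
      rw [← mul_assoc, mul_comm (β ^ (k - j)), hk, mul_assoc]
      congr 1
      rw [Finset.mul_sum]
      refine Finset.sum_congr rfl fun l _ => ?_
      simp only [Finset.mul_sum]
      refine Finset.sum_congr rfl fun x _ => Finset.sum_congr rfl fun y _ => ?_
      split_ifs <;> ring
    -- The sum is reversed because `expDerivTerm` has the power `k - i` on the left, whereas `h1`
    -- has the power `j` there.
    rw [trace_mul_expDerivTerm, ← Finset.sum_range_reflect, Finset.sum_range]
    have h2 (j : Fin (k + 1)) : k - (k + 1 - 1 - (j : ℕ)) = j := by omega
    have h3 (j : Fin (k + 1)) : k + 1 - 1 - (j : ℕ) = k - j := by omega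
    simp only [h2]
    simp only [h3, h1]
    rw [← Finset.mul_sum, Finset.sum_comm]
    simp only [Finset.mul_sum]
    refine Finset.sum_congr rfl fun l _ => ?_
    rw [Finset.sum_comm]
    refine Finset.sum_congr rfl fun x _ => ?_
    rw [Finset.sum_comm]
    refine Finset.sum_congr rfl fun y _ => Finset.sum_congr rfl fun j _ => ?_
    split_ifs
    · field_simp
      ring
    · ring
  simp only [hterm] at hsum
  have hnn {k : ℕ} (l : Fin k → Label G) (x y : V) (j : Fin (k + 1)) :
      0 ≤ if segLoop l (x, 0) = segLoop l (y, j) then β ^ (k + 1) / ((k + 1).factorial : ℝ)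
        else 0 := by
    split_ifs
    exacts [hb k, le_rfl]
  have hnn3 {k : ℕ} (l : Fin k → Label G) (x y : V) := Finset.sum_nonneg (s := Finset.univ)
    fun j _ => hnn l x y j
  have hnn2 {k : ℕ} (l : Fin k → Label G) (x : V) := Finset.sum_nonneg (s := Finset.univ)
    fun y _ => hnn3 l x y
  have hnn1 {k : ℕ} (l : Fin k → Label G) := Finset.sum_nonneg (s := Finset.univ)
    fun x _ => hnn2 l x
  rw [← hsum.tsum_eq, ENNReal.ofReal_tsum_of_nonneg _ hsum.summable]
  · refine tsum_congr fun k => ?_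
    rw [ENNReal.ofReal_mul (Real.exp_pos _).le, ENNReal.ofReal_sum_of_nonneg fun l _ =>
      mul_nonneg (hw l) (mul_nonneg (by positivity) (hnn1 l))]
    congr 1
    refine Finset.sum_congr rfl fun l _ => ?_
    rw [ENNReal.ofReal_mul (hw l), ENNReal.ofReal_mul (by positivity),
      lintegral_const_mul _ (hmeas k l), ENNReal.ofReal_sum_of_nonneg fun x _ => hnn2 l x,
      lintegral_finsetSum _ fun x _ => Finset.measurable_sum _ fun y _ =>
        Finset.measurable_sum _ fun j _ => by
          split_ifs
          exacts [measurable_volume_timeInterval β j, measurable_const]]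
    congr 2
    refine Finset.sum_congr rfl fun x _ => ?_
    rw [ENNReal.ofReal_sum_of_nonneg fun y _ => hnn3 l x y,
      lintegral_finsetSum _ fun y _ => Finset.measurable_sum _ fun j _ => by
          split_ifs
          exacts [measurable_volume_timeInterval β j, measurable_const]]
    refine Finset.sum_congr rfl fun y _ => ?_
    rw [ENNReal.ofReal_sum_of_nonneg fun j _ => hnn l x y j,
      lintegral_finsetSum _ fun j _ => by
          split_ifs
          exacts [measurable_volume_timeInterval β j, measurable_const]]
    refine Finset.sum_congr rfl fun j _ => ?_
    split_ifs
    · exact lintegral_volume_timeInterval β hβ.le j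
    · simp
  · exact fun k => mul_nonneg (Real.exp_pos _).le
      (Finset.sum_nonneg fun l _ => mul_nonneg (hw l) (mul_nonneg (by positivity) (hnn1 l)))

end RandomLoops

/-! ### Expected total length as a Duhamel function -/

section LoopExpectations

open NormedSpace
open scoped Matrix.Norms.Operator

variable {V : Type*} [Fintype V] [DecidableEq V] {G : SimpleGraph V} [Fintype G.edgeSet]

theorem compat_comm {α : Type*} (l : Label G) (σ τ : V → α) : Compat l τ σ ↔ Compat l σ τ := by
  have h (σ τ : V → α) (h : Compat l σ τ) : Compat l τ σ :=
    ⟨fun z hz => (h.1 z hz).symm, fun x y hxy =>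
      ⟨fun hk => ((h.2 y x (hxy.trans Sym2.eq_swap)).1 hk).symm, fun hk => ((h.2 x y hxy).2 hk).symm⟩⟩
  exact ⟨h τ σ, h σ τ⟩

theorem labelOp_isSymm (n : ℕ) (l : Label G) : (labelOp n l).IsSymm := by
  ext σ τ
  simp only [Matrix.transpose_apply, labelOp, Matrix.of_apply]
  by_cases h : Compat l σ τ
  · rw [if_pos h, if_pos ((compat_comm l σ τ).2 h)]
  · rw [if_neg h, if_neg (mt (compat_comm l σ τ).1 h)]

theorem hopping_isSymm (n : ℕ) (u : ℝ) : (hopping G n u).IsSymm := by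
  rw [Matrix.IsSymm, hopping, Matrix.transpose_sum]
  refine Finset.sum_congr rfl fun l _ => ?_
  rw [Matrix.transpose_smul, labelOp_isSymm]

variable (G) in
/-- The partition function without its normalization. -/
noncomputable def hoppingPartition (n : ℕ) (β u : ℝ) : ℝ := (exp (β • hopping G n u)).trace

variable (G) in
/-- The Duhamel two-point function of the total spin, without its normalization. -/
noncomputable def spinDuhamel (n : ℕ) (β u : ℝ) : ℝ :=
  (Matrix.diagonal (totalSpin V n) *
    ∑' k, expDerivTerm (β • hopping G n u) (Matrix.diagonal (totalSpin V n)) k).trace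

theorem hoppingPartition_pos (n : ℕ) (β u : ℝ) : 0 < hoppingPartition G n β u :=
  trace_exp_pos ((hopping_isSymm n u).smul β)

theorem spinDuhamel_nonneg (n : ℕ) (β u : ℝ) : 0 ≤ spinDuhamel G n β u :=
  (duhamel_bounds ((hopping_isSymm n u).smul β) (Matrix.isSymm_diagonal _)).2.1

theorem loopPartition_eq (n : ℕ) {β u : ℝ} (hβ : 0 < β) (hu0 : 0 ≤ u) (hu1 : u ≤ 1) :
    loopPartition G β u (n + 1) =
      Real.exp (-(Fintype.card G.edgeSet * β)) * hoppingPartition G n β u := by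
  obtain ⟨h1, h2⟩ := lintegral_pow_loopCount (G := G) n hβ hu0 hu1
  have hm : AEMeasurable (fun ω => ((n : ℝ) + 1) ^ loopCount β ω) (rho G β u) := by
    refine h1.ennreal_toReal.congr (Filter.Eventually.of_forall fun ω => ?_)
    exact ENNReal.toReal_ofReal (by positivity)
  rw [loopPartition, integral_eq_lintegral_of_nonneg_ae
    (Filter.Eventually.of_forall fun ω => by positivity) hm.aestronglyMeasurable, h2,
    ENNReal.toReal_ofReal]
  · rfl
  · exact mul_nonneg (Real.exp_pos _).le (hoppingPartition_pos n β u).le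

/-- The Poisson normalization `exp (-β|𝓔|)` occurs in numerator and denominator and cancels.
Finiteness of the integral of the length comes with its explicit value. -/
theorem loopMeasure_facts (n : ℕ) (hn : 0 < n) {β u : ℝ} (hβ : 0 < β) (hu0 : 0 ≤ u) (hu1 : u ≤ 1) :
    IsProbabilityMeasure (loopMeasure G β u (n + 1)) ∧
    Integrable (totalLength β) (loopMeasure G β u (n + 1)) ∧
    expectedTotalLength G β u (n + 1) =
      β / ((n : ℝ) * (n + 2) / 12) * (spinDuhamel G n β u / hoppingPartition G n β u) := by
  obtain ⟨h1, h2⟩ := lintegral_pow_loopCount (G := G) n hβ hu0 hu1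
  obtain ⟨h3, h4⟩ := lintegral_totalLength_mul (G := G) n hn hβ hu0 hu1
  have hZ := hoppingPartition_pos (G := G) n β u
  have hY := loopPartition_eq (G := G) n hβ hu0 hu1
  have hYpos : 0 < loopPartition G β u (n + 1) := by
    rw [hY]
    exact mul_pos (Real.exp_pos _) hZ
  have hdens (ω : Realization G) : ENNReal.ofReal (((n : ℝ) + 1) ^ loopCount β ω /
      loopPartition G β u (n + 1)) = ENNReal.ofReal (((n : ℝ) + 1) ^ loopCount β ω) *
      ENNReal.ofReal (loopPartition G β u (n + 1))⁻¹ := by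
    rw [div_eq_mul_inv, ENNReal.ofReal_mul (by positivity)]
  have hmeas : loopMeasure G β u (n + 1) = (rho G β u).withDensity fun ω =>
      ENNReal.ofReal (((n : ℝ) + 1) ^ loopCount β ω) *
      ENNReal.ofReal (loopPartition G β u (n + 1))⁻¹ := by
    simp only [loopMeasure, hdens]
  have hTL : AEMeasurable (totalLength β) (rho G β u) := by
    refine h3.ennreal_toReal.congr (Filter.Eventually.of_forall fun ω => ?_)
    exact ENNReal.toReal_ofReal (totalLength_nonneg ω)
  have hTLm : AEStronglyMeasurable (totalLength β) (loopMeasure G β u (n + 1)) := by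
    rw [hmeas]
    exact (hTL.mono_ac (withDensity_absolutelyContinuous _ _)).aestronglyMeasurable
  have hlint : ∫⁻ ω, ENNReal.ofReal (totalLength β ω) ∂(loopMeasure G β u (n + 1)) =
      ENNReal.ofReal (β / ((n : ℝ) * (n + 2) / 12) *
        (spinDuhamel G n β u / hoppingPartition G n β u)) := by
    rw [hmeas, lintegral_withDensity_eq_lintegral_mul₀ (h1.mul_const _) h3]
    simp only [Pi.mul_apply]
    have hcomm (ω : Realization G) : ENNReal.ofReal (((n : ℝ) + 1) ^ loopCount β ω) *
        ENNReal.ofReal (loopPartition G β u (n + 1))⁻¹ * ENNReal.ofReal (totalLength β ω) =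
        ENNReal.ofReal (((n : ℝ) + 1) ^ loopCount β ω) * ENNReal.ofReal (totalLength β ω) *
        ENNReal.ofReal (loopPartition G β u (n + 1))⁻¹ := mul_right_comm _ _ _
    simp only [hcomm]
    rw [lintegral_mul_const' _ _ ENNReal.ofReal_ne_top, h4, ← ENNReal.ofReal_mul]
    · congr 1
      rw [hY]
      change Real.exp _ * (_ * spinDuhamel G n β u) * _ = _
      have := (Real.exp_pos (-(Fintype.card G.edgeSet * β))).ne'
      field_simp
    · have hD := spinDuhamel_nonneg (G := G) n β u
      unfold spinDuhamel at hD
      positivity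
  have hE : 0 ≤ β / ((n : ℝ) * (n + 2) / 12) *
      (spinDuhamel G n β u / hoppingPartition G n β u) := by
    have hD := spinDuhamel_nonneg (G := G) n β u
    positivity
  have hae : 0 ≤ᵐ[loopMeasure G β u (n + 1)] totalLength β :=
    Filter.Eventually.of_forall fun ω => totalLength_nonneg ω
  refine ⟨⟨?_⟩, ⟨hTLm, ?_⟩, ?_⟩
  · rw [hmeas, withDensity_apply _ MeasurableSet.univ, setLIntegral_univ,
      lintegral_mul_const' _ _ ENNReal.ofReal_ne_top, h2]
    change ENNReal.ofReal (_ * hoppingPartition G n β u) * _ = _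
    rw [← hY, ← ENNReal.ofReal_mul hYpos.le, mul_inv_cancel₀ hYpos.ne', ENNReal.ofReal_one]
  · rw [hasFiniteIntegral_iff_ofReal hae, hlint]
    exact ENNReal.ofReal_lt_top
  · rw [expectedTotalLength, integral_eq_lintegral_of_nonneg_ae hae hTLm, hlint,
      ENNReal.toReal_ofReal hE]

end LoopExpectations

/-! ### Quantum model in terms of real matrices -/

section QuantumSide

open NormedSpace
open scoped Matrix.Norms.Operator

variable {V : Type*} [Fintype V] [DecidableEq V]

theorem pairOp_transposition (n : ℕ) {G : SimpleGraph V} (e : G.edgeSet) (x y : V)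
    (he : (e : Sym2 V) = s(x, y)) :
    pairOp x y (transposition n) =
      (labelOp n ((e, .cross) : Label G)).map (Complex.ofReal : ℝ → ℂ) := by
  ext σ τ
  simp only [pairOp, transposition, labelOp, Matrix.of_apply, Matrix.map_apply, Compat]
  rw [apply_ite Complex.ofReal, Complex.ofReal_one, Complex.ofReal_zero, ← ite_and]
  refine if_congr ?_ rfl rfl
  simp only [he, Sym2.mem_iff, not_or, and_imp, Sym2.eq_iff]
  refine and_congr Iff.rfl ⟨?_, fun h => ⟨?_, ?_⟩⟩
  · rintro ⟨h1, h2⟩ a b (⟨rfl, rfl⟩ | ⟨rfl, rfl⟩)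
    exacts [⟨fun _ => h1, nofun⟩, ⟨fun _ => h2, nofun⟩]
  · exact (h x y (.inl ⟨rfl, rfl⟩)).1 trivial
  · exact (h y x (.inr ⟨rfl, rfl⟩)).1 trivial

theorem pairOp_doubleBar (n : ℕ) {G : SimpleGraph V} (e : G.edgeSet) (x y : V)
    (he : (e : Sym2 V) = s(x, y)) :
    pairOp x y (doubleBar n) =
      (labelOp n ((e, .bar) : Label G)).map (Complex.ofReal : ℝ → ℂ) := by
  ext σ τ
  simp only [pairOp, doubleBar, labelOp, Matrix.of_apply, Matrix.map_apply, Compat]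
  rw [apply_ite Complex.ofReal, Complex.ofReal_one, Complex.ofReal_zero, ← ite_and]
  refine if_congr ?_ rfl rfl
  simp only [he, Sym2.mem_iff, not_or, and_imp, Sym2.eq_iff]
  refine and_congr Iff.rfl ⟨?_, fun h => ?_⟩
  · rintro ⟨h1, h2⟩ a b (⟨rfl, rfl⟩ | ⟨rfl, rfl⟩)
    exacts [⟨nofun, fun _ => ⟨h1, h2⟩⟩, ⟨nofun, fun _ => ⟨h1.symm, h2.symm⟩⟩]
  · exact (h x y (.inl ⟨rfl, rfl⟩)).2 trivial

/-- Entrywise inclusion of real matrices into complex matrices. -/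
noncomputable abbrev complexify (N : Type*) [Fintype N] [DecidableEq N] :
    Matrix N N ℝ →+* Matrix N N ℂ := Complex.ofRealHom.mapMatrix

theorem complexify_smul {N : Type*} [Fintype N] [DecidableEq N] (r : ℝ) (A : Matrix N N ℝ) :
    complexify N (r • A) = (r : ℂ) • complexify N A := by
  ext i j
  simp

theorem complexify_exp {N : Type*} [Fintype N] [DecidableEq N] (A : Matrix N N ℝ) :
    complexify N (exp A) = exp (complexify N A) :=
  map_exp (complexify N) (continuous_id.matrix_map Complex.continuous_ofReal) A

theorem complexify_trace {N : Type*} [Fintype N] [DecidableEq N] (A : Matrix N N ℝ) :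
    (complexify N A).trace = (A.trace : ℂ) := by
  simp [Matrix.trace]

variable (G : SimpleGraph V) [DecidableRel G.Adj]

/-- The `-1` in each bond adds up to the shift by `|𝓔|`, which in the exponential is the Poisson
normalization. -/
theorem neg_hamiltonian_eq (n : ℕ) (u : ℝ) :
    -hamiltonian G n u = complexify _ (hopping G n u - (Fintype.card G.edgeSet : ℝ) • 1) := by
  rw [hamiltonian, neg_neg, hopping, Fintype.sum_prod_type, SimpleGraph.edgeFinset,
    ← Finset.sum_set_coe, map_sub, complexify_smul, map_one, map_sum]
  have h1 : (((Fintype.card G.edgeSet : ℝ) : ℂ) • 1 : Op V n) = ∑ _e : G.edgeSet, 1 := by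
    rw [Finset.sum_const, Finset.card_univ, ← Nat.cast_smul_eq_nsmul ℂ]
    simp
  rw [h1, ← Finset.sum_sub_distrib]
  refine Finset.sum_congr rfl fun e _ => ?_
  obtain ⟨e, he⟩ := e
  induction e with
  | _ x y =>
  rw [Sym2.lift_mk, Kind.sum_univ, map_add, complexify_smul, complexify_smul]
  simp only [bond]
  rw [pairOp_transposition n ⟨s(x, y), he⟩ x y rfl, pairOp_doubleBar n ⟨s(x, y), he⟩ x y rfl]
  rfl

theorem sum_siteOp_spin3 (n : ℕ) :
    ∑ x : V, siteOp x (spin3 n) = complexify _ (Matrix.diagonal (totalSpin V n)) := by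
  ext σ τ
  rw [Matrix.sum_apply]
  by_cases h : σ = τ
  · subst h
    simp [siteOp, spin3, totalSpin, spinVal]
  · simp only [siteOp, Matrix.of_apply, spin3]
    simp only [RingHom.mapMatrix_apply, Matrix.map_apply, Matrix.diagonal_apply_ne _ h, map_zero]
    refine Finset.sum_eq_zero fun x _ => ?_
    split_ifs with hx
    · refine Matrix.diagonal_apply_ne _ fun hxx => h (funext fun z => ?_)
      by_cases hz : z = x
      · rw [hz, hxx]
      · exact hx z hz
    · rfl

theorem exp_sub_smul_one {N : Type*} [Fintype N] [DecidableEq N] (A : Matrix N N ℝ) (r : ℝ) :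
    exp (A - r • (1 : Matrix N N ℝ)) = Real.exp (-r) • exp A := by
  have h1 : A - r • (1 : Matrix N N ℝ) = A + (-r) • 1 := by rw [neg_smul, sub_eq_add_neg]
  rw [h1, Matrix.exp_add_of_commute _ _ ((Commute.one_right A).smul_right _)]
  have h2 : exp ((-r) • (1 : Matrix N N ℝ)) = Real.exp (-r) • 1 := by
    rw [Matrix.smul_one_eq_diagonal, Matrix.exp_diagonal, Matrix.smul_one_eq_diagonal]
    congr 1
    funext i
    rw [Pi.exp_def, Real.exp_eq_exp_ℝ]
  rw [h2, mul_smul_comm, mul_one]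

theorem gibbsOp_eq (n : ℕ) (β u h : ℝ) :
    gibbsOp G n β u h = complexify _ (Real.exp (-(Fintype.card G.edgeSet * β)) •
      exp (β • hopping G n u + h • (β • Matrix.diagonal (totalSpin V n)))) := by
  rw [← exp_sub_smul_one, complexify_exp, gibbsOp, neg_smul, ← smul_neg, neg_hamiltonian_eq,
    sum_siteOp_spin3, ← complexify_smul, ← complexify_smul, ← map_add]
  congr 2
  rw [smul_sub, smul_smul, smul_smul, mul_comm h, mul_comm (Fintype.card G.edgeSet : ℝ)]
  abel

theorem exp_neg_smul_hamiltonian (n : ℕ) (β u : ℝ) :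
    exp (-(β : ℂ) • hamiltonian G n u) = complexify _
      (Real.exp (-(Fintype.card G.edgeSet * β)) • exp (β • hopping G n u)) := by
  have h := gibbsOp_eq G n β u 0
  simpa [gibbsOp] using h

theorem spinCorrelationSum_eq (n : ℕ) (β u : ℝ) :
    spinCorrelationSum G n β u = (Matrix.diagonal (totalSpin V n) *
      Matrix.diagonal (totalSpin V n) * exp (β • hopping G n u)).trace /
        hoppingPartition G n β u := by
  have h1 : spinCorrelationSum G n β u =
      (((∑ x, siteOp x (spin3 n)) * (∑ y, siteOp y (spin3 n)) *
        exp (-(β : ℂ) • hamiltonian G n u)).trace /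
        (exp (-(β : ℂ) • hamiltonian G n u)).trace).re := by
    simp only [spinCorrelationSum, gibbsState]
    rw [Finset.sum_mul_sum, Finset.sum_mul, Matrix.trace_sum, Finset.sum_div, Complex.re_sum]
    refine Finset.sum_congr rfl fun x _ => ?_
    rw [Finset.sum_mul, Matrix.trace_sum, Finset.sum_div, Complex.re_sum]
  rw [h1, exp_neg_smul_hamiltonian, sum_siteOp_spin3, ← map_mul, ← map_mul, complexify_trace,
    complexify_trace, ← Complex.ofReal_div, Complex.ofReal_re, mul_smul_comm, Matrix.trace_smul,
    Matrix.trace_smul, smul_eq_mul, smul_eq_mul, mul_div_mul_left _ _ (Real.exp_pos _).ne']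
  rfl

theorem expDerivTerm_smul {N : Type*} [Fintype N] [DecidableEq N] [Nonempty N] (X B : Matrix N N ℝ)
    (r : ℝ) : ∑' k, expDerivTerm X (r • B) k = r • ∑' k, expDerivTerm X B k := by
  refine Eq.trans (tsum_congr fun k => ?_) ((summable_expDerivTerm X B).tsum_const_smul r)
  simp only [expDerivTerm, mul_smul_comm, smul_mul_assoc, ← Finset.smul_sum]
  rw [smul_comm]

theorem trace_totalSpin_mul_exp (n : ℕ) (β u : ℝ) :
    (Matrix.diagonal (totalSpin V n) * exp (β • hopping G n u)).trace = 0 := by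
  have h := hasSum_trace_mul_exp (Matrix.diagonal (totalSpin V n)) (β • hopping G n u)
  simp only [smul_pow, mul_smul_comm, Matrix.trace_smul, trace_totalSpin_mul_hopping_pow,
    smul_zero, mul_zero] at h
  exact h.unique hasSum_zero

/-- The second derivative of `log f` is `f''/f - (f'/f)²`, and `f'(0) = 0` as the total spin has
mean zero. The factor `β²` appears because the field is multiplied by `βM`. -/
theorem logPartition_facts (n : ℕ) (β u : ℝ) :
    ContDiffAt ℝ 2 (logPartition G n β u) 0 ∧ iteratedDeriv 2 (logPartition G n β u) 0 =
      β ^ 2 * (spinDuhamel G n β u / hoppingPartition G n β u) := by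
  set A := β • hopping G n u with hA
  set M := Matrix.diagonal (totalSpin V n) with hM
  let f : ℝ → ℝ := fun h => (exp (A + h • (β • M))).trace
  let g : ℝ → ℝ := fun h => ((β • M) * exp (A + h • (β • M))).trace
  have hfpos (h : ℝ) : 0 < f h :=
    trace_exp_pos (((hopping_isSymm n u).smul β).add
      (((Matrix.isSymm_diagonal _).smul β).smul h))
  have hlog : logPartition G n β u =
      fun h => -(Fintype.card G.edgeSet * β) + Real.log (f h) := by
    funext h
    rw [logPartition, gibbsOp_eq, complexify_trace, Complex.ofReal_re, Matrix.trace_smul,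
      smul_eq_mul, Real.log_mul (Real.exp_pos _).ne' (hfpos h).ne', Real.log_exp]
  have hf' (h : ℝ) : HasDerivAt f (g h) h := hasDerivAt_trace_exp A (β • M) h
  have hg' : HasDerivAt g (β ^ 2 * spinDuhamel G n β u) 0 := by
    convert hasDerivAt_trace_mul_exp (β • M) A (β • M) 0 using 1
    rw [zero_smul, add_zero, expDerivTerm_smul, smul_mul_smul_comm, Matrix.trace_smul, smul_eq_mul,
      sq]
    rfl
  have hg0 : g 0 = 0 := by
    simp only [g]
    rw [zero_smul, add_zero, smul_mul_assoc, Matrix.trace_smul, hA, hM, trace_totalSpin_mul_exp,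
      smul_zero]
  have hf0 : f 0 = hoppingPartition G n β u := by
    simp only [f, zero_smul, add_zero]
    rfl
  constructor
  · rw [hlog]
    exact contDiffAt_const.add
      ((contDiff_trace_exp A (β • M)).contDiffAt.log (hfpos 0).ne')
  · have hd : deriv (logPartition G n β u) = fun h => g h / f h := by
      funext h
      rw [hlog]
      exact (((hf' h).log (hfpos h).ne').const_add _).deriv
    rw [iteratedDeriv_succ, iteratedDeriv_one, hd,
      (hg'.fun_div (hf' 0) (hfpos 0).ne').deriv, hg0, hf0]
    have := (hoppingPartition_pos (G := G) n β u).ne'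
    field_simp
    ring

end QuantumSide

/-! ### Double commutator bound -/

section CommutatorBound

open NormedSpace
open scoped Matrix.Norms.Operator

theorem pow_entry_nonneg {N : Type*} [Fintype N] [DecidableEq N] {X : Matrix N N ℝ}
    (hX : ∀ i j, 0 ≤ X i j) (k : ℕ) (i j : N) : 0 ≤ (X ^ k) i j := by
  induction k generalizing j with
  | zero =>
    rw [pow_zero, Matrix.one_apply]
    split_ifs <;> norm_num
  | succ k ih =>
    rw [pow_succ, Matrix.mul_apply]
    exact Finset.sum_nonneg fun a _ => mul_nonneg (ih a) (hX a j)

/-- The powers of `X`, hence the terms of the exponential series, have nonnegative entries, so an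
entrywise comparison suffices; no operator inequality between `C` and `C'` is needed. -/
theorem trace_mul_exp_mono {N : Type*} [Fintype N] [DecidableEq N] [Nonempty N]
    {C C' X : Matrix N N ℝ} (hX : ∀ i j, 0 ≤ X i j) (hC : ∀ i j, C i j ≤ C' i j) :
    (C * exp X).trace ≤ (C' * exp X).trace := by
  refine hasSum_le (fun k => ?_) (hasSum_trace_mul_exp C X) (hasSum_trace_mul_exp C' X)
  refine mul_le_mul_of_nonneg_left ?_ (by positivity)
  simp only [Matrix.trace, Matrix.diag_apply, Matrix.mul_apply]
  exact Finset.sum_le_sum fun i _ => Finset.sum_le_sum fun j _ =>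
    mul_le_mul_of_nonneg_right (hC i j) (pow_entry_nonneg hX k j i)

variable {V : Type*} [Fintype V] [DecidableEq V] {G : SimpleGraph V}

theorem totalSpin_eq_of_compat_cross (n : ℕ) {e : G.edgeSet} {σ τ : V → Fin (n + 1)}
    (h : Compat ((e, .cross) : Label G) σ τ) : totalSpin V n σ = totalSpin V n τ := by
  obtain ⟨e, he⟩ := e
  induction e with
  | _ x y =>
  rw [totalSpin, totalSpin, ← Equiv.sum_comp (Equiv.swap x y) fun z => spinVal n (τ z)]
  refine Finset.sum_congr rfl fun z _ => congrArg (spinVal n) ?_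
  by_cases hx : z = x
  · rw [hx, Equiv.swap_apply_left]
    exact (h.2 x y rfl).1 rfl
  by_cases hy : z = y
  · rw [hy, Equiv.swap_apply_right]
    exact (h.2 y x Sym2.eq_swap).1 rfl
  · rw [Equiv.swap_apply_of_ne_of_ne hx hy]
    exact h.1 z (by simp [hx, hy])

/-- The spins at the two endpoints agree before and agree after a double bar, so the total spin
changes by twice a difference of two numbers in `[0, n]`. -/
theorem sq_totalSpin_sub_le_of_compat_bar (n : ℕ) {e : G.edgeSet} {σ τ : V → Fin (n + 1)}
    (h : Compat ((e, .bar) : Label G) σ τ) :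
    (totalSpin V n σ - totalSpin V n τ) ^ 2 ≤ 4 * (n : ℝ) ^ 2 := by
  obtain ⟨e, he⟩ := e
  induction e with
  | _ x y =>
  have hxy : x ≠ y := G.ne_of_adj he
  have h1 : totalSpin V n σ - totalSpin V n τ = 2 * ((σ x : ℝ) - τ x) := by
    rw [totalSpin, totalSpin, ← Finset.sum_sub_distrib,
      ← Finset.sum_subset (Finset.subset_univ {x, y}), Finset.sum_pair hxy]
    · obtain ⟨h2, h3⟩ := (h.2 x y rfl).2 rfl
      rw [← h2, ← h3, spinVal, spinVal]
      ring
    · intro z _ hz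
      rw [h.1 z (by simpa using hz), sub_self]
  have h2 : (σ x : ℝ) ≤ n := by exact_mod_cast Nat.lt_succ_iff.mp (σ x).2
  have h3 : (τ x : ℝ) ≤ n := by exact_mod_cast Nat.lt_succ_iff.mp (τ x).2
  have h4 : (0 : ℝ) ≤ (σ x : ℕ) := Nat.cast_nonneg _
  have h5 : (0 : ℝ) ≤ (τ x : ℕ) := Nat.cast_nonneg _
  rw [h1, mul_pow]
  have : ((σ x : ℝ) - τ x) ^ 2 ≤ (n : ℝ) ^ 2 := sq_le_sq' (by linarith) (by linarith)
  linarith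

theorem labelOp_bar_mul_self (n : ℕ) (e : G.edgeSet) :
    labelOp n ((e, .bar) : Label G) * labelOp n (e, .bar) =
      ((n : ℝ) + 1) • labelOp n (e, .bar) := by
  classical
  ext σ τ
  obtain ⟨e, he⟩ := e
  induction e with
  | _ x y =>
  have hxy : x ≠ y := G.ne_of_adj he
  have hiff (σ τ : V → Fin (n + 1)) : Compat ((⟨s(x, y), he⟩, .bar) : Label G) σ τ ↔
      (∀ z, z ≠ x → z ≠ y → σ z = τ z) ∧ σ x = σ y ∧ τ x = τ y := by
    simp only [Compat, Sym2.mem_iff, not_or, and_imp, Sym2.eq_iff]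
    refine and_congr Iff.rfl ⟨fun h => (h x y (.inl ⟨rfl, rfl⟩)).2 trivial, ?_⟩
    rintro ⟨h1, h2⟩ a b (⟨rfl, rfl⟩ | ⟨rfl, rfl⟩)
    exacts [⟨nofun, fun _ => ⟨h1, h2⟩⟩, ⟨nofun, fun _ => ⟨h1.symm, h2.symm⟩⟩]
  simp only [Matrix.mul_apply, Matrix.smul_apply, smul_eq_mul, labelOp, Matrix.of_apply, hiff]
  by_cases h : (∀ z, z ≠ x → z ≠ y → σ z = τ z) ∧ σ x = σ y ∧ τ x = τ y
  · rw [if_pos h, mul_one]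
    -- The intermediate configurations that contribute are determined by their common value `a` at
    -- `x` and `y`, which accounts for the factor `n + 1`.
    let f : Fin (n + 1) → V → Fin (n + 1) := fun a z => if z = x ∨ z = y then a else σ z
    have hf : Function.Injective f := fun a b hab => by simpa [f] using congrFun hab x
    have key : ∀ ρ : V → Fin (n + 1), ρ ∉ Finset.univ.image f →
        (if (∀ z, z ≠ x → z ≠ y → σ z = ρ z) ∧ σ x = σ y ∧ ρ x = ρ y then (1 : ℝ) else 0) = 0 := by
      intro ρ hρ
      refine if_neg fun hc => hρ ?_
      refine Finset.mem_image.2 ⟨ρ x, Finset.mem_univ _, funext fun z => ?_⟩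
      by_cases hx : z = x
      · simp [f, hx]
      by_cases hy : z = y
      · simp [f, hy, hc.2.2]
      · simp [f, hx, hy, hc.1 z hx hy]
    rw [← Finset.sum_subset (Finset.subset_univ (Finset.univ.image f))
      (fun ρ _ hρ => by rw [key ρ hρ, zero_mul]), Finset.sum_image hf.injOn]
    have hone (a : Fin (n + 1)) :
        ((if (∀ z, z ≠ x → z ≠ y → σ z = f a z) ∧ σ x = σ y ∧ f a x = f a y then (1 : ℝ) else 0) *
        if (∀ z, z ≠ x → z ≠ y → f a z = τ z) ∧ f a x = f a y ∧ τ x = τ y then 1 else 0) = 1 := by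
      rw [if_pos, if_pos, mul_one]
      · exact ⟨fun z hx hy => by simp [f, hx, hy, h.1 z hx hy], by simp [f], h.2.2⟩
      · exact ⟨fun z hx hy => by simp [f, hx, hy], h.2.1, by simp [f]⟩
    simp [hone]
  · rw [if_neg h, mul_zero]
    refine Finset.sum_eq_zero fun ρ _ => ?_
    by_contra hne
    obtain ⟨h1, h2⟩ := mul_ne_zero_iff.mp hne
    have h3 := (ite_ne_right_iff.mp h1).1
    have h4 := (ite_ne_right_iff.mp h2).1
    exact h ⟨fun z hx hy => (h3.1 z hx hy).trans (h4.1 z hx hy), h3.2.1, h4.2.2⟩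

theorem labelOp_nonneg (n : ℕ) (l : Label G) (σ τ : V → Fin (n + 1)) : 0 ≤ labelOp n l σ τ := by
  simp only [labelOp, Matrix.of_apply]
  split_ifs <;> norm_num

variable [Fintype G.edgeSet]

theorem hopping_nonneg (n : ℕ) {u : ℝ} (hu0 : 0 ≤ u) (hu1 : u ≤ 1) (σ τ : V → Fin (n + 1)) :
    0 ≤ hopping G n u σ τ := by
  rw [hopping, Matrix.sum_apply]
  exact Finset.sum_nonneg fun l _ =>
    mul_nonneg (labelWeight_nonneg hu0 hu1 l) (labelOp_nonneg n l σ τ)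

theorem sq_totalSpin_sub_mul_hopping_le (n : ℕ) {u : ℝ} (hu1 : u ≤ 1)
    (σ τ : V → Fin (n + 1)) :
    (totalSpin V n σ - totalSpin V n τ) ^ 2 * hopping G n u σ τ ≤
      (4 * (n : ℝ) ^ 2 * (1 - u)) * ∑ e, labelOp n ((e, .bar) : Label G) σ τ := by
  rw [hopping, Matrix.sum_apply, Fintype.sum_prod_type, Finset.mul_sum, Finset.mul_sum]
  refine Finset.sum_le_sum fun e _ => ?_
  rw [Kind.sum_univ, mul_add]
  have h1 : (totalSpin V n σ - totalSpin V n τ) ^ 2 *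
      (labelWeight u ((e, .cross) : Label G) • labelOp n ((e, .cross) : Label G)) σ τ = 0 := by
    by_cases h : Compat ((e, .cross) : Label G) σ τ
    · rw [totalSpin_eq_of_compat_cross n h]; simp
    · simp [labelOp, h]
  have h2 : (totalSpin V n σ - totalSpin V n τ) ^ 2 *
      (labelWeight u ((e, .bar) : Label G) • labelOp n ((e, .bar) : Label G)) σ τ ≤
      4 * (n : ℝ) ^ 2 * (1 - u) * labelOp n ((e, .bar) : Label G) σ τ := by
    by_cases h : Compat ((e, .bar) : Label G) σ τ
    · have h3 := sq_totalSpin_sub_le_of_compat_bar n h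
      simp only [labelOp, Matrix.smul_apply, Matrix.of_apply, if_pos h, labelWeight, smul_eq_mul,
        mul_one]
      exact mul_le_mul_of_nonneg_right h3 (sub_nonneg.mpr hu1)
    · simp [labelOp, h]
  linarith

/-- As `M` is diagonal, the double commutator is bounded entrywise by a multiple of the sum of the
double bar operators. Each of these satisfies `Q² = (n + 1) Q`, so `trace_mul_exp_le` applies edge
by edge. -/
theorem trace_commutator_le (n : ℕ) {β u : ℝ} (hβ : 0 < β) (hu0 : 0 ≤ u) (hu1 : u ≤ 1)
    {A M : Matrix (V → Fin (n + 1)) (V → Fin (n + 1)) ℝ} (hA : A = β • hopping G n u)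
    (hM : M = Matrix.diagonal (totalSpin V n)) :
    ((M * M * A - M * A * M - M * A * M + A * M * M) * exp A).trace ≤
      β * ((1 - u) * Fintype.card G.edgeSet) * (4 * (n : ℝ) ^ 2 * (n + 1)) *
        hoppingPartition G n β u := by
  have hu : 0 ≤ 1 - u := sub_nonneg.mpr hu1
  have hX (σ τ : V → Fin (n + 1)) : 0 ≤ A σ τ := by
    rw [hA]
    exact mul_nonneg hβ.le (hopping_nonneg n hu0 hu1 σ τ)
  have hC (σ τ : V → Fin (n + 1)) : (M * M * A - M * A * M - M * A * M + A * M * M) σ τ ≤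
      ((β * (4 * (n : ℝ) ^ 2 * (1 - u))) • ∑ e, labelOp n ((e, .bar) : Label G)) σ τ := by
    have h1 : (M * M * A - M * A * M - M * A * M + A * M * M) σ τ =
        β * ((totalSpin V n σ - totalSpin V n τ) ^ 2 * hopping G n u σ τ) := by
      simp only [hM, hA, Matrix.add_apply, Matrix.sub_apply, Matrix.mul_assoc,
        Matrix.diagonal_mul, Matrix.diagonal_mul_diagonal, Matrix.mul_diagonal, Matrix.smul_apply,
        smul_eq_mul]
      ring
    rw [h1, Matrix.smul_apply, Matrix.sum_apply, smul_eq_mul, mul_assoc β]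
    exact mul_le_mul_of_nonneg_left (sq_totalSpin_sub_mul_hopping_le n hu1 σ τ) hβ.le
  refine (trace_mul_exp_mono hX hC).trans ?_
  rw [smul_mul_assoc, Matrix.trace_smul, Finset.sum_mul, Matrix.trace_sum, smul_eq_mul]
  have hsum : ∑ e, (labelOp n ((e, .bar) : Label G) * exp A).trace ≤
      ∑ _e : G.edgeSet, ((n : ℝ) + 1) * hoppingPartition G n β u := by
    refine Finset.sum_le_sum fun e _ => ?_
    rw [hoppingPartition, ← hA]
    refine trace_mul_exp_le ?_ (labelOp_isSymm n _) (by positivity) (labelOp_bar_mul_self n e)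
    rw [hA]
    exact (hopping_isSymm n u).smul β
  refine (mul_le_mul_of_nonneg_left hsum (by positivity)).trans_eq ?_
  rw [Finset.sum_const, Finset.card_univ, nsmul_eq_mul]
  ring

/-- Comparison of the expected total length with the spin correlations. -/
theorem expectedTotalLength_bounds (G : SimpleGraph V) [DecidableRel G.Adj] (n : ℕ) (hn : 0 < n)
    {β u : ℝ} (hβ : 0 < β) (hu0 : 0 ≤ u) (hu1 : u ≤ 1) :
    β / ((n : ℝ) * (n + 2) / 12) * spinCorrelationSum G n β u -
        √(4 * (n : ℝ) ^ 2 * (n + 1) / ((n : ℝ) * (n + 2) / 12)) / 2 * β *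
          √((1 - u) * (G.edgeFinset.card : ℝ)) * √(expectedTotalLength G β u (n + 1)) ≤
      expectedTotalLength G β u (n + 1) ∧
    expectedTotalLength G β u (n + 1) ≤
      β / ((n : ℝ) * (n + 2) / 12) * spinCorrelationSum G n β u := by
  obtain ⟨-, -, hE⟩ := loopMeasure_facts (G := G) n hn hβ hu0 hu1
  have hZ := hoppingPartition_pos (G := G) n β u
  obtain ⟨h1, h2, h3⟩ := duhamel_bounds (A := β • hopping G n u)
    (M := Matrix.diagonal (totalSpin V n)) ((hopping_isSymm n u).smul β) (Matrix.isSymm_diagonal _)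
  have hR := trace_commutator_le (G := G) n hβ hu0 hu1 rfl rfl
  have hS := spinCorrelationSum_eq G n β u
  rw [← SimpleGraph.edgeFinset_card] at hR
  change spinDuhamel G n β u ≤ _ at h1
  change 0 ≤ spinDuhamel G n β u at h2
  change _ - spinDuhamel G n β u ≤ √_ * √(spinDuhamel G n β u) / 2 at h3
  generalize hTdef : (Matrix.diagonal (totalSpin V n) * Matrix.diagonal (totalSpin V n) *
    exp (β • hopping G n u)).trace = T at *
  generalize spinDuhamel G n β u = D at *
  generalize hoppingPartition G n β u = Z at *
  set c : ℝ := (n : ℝ) * (n + 2) / 12 with hc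
  have hcpos : 0 < c := by positivity
  set m : ℝ := (1 - u) * (G.edgeFinset.card : ℝ)
  have hm : 0 ≤ m := mul_nonneg (sub_nonneg.mpr hu1) (Nat.cast_nonneg _)
  set C : ℝ := 4 * (n : ℝ) ^ 2 * (n + 1)
  have hCpos : 0 ≤ C := by positivity
  rw [hE, hS]
  constructor
  · have h4 := h3.trans (div_le_div_of_nonneg_right (mul_le_mul_of_nonneg_right
      (Real.sqrt_le_sqrt hR) (Real.sqrt_nonneg D)) zero_le_two)
    -- Rewrites the Duhamel bound in terms of the expected length `β/c · D/Z`, so that after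
    -- division by `Z` only this expectation remains.
    have h5 : √(β * m * C * Z) * √D = Z * (c * (√(C / c) * √m * √(β / c * (D / Z)))) := by
      rw [← Real.sqrt_mul (by positivity), ← Real.sqrt_mul (by positivity),
        ← Real.sqrt_mul (by positivity)]
      have h6 : Z * (c * √(C / c * m * (β / c * (D / Z)))) =
          √((Z * c) ^ 2 * (C / c * m * (β / c * (D / Z)))) := by
        rw [Real.sqrt_mul (sq_nonneg (Z * c)), Real.sqrt_sq (by positivity), mul_assoc Z c]
      rw [h6]
      congr 1
      field_simp
    rw [h5] at h4
    have h7 : β / c * (T / Z) - β / c * (D / Z) = β / c / Z * (T - D) := by ring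
    have h8 : β / c / Z * (T - D) ≤
        √(C / c) / 2 * β * √m * √(β / c * (D / Z)) := by
      refine (mul_le_mul_of_nonneg_left h4 (by positivity)).trans_eq ?_
      generalize √(β / c * (D / Z)) = q
      field_simp
    linarith
  · gcongr

end CommutatorBound

end LoopModel

/-! ### The main theorem -/

theorem mainTheorem8 (n : ℕ) (hn : 0 < n) (S : ℝ) (hS : S = (n : ℝ) / 2) :
    (∀ (V : Type*) [Fintype V] [DecidableEq V] (G : SimpleGraph V) [DecidableRel G.Adj]
      (β u : ℝ), 0 < β → 0 ≤ u → u ≤ 1 →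
        IsProbabilityMeasure (LoopModel.loopMeasure G β u (2 * S + 1)) ∧
        Integrable (LoopModel.totalLength β) (LoopModel.loopMeasure G β u (2 * S + 1)) ∧
        ContDiffAt ℝ 2 (LoopModel.logPartition G n β u) 0 ∧
        LoopModel.expectedTotalLength G β u (2 * S + 1) =
          3 / (β * S * (S + 1)) * iteratedDeriv 2 (LoopModel.logPartition G n β u) 0) ∧
    ∃ K : ℝ, ∀ (V : Type*) [Fintype V] [DecidableEq V] (G : SimpleGraph V) [DecidableRel G.Adj]
      (β u : ℝ), 0 < β → 0 ≤ u → u ≤ 1 →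
        3 * β / (S * (S + 1)) * LoopModel.spinCorrelationSum G n β u -
            K * β * √((1 - u) * (G.edgeFinset.card : ℝ)) *
              √(LoopModel.expectedTotalLength G β u (2 * S + 1)) ≤
          LoopModel.expectedTotalLength G β u (2 * S + 1) ∧
        LoopModel.expectedTotalLength G β u (2 * S + 1) ≤
          3 * β / (S * (S + 1)) * LoopModel.spinCorrelationSum G n β u := by
  have hθ : 2 * S + 1 = (n : ℝ) + 1 := by rw [hS]; ring
  have hn0 : (0 : ℝ) < n := Nat.cast_pos.mpr hn
  rw [hθ]
  refine ⟨fun V _ _ G _ β u hβ hu0 hu1 => ?_,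
    -- The witness for `K`: the numerator is the constant of `trace_commutator_le`, the denominator
    -- is `S (S + 1)/3`, and the final `1/2` comes from `duhamel_bounds`.
    √(4 * (n : ℝ) ^ 2 * (n + 1) / ((n : ℝ) * (n + 2) / 12)) / 2,
    fun V _ _ G _ β u hβ hu0 hu1 => ?_⟩
  · obtain ⟨h1, h2, h3⟩ := LoopModel.loopMeasure_facts (G := G) n hn hβ hu0 hu1
    obtain ⟨h4, h5⟩ := LoopModel.logPartition_facts G n β u
    refine ⟨h1, h2, h4, ?_⟩
    rw [h3, h5, hS]
    field_simp
    ring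
  · have hcoef : 3 * β / (S * (S + 1)) = β / ((n : ℝ) * (n + 2) / 12) := by
      rw [hS]
      field_simp
      ring
    rw [hcoef]
    exact LoopModel.expectedTotalLength_bounds G n hn hβ hu0 hu1
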